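/- Let $p$ be a prime, $n\ge 1$, and let $K/F$ be a cyclic Galois extension of degree $p^n$ with group $G=\langle\sigma\rangle$. Suppose $F$ contains a primitive $p$-th root of unity $\xi_p$ and, if $p=2$ and $n=1$, that $-1\in N_{K/F}(K^\times)$. For $0\le i\le n$ let $K_i$ be the intermediate field of degree $p^i$ over $F$, $G_i=\mathrm{Gal}(K_i/F)$, and put $K_{-\infty}^\times=\{1\}$; for $i=0$ read $K_{i-1}^\times$ as $K_{-\infty}^\times$. For $m\ge 1$ let $R_m=\mathbb{Z}/p^m\mathbb{Z}$ and let $J_m=K^\times/K^{\times p^m}$, an $R_mG$-module. Write $[\gamma]_m$ for the class of $\gamma\in K^\times$, and $\langle\cdot\rangle$ for the $R_mG$-submodule generated. Write $K^\times$ additively (so $0$ denotes $1\in K^\times$). Put $U_i=1+p^i\mathbb{Z}$. Definitions. Let $\mathbf a=(a_0,\dots,a_{m-1})\in\{-\infty,0,\dots,n\}^m$ with $a_0<n$, and $d\in U_1$. A pair $(\alpha,\{\delta_i\}_{i=0}^m)$ with $\alpha,\delta_m\in K^\times$ and $\delta_i\in K_{a_i}^\times$ for $0\le i<m$ *represents*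 $(\mathbf a,d)$ if $$(\sigma-d)\alpha=\sum_{i=0}^m p^i\delta_i,\qquad \xi_p=\tfrac{d-1}{p}N_{K/F}(\alpha)+N_{K_{n-1}/F}(\delta_0)+\sum_{i=1}^m p^{i-1}N_{K/F}(\delta_i).$$ If such a pair exists, $(\mathbf a,d)$ is a *norm pair of length $m$*. For $d,d'\in U_1$ write $d\le_m d'$ if $d'\in U_i$ implies $d\in U_i$ for all $1\le i\le m$, except that if $p=2$ and $d,d'\notin U_2$, then $d\le_m d'$ means that $d'\in -U_i$ implies $d\in -U_i$ for all $2\le i\le m$. Order vectors lexicographically. A norm pair $(\mathbf a,d)$ of length $m$ is *minimal* if for every norm pair $(\mathbf a',d')$ of length $m$ either $\mathbf a<\mathbf a'$, or $\mathbf a=\mathbf a'$ and $d\le_m d'$. An *$m$-exceptional module* is a submodule of $J_m$ of the form $$X(\alpha,\{\delta_i\},d,m)=\langle[\alpha]_m,[\delta_1]_m,\dots,[\delta_{m-1}]_m\rangle,$$ where $(\alpha,\{\delta_i\})$ represents a minimal norm pair $(\mathbf a,d)$ of length $m$. Given such $(\alpha,\{\delta_i\})$, let $\mathcal X_m=\{\alpha,\delta_1,\dots,\delta_{m-1}\}\setminus\{0\}$.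 Call a set $\mathcal T\subseteq K^\times$ a *complementary basis set* if $$J_1=\bigoplus_{x\in\mathcal X_m}\langle[x]_1\rangle\oplus\bigoplus_{t\in\mathcal T}\langle[t]_1\rangle$$ and, for every $0\le i\le n$ and every $t\in\mathcal T\cap(K_i^\times\setminus K_{i-1}^\times)$, $\langle[t]_1\rangle$ is a free $\mathbb{F}_pG_i$-module of rank one. **Proposition 7.1.** Every $m$-exceptional module $X$ is a direct summand of the $R_mG$-module $J_m$. More precisely, if $X=X(\alpha,\{\delta_i\},d,m)$ with $(\alpha,\{\delta_i\})$ representing a minimal norm pair of length $m$, then a complementary basis set $\mathcal T$ exists, and for every complementary basis set $\mathcal T$, $$J_m=X\oplus\sum_{t\in\mathcal T}\langle[t]_m\rangle.$$ -/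

import Mathlib

noncomputable section

namespace PowerClasses

/-! ### The Galois module of power classes

`K/F` is a field extension with Galois group `G = K ≃ₐ[F] K`, `R_m = ZMod (p ^ m)`, and the group
ring `R_m G` is `MonoidAlgebra (ZMod (p ^ m)) (K ≃ₐ[F] K)`. -/

section Module

variable (F K : Type*) [Field F] [Field K] [Algebra F K] (p m : ℕ)

/-- `J_m = Kˣ / Kˣ^(p^m)`, written additively. -/
def J (K : Type*) [Field K] (p m : ℕ) : Type _ := ModN (Additive Kˣ) (p ^ m)

instance : AddCommGroup (J K p m) :=
  inferInstanceAs (AddCommGroup (ModN (Additive Kˣ) (p ^ m)))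

instance : Module (ZMod (p ^ m)) (J K p m) :=
  inferInstanceAs (Module (ZMod (p ^ m)) (ModN (Additive Kˣ) (p ^ m)))

variable {K} in
/-- The class `[γ]_m` of `γ ∈ Kˣ` in `J_m`. -/
def cls (γ : Kˣ) : J K p m := ModN.mkQ (p ^ m) (Additive.ofMul γ)

variable {F K} in
/-- The action of `g ∈ Gal(K/F)` on `Kˣ`. -/
def act (g : K ≃ₐ[F] K) : Kˣ →* Kˣ := Units.map (g : K →* K)

variable {F K} in
/-- The additive endomorphism of `J_m` induced by `g ∈ Gal(K/F)`. -/
def actJ (g : K ≃ₐ[F] K) : J K p m →+ J K p m :=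
  (Submodule.mapQ (LinearMap.range (LinearMap.lsmul ℤ (Additive Kˣ) ((p ^ m : ℕ) : ℤ)))
    (LinearMap.range (LinearMap.lsmul ℤ (Additive Kˣ) ((p ^ m : ℕ) : ℤ)))
    (MonoidHom.toAdditive (act g)).toIntLinearMap
    (by
      rintro _ ⟨y, rfl⟩
      exact ⟨MonoidHom.toAdditive (act g) y, by simp⟩)).toAddMonoidHom

variable {F K} in
theorem actJ_cls (g : K ≃ₐ[F] K) (γ : Kˣ) : actJ p m g (cls p m γ) = cls p m (act g γ) := rfl

variable {K} in
theorem cls_surjective : Function.Surjective (cls (K := K) p m) := fun x =>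
  (Submodule.mkQ_surjective _ x).imp fun _ h => h

/-- `J_m` as an `R_m`-linear representation of `G`. -/
def galRep : Representation (ZMod (p ^ m)) (K ≃ₐ[F] K) (J K p m) where
  toFun g := (actJ p m g).toZModLinearMap (p ^ m)
  map_one' := by
    ext x
    obtain ⟨γ, rfl⟩ := cls_surjective p m x
    rfl
  map_mul' g h := by
    ext x
    obtain ⟨γ, rfl⟩ := cls_surjective p m x
    rfl

/-- `J_m` as an `R_m G`-module. -/
instance : Module (MonoidAlgebra (ZMod (p ^ m)) (K ≃ₐ[F] K)) (J K p m) :=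
  Module.compHom (J K p m) (galRep F K p m).asAlgebraHom.toRingHom

variable {F K} in
theorem of_smul_cls (g : K ≃ₐ[F] K) (γ : Kˣ) :
    MonoidAlgebra.of (ZMod (p ^ m)) (K ≃ₐ[F] K) g • cls p m γ = cls p m (act g γ) :=
  LinearMap.congr_fun (Representation.asAlgebraHom_of (galRep F K p m) g) (cls p m γ)

variable {K} in
/-- The cyclic `R_m G`-submodule `⟨[γ]_m⟩` of `J_m`. -/
def cyc (γ : Kˣ) : Submodule (MonoidAlgebra (ZMod (p ^ m)) (K ≃ₐ[F] K)) (J K p m) :=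
  Submodule.span _ {cls p m γ}

end Module

/-! ### Intermediate fields, norm pairs, exceptional modules

From here on `K/F` is meant to be cyclic of degree `p ^ n` with `σ` a generator of its group. -/

section NormPairs

variable {F K : Type*} [Field F] [Field K] [Algebra F K] (p n m : ℕ) (σ : K ≃ₐ[F] K)

/-- `K_i`, the intermediate field of degree `p ^ i` over `F`: the fixed field of `σ ^ (p ^ i)`. -/
def stage (i : ℕ) : IntermediateField F K :=
  IntermediateField.fixedField (Subgroup.zpowers (σ ^ p ^ i))

/-- `K_iˣ` as a subset of `Kˣ`, with `⊥` standing for `-∞` and `K_{-∞}ˣ = {1}`. -/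
def stageUnits : WithBot ℕ → Set Kˣ
  | ⊥ => {1}
  | (i : ℕ) => {u | (u : K) ∈ stage p σ i}

/-- The index preceding `i`, where `-∞` precedes `0`. -/
def prev : ℕ → WithBot ℕ
  | 0 => ⊥
  | i + 1 => (i : WithBot ℕ)

/-- `U_i = 1 + p^i ℤ`. -/
def U (i : ℕ) : Set ℤ := {d | (p : ℤ) ^ i ∣ d - 1}

/-- `(α, {δ_i}_{0 ≤ i ≤ m})` represents the norm pair `(a, d)` of length `m`. In additive notation
for `Kˣ`, the two equations are `(σ - d) α = ∑_{i=0}^m p^i δ_i` and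
`ξ = ((d - 1) / p) N_{K/F}(α) + N_{K_{n-1}/F}(δ_0) + ∑_{i=1}^m p^(i-1) N_{K/F}(δ_i)`. -/
structure Represents [NeZero m] (ξ : F) (a : Fin m → WithBot ℕ) (d : ℤ)
    (α : Kˣ) (δ : Fin (m + 1) → Kˣ) : Prop where
  a_le : ∀ i, a i ≤ (n : WithBot ℕ)
  a_zero_lt : a 0 < (n : WithBot ℕ)
  d_mem : d ∈ U p 1
  δ_mem : ∀ i : Fin m, δ i.castSucc ∈ stageUnits p σ (a i)
  eq_act : act σ α / α ^ d = ∏ i : Fin (m + 1), δ i ^ p ^ (i : ℕ)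
  eq_norm : ∃ η : stage p σ (n - 1), (η : K) = δ 0 ∧
    ξ = Algebra.norm F (α : K) ^ ((d - 1) / (p : ℤ)) * Algebra.norm F η *
      ∏ i : Fin m, Algebra.norm F (δ i.succ : K) ^ p ^ (i : ℕ)

/-- `(a, d)` is a norm pair of length `m`. -/
def IsNormPair [NeZero m] (ξ : F) (a : Fin m → WithBot ℕ) (d : ℤ) : Prop :=
  ∃ (α : Kˣ) (δ : Fin (m + 1) → Kˣ), Represents p n m σ ξ a d α δ

/-- The relation `d ≤_m d'` on twists: the first clause is the exceptional case, where `p = 2` and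
neither twist lies in `U_2`; the second clause covers all other cases. -/
def TwistLE (d d' : ℤ) : Prop :=
  ((p = 2 ∧ d ∉ U p 2 ∧ d' ∉ U p 2) → ∀ i, 2 ≤ i → i ≤ m → -d' ∈ U p i → -d ∈ U p i) ∧
  (¬(p = 2 ∧ d ∉ U p 2 ∧ d' ∉ U p 2) → ∀ i, 1 ≤ i → i ≤ m → d' ∈ U p i → d ∈ U p i)

/-- The relation `(a, d) ≼_m (a', d')`: lexicographic, the vectors themselves being ordered
lexicographically. -/
def PairLE (a : Fin m → WithBot ℕ) (d : ℤ) (a' : Fin m → WithBot ℕ) (d' : ℤ) : Prop :=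
  toLex a < toLex a' ∨ (a = a' ∧ TwistLE p m d d')

/-- `(a, d)` is a minimal norm pair of length `m`. -/
def IsMinimalNormPair [NeZero m] (ξ : F) (a : Fin m → WithBot ℕ) (d : ℤ) : Prop :=
  IsNormPair p n m σ ξ a d ∧ ∀ a' d', IsNormPair p n m σ ξ a' d' → PairLE p m a d a' d'

/-- The set `{δ_1, …, δ_{m-1}}`. -/
def innerδ (δ : Fin (m + 1) → Kˣ) : Set Kˣ :=
  {x | ∃ i : Fin (m + 1), 1 ≤ (i : ℕ) ∧ (i : ℕ) < m ∧ x = δ i}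

variable (F) in
/-- `X(α, {δ_i}, d, m) = ⟨[α]_m, [δ_1]_m, …, [δ_{m-1}]_m⟩ ⊆ J_m`. -/
def excModule (α : Kˣ) (δ : Fin (m + 1) → Kˣ) :
    Submodule (MonoidAlgebra (ZMod (p ^ m)) (K ≃ₐ[F] K)) (J K p m) :=
  Submodule.span _ (cls p m '' insert α (innerδ m δ))

/-- `X` is an `m`-exceptional module. -/
def IsExceptionalModule [NeZero m] (ξ : F)
    (X : Submodule (MonoidAlgebra (ZMod (p ^ m)) (K ≃ₐ[F] K)) (J K p m)) : Prop :=
  ∃ (a : Fin m → WithBot ℕ) (d : ℤ) (α : Kˣ) (δ : Fin (m + 1) → Kˣ),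
    IsMinimalNormPair p n m σ ξ a d ∧ Represents p n m σ ξ a d α δ ∧ X = excModule F p m α δ

/-- The set `𝒳_m = {α, δ_1, …, δ_{m-1}} \ {1}` (`1` being the zero of `Kˣ` in additive
notation). -/
def basisPart (α : Kˣ) (δ : Fin (m + 1) → Kˣ) : Set Kˣ :=
  insert α (innerδ m δ) \ {1}

/-- `⟨[t]_1⟩` is a free `𝔽_p G_i`-module of rank one, where `G_i = Gal(K_i/F)`, that is,
`G_i = G / ⟨σ ^ (p ^ i)⟩`: there is a `G`-equivariant `𝔽_p`-linear isomorphism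
`⟨[t]_1⟩ ≃ 𝔽_p[G_i]`, with `G` acting on `𝔽_p[G_i]` by translations of `G_i`. -/
def IsFreeOverG (i : ℕ) (t : Kˣ) : Prop :=
  Nonempty (cyc F p 1 t ≃ₗ[MonoidAlgebra (ZMod (p ^ 1)) (K ≃ₐ[F] K)]
    (Representation.ofMulAction (ZMod (p ^ 1)) (K ≃ₐ[F] K)
      ((K ≃ₐ[F] K) ⧸ Subgroup.zpowers (σ ^ p ^ i))).asModule)

open scoped Classical in
/-- `T ⊆ Kˣ` is a complementary basis set: `J_1` is the internal direct sum of the `⟨[x]_1⟩`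
(`x ∈ 𝒳_m`) and the `⟨[t]_1⟩` (`t ∈ T`), and for `t ∈ T ∩ (K_iˣ \ K_{i-1}ˣ)` the module `⟨[t]_1⟩`
is free of rank one over `𝔽_p G_i`. -/
structure IsComplementaryBasis (α : Kˣ) (δ : Fin (m + 1) → Kˣ) (T : Set Kˣ) : Prop where
  isInternal : DirectSum.IsInternal
    (fun s : basisPart m α δ ⊕ T => cyc F p 1 (Sum.elim Subtype.val Subtype.val s))
  free : ∀ i, i ≤ n → ∀ t ∈ T, t ∈ stageUnits p σ (i : WithBot ℕ) →
    t ∉ stageUnits p σ (prev i) → IsFreeOverG p σ i t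

end NormPairs

end PowerClasses

end

open PowerClasses

/-! Write `Kˣ` additively as a module `M` with `σ` acting, put `τ = σ - 1` and `N_k = 1 + σ + ⋯ +
σ^(p^k - 1)`, and let `X`, `S` be the submodules of `M` generated by the nonzero elements among `α,
δ_1, …, δ_{m-1}` and by `𝒯`. Modulo `p`, `N_k` is `τ^(p^k - 1)`, so cyclic submodules of `J_1` are
uniserial, and independence of cyclic modules can be tested on their socles. The socle of `⟨[t]_1⟩`,
for `t ∈ K_k` with `N_k t ∉ pM`, is spanned by the class of `N_k t`. The classes of the norms `N_k
K_k` form a filtration of a subspace of `J_1`, decreasing in `k`, and a decomposition of `J_1` comes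
from a basis adapted to it.

Hilbert 90 and Kummer generators show that an element of `K_k`, `k < n`, whose norm is divisible by
`p` lies in `K_{k-1} + τ K_k + pM` (`exists_decomp`); at the top stage one extra reference element
is needed (`exists_decomp_top`). If `a_j = k` and `N_k δ_j` were, modulo `p`, a norm from `K_{k+1}`,
such a decomposition of `δ_j` could be redistributed over the other entries to represent a smaller
vector. Minimality therefore gives `LexMin.normSum_smul_ne`; when `a_0 = -∞`, the norm equation
gives `α ∉ F + pM`. So the socles of the exceptional generators extend to an adapted basis
(`LexMin.exists_basis`), the new vectors form `𝒯`, and `LexMin.eq_top` shows that everything is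
generated.

Passing from `p` to `p^m`, spanning is by iteration. For the intersection, a relation `y + s ∈
p^(j+1) M` with `y ∈ X`, `s ∈ S` splits modulo `p`, giving `y ∈ pX + p^m M` and `s ∈ pS`. Dividing
by `p` costs a multiple of `ξ`. The norm equation says exactly that `ξ ∈ X + p^(m-1) M`
(`Rep.exists_xi_eq`), so the ambiguity is absorbed into `X` and induction proceeds
(`exists_eq_of_add_eq_pow_smul`). -/

open PowerClasses

/-! ### Norm elements of a cyclic `p`-group -/

namespace KummerModule

open Finset

section Ring

variable {A : Type*} [CommRing A] (p : ℕ) (σ : A)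

/-- `1 + σ + ⋯ + σ ^ (p ^ k - 1)`, the norm element of the quotient of order `p ^ k`. -/
def normSum (k : ℕ) : A := ∑ j ∈ range (p ^ k), σ ^ j

/-- The norm element of the group of order `p` generated by the class of `σ ^ (p ^ k)`. -/
def stepSum (k : ℕ) : A := ∑ j ∈ range p, (σ ^ p ^ k) ^ j

@[simp] theorem normSum_zero : normSum p σ 0 = 1 := by simp [normSum]

theorem sub_one_mul_normSum (k : ℕ) : (σ - 1) * normSum p σ k = σ ^ p ^ k - 1 :=
  mul_geom_sum σ (p ^ k)

theorem geom_sum_mul_range (q r : ℕ) :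
    ∑ i ∈ range (q * r), σ ^ i = (∑ j ∈ range r, (σ ^ q) ^ j) * ∑ i ∈ range q, σ ^ i := by
  induction r with
  | zero => simp
  | succ r ih =>
    rw [Nat.mul_succ, sum_range_add, ih, sum_range_succ, add_mul]
    simp only [pow_add, pow_mul, mul_sum]

theorem normSum_succ (k : ℕ) : normSum p σ (k + 1) = stepSum p σ k * normSum p σ k := by
  rw [normSum, pow_succ, geom_sum_mul_range]; rfl

theorem sub_one_mul_stepSum (k : ℕ) :
    (σ ^ p ^ k - 1) * stepSum p σ k = σ ^ p ^ (k + 1) - 1 := by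
  rw [stepSum, mul_geom_sum, ← pow_mul, pow_succ]

theorem exists_stepSum_eq (k : ℕ) : ∃ Φ : A, stepSum p σ k = p + (σ ^ p ^ k - 1) * Φ := by
  have : (σ ^ p ^ k - 1) ∣ ∑ j ∈ range p, ((σ ^ p ^ k) ^ j - 1) :=
    dvd_sum fun j _ => sub_one_dvd_pow_sub_one _ j
  obtain ⟨Φ, h⟩ := this
  refine ⟨Φ, ?_⟩
  rw [← h, sum_sub_distrib, stepSum]
  simp

theorem exists_normSum_eq_mul {k l : ℕ} (h : k ≤ l) : ∃ R : A,
    normSum p σ l = normSum p σ k * R ∧ (σ ^ p ^ k - 1) * R = σ ^ p ^ l - 1 := by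
  induction l, h using Nat.le_induction with
  | base => exact ⟨1, by simp, by simp⟩
  | succ l _ ih =>
    obtain ⟨R, h1, h2⟩ := ih
    refine ⟨stepSum p σ l * R, ?_, ?_⟩
    · rw [normSum_succ, h1]; ring
    · rw [← sub_one_mul_stepSum, ← h2]; ring

theorem sub_one_dvd_pow_pow_sub_one {k l : ℕ} (h : k ≤ l) : (σ ^ p ^ k - 1) ∣ (σ ^ p ^ l - 1) :=
  let ⟨R, _, h2⟩ := exists_normSum_eq_mul p σ h; ⟨R, h2.symm⟩

open Polynomial in
-- Over `𝔽_p[X]` both sides become `X^(p^k) - 1` after multiplication by `X - 1`, which cancels. The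
-- resulting congruence in `ℤ[X]` is evaluated at `σ`.
theorem exists_normSum_eq_sub_one_pow (hp : p.Prime) (k : ℕ) :
    ∃ g : A, normSum p σ k = (σ - 1) ^ (p ^ k - 1) + p * g := by
  have := Fact.mk hp
  have key : (p : ℤ[X]) ∣ normSum p X k - (X - 1) ^ (p ^ k - 1) := by
    rw [← Int.cast_natCast (R := ℤ[X]), ← eq_intCast (C : ℤ →+* ℤ[X]), C_dvd_iff_dvd_coeff]
    intro i
    rw [← ZMod.intCast_zmod_eq_zero_iff_dvd, ← eq_intCast (Int.castRingHom (ZMod p)), ← coeff_map]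
    suffices h : (normSum p X k - (X - 1) ^ (p ^ k - 1) : ℤ[X]).map (Int.castRingHom (ZMod p)) = 0 by
      rw [h, coeff_zero]
    have hX : (X - 1 : (ZMod p)[X]) ≠ 0 := by simpa using X_sub_C_ne_zero (1 : ZMod p)
    refine mul_left_cancel₀ hX ?_
    have h1 : (X - 1 : (ZMod p)[X]) * (X - 1) ^ (p ^ k - 1) = X ^ p ^ k - 1 := by
      rw [← pow_succ', Nat.sub_add_cancel (Nat.one_le_pow _ _ hp.pos), sub_pow_char_pow, one_pow]
    simp only [normSum, Polynomial.map_sub, Polynomial.map_sum, Polynomial.map_pow, map_X,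
      Polynomial.map_one, mul_sub, mul_geom_sum, h1, sub_self, mul_zero]
  obtain ⟨g, hg⟩ := key
  refine ⟨aeval σ g, ?_⟩
  have := congrArg (aeval σ) hg
  simp only [normSum, map_sub, map_sum, map_pow, aeval_X, map_one, map_mul, map_natCast] at this
  rw [normSum]
  linear_combination this

theorem exists_sub_one_pow_eq (hp : p.Prime) (k : ℕ) :
    ∃ g : A, (σ - 1) ^ p ^ k = (σ ^ p ^ k - 1) + p * g := by
  obtain ⟨g, hg⟩ := exists_normSum_eq_sub_one_pow p σ hp k
  refine ⟨-((σ - 1) * g), ?_⟩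
  have h1 : (σ - 1) ^ p ^ k = (σ - 1) * (σ - 1) ^ (p ^ k - 1) := by
    rw [← pow_succ', Nat.sub_add_cancel (Nat.one_le_pow _ _ hp.pos)]
  rw [h1, ← sub_one_mul_normSum, hg]; ring

end Ring

end KummerModule

/-! ### Hilbert 90 and elements whose norm is divisible by `p` -/

namespace KummerModule

open Finset

section Setup

variable {A M : Type*} [CommRing A] [AddCommGroup M] [Module A M] (p n : ℕ) (σ : A)

variable (M) in
/-- The elements of `M` fixed by `σ ^ (p ^ k)`. -/
def fixedBy (k : ℕ) : Submodule A M := LinearMap.ker (LinearMap.lsmul A M (σ ^ p ^ k - 1))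

theorem mem_fixedBy {k : ℕ} {x : M} : x ∈ fixedBy M p σ k ↔ (σ ^ p ^ k - 1) • x = 0 := Iff.rfl

variable (M) in
/-- `fixedBy` extended to `⊥` by the zero submodule. -/
def fixedBot : WithBot ℕ → Submodule A M
  | ⊥ => ⊥
  | (k : ℕ) => fixedBy M p σ k

variable (M) in
/-- The fixed points at the level preceding `k`. -/
def fixedPrev (k : ℕ) : Submodule A M := fixedBot M p σ (prev k)

theorem fixedBy_mono {k l : ℕ} (h : k ≤ l) : fixedBy M p σ k ≤ fixedBy M p σ l := by
  intro x hx
  obtain ⟨R, hR⟩ := sub_one_dvd_pow_pow_sub_one p σ h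
  rw [mem_fixedBy] at hx ⊢
  rw [hR, mul_comm, mul_smul, hx, smul_zero]

/-- The module-theoretic properties of the multiplicative group of a cyclic extension of degree
`p ^ n` that contains `p`-th roots of unity generated by a fixed element `ξ`. -/
structure IsKummer (ξ : M) : Prop where
  prime : p.Prime
  pos : 1 ≤ n
  period : ∀ x : M, (σ ^ p ^ n - 1) • x = 0
  hilbert90 : ∀ k < n, ∀ x ∈ fixedBy M p σ (k + 1), stepSum p σ k • x = 0 →
    ∃ y ∈ fixedBy M p σ (k + 1), x = (σ ^ p ^ k - 1) • y
  torsion : ∀ x : M, (p : A) • x = 0 → ∃ c : ℤ, x = (c : A) • ξ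
  fixed : (σ - 1) • ξ = 0
  p_smul : (p : A) • ξ = 0
  ne_zero : ξ ≠ 0

variable {p n σ} {ξ : M}

theorem sub_one_smul_eq_zero {k : ℕ} {x : M} (h : (σ - 1) • x = 0) : (σ ^ p ^ k - 1) • x = 0 := by
  rw [← sub_one_mul_normSum, mul_comm, mul_smul, h, smul_zero]

theorem stepSum_smul {k : ℕ} {x : M} (h : x ∈ fixedBy M p σ k) : stepSum p σ k • x = (p : A) • x := by
  obtain ⟨Φ, hΦ⟩ := exists_stepSum_eq p σ k
  linear_combination (norm := module) hΦ • x + Φ • (mem_fixedBy p σ).1 h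

theorem normSum_smul_fixed {k : ℕ} {x : M} (h : (σ - 1) • x = 0) :
    normSum p σ k • x = ((p : A) ^ k) • x := by
  induction k with
  | zero => simp
  | succ k ih =>
    have := stepSum_smul (p := p) (k := k) (sub_one_smul_eq_zero (p := p) (k := k) h)
    rw [normSum_succ, mul_smul, ih, smul_comm, this, pow_succ, mul_smul]

theorem mem_fixedBy_zero {x : M} : x ∈ fixedBy M p σ 0 ↔ (σ - 1) • x = 0 := by
  rw [mem_fixedBy, pow_zero, pow_one]

namespace IsKummer

variable (H : IsKummer p n σ ξ)

include H

theorem mem_top {x : M} : x ∈ fixedBy M p σ n := H.period x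

theorem mem_of_le {k : ℕ} (h : n ≤ k) (x : M) : x ∈ fixedBy M p σ k :=
  fixedBy_mono p σ h H.mem_top

/-- The step norm of `ξ` is `p ξ = 0`, so Hilbert 90 provides a Kummer generator of stage `k + 1`
over stage `k`. -/
theorem exists_kummer {k : ℕ} (hk : k < n) :
    ∃ θ ∈ fixedBy M p σ (k + 1), (σ ^ p ^ k - 1) • θ = ξ := by
  have h0 : ∀ l, ξ ∈ fixedBy M p σ l := fun l => sub_one_smul_eq_zero H.fixed
  obtain ⟨θ, h1, h2⟩ := H.hilbert90 k hk ξ (h0 _) (by rw [stepSum_smul (h0 k), H.p_smul])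
  exact ⟨θ, h1, h2.symm⟩

/-- The element `N_k ω - f` has step norm zero, hence equals `(σ^(p^k) - 1) η`. Then `σ^(p^k) - 1`
sends `ω - (σ - 1) η` to `(σ - 1) f = 0`. -/
theorem exists_decomp_of_fixed {k : ℕ} (hk : k < n) {ω f : M} (hω : ω ∈ fixedBy M p σ (k + 1))
    (hf : (σ - 1) • f = 0) (h : normSum p σ (k + 1) • ω = (p : A) • f) :
    ∃ v ∈ fixedBy M p σ k, ∃ η ∈ fixedBy M p σ (k + 1), ω = v + (σ - 1) • η := by
  have hf' : ∀ l, f ∈ fixedBy M p σ l := fun l => sub_one_smul_eq_zero hf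
  obtain ⟨η, h1, h2⟩ := H.hilbert90 k hk (normSum p σ k • ω - f)
    (sub_mem (Submodule.smul_mem _ _ hω) (hf' _))
    (by rw [smul_sub, ← mul_smul, ← normSum_succ, h, stepSum_smul (hf' k), sub_self])
  refine ⟨ω - (σ - 1) • η, ?_, η, h1, by module⟩
  rw [mem_fixedBy]
  have e := sub_one_mul_normSum p σ k
  linear_combination (norm := module) (-e) • (ω - (σ - 1) • η) + (σ - 1) • h2 + hf - (σ - 1) • e • η

theorem sub_one_smul_of_p_smul {x : M} (h : (σ - 1) • (p : A) • x = 0) :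
    ∃ c : ℤ, (σ - 1) • x = (c : A) • ξ :=
  H.torsion _ (by rw [smul_comm, h])

omit H in
theorem normSum_fixed {k : ℕ} {x : M} (h : x ∈ fixedBy M p σ k) :
    (σ - 1) • normSum p σ k • x = 0 := by
  rw [← mul_smul, sub_one_mul_normSum]; exact h

/-- The obstruction to `exists_decomp_of_fixed` is that `l` need not be fixed: `(σ - 1) l = c ξ`. A
Kummer generator `θ` of the next stage satisfies `(σ - 1) N_k θ = ξ` and `p θ ∈ K_k`, so subtracting
`c p θ` from `u` removes it. At `k = 0`, `l` itself serves as `z`. -/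
theorem exists_decomp {k : ℕ} (hk : k < n) {u l : M} (hu : u ∈ fixedBy M p σ k)
    (h : normSum p σ k • u = (p : A) • l) :
    ∃ v ∈ fixedPrev M p σ k, ∃ η ∈ fixedBy M p σ k, ∃ z ∈ fixedBy M p σ (k + 1),
      (∃ c : ℤ, (σ ^ p ^ k - 1) • z = (c : A) • ξ) ∧ u = v + (σ - 1) • η + (p : A) • z := by
  obtain ⟨c, hc⟩ := H.sub_one_smul_of_p_smul (by rw [← h]; exact normSum_fixed hu)
  cases k with
  | zero =>
    refine ⟨0, zero_mem _, 0, zero_mem _, l, ?_, ⟨c, by simpa using hc⟩, by simpa using h⟩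
    obtain ⟨g, hg⟩ := exists_stepSum_eq p σ 0
    have e := sub_one_mul_stepSum p σ 0
    rw [mem_fixedBy]
    have e2 : (σ - 1) • (σ - 1) • l = 0 := by rw [hc, smul_comm, H.fixed, smul_zero]
    simp only [pow_zero, pow_one] at hg e
    have e3 : (σ ^ p ^ (0 + 1) - 1) • l = (p : A) • (σ - 1) • l + g • (σ - 1) • (σ - 1) • l := by
      rw [← e, hg]; module
    rw [e3, e2, hc, smul_comm, H.p_smul]; simp
  | succ k =>
    obtain ⟨θ, hθ, hθ'⟩ := H.exists_kummer hk
    have e := sub_one_mul_normSum p σ (k + 1)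
    obtain ⟨v, hv, η, hη, huv⟩ := H.exists_decomp_of_fixed (k := k) (by omega)
      (ω := u - (c : A) • (p : A) • θ) (f := l - (c : A) • normSum p σ (k + 1) • θ)
      (sub_mem hu (Submodule.smul_mem _ _ (by
        rw [mem_fixedBy, smul_comm, hθ', H.p_smul])))
      (by linear_combination (norm := module) hc - (c : A) • e • θ - (c : A) • hθ')
      (by linear_combination (norm := module) h)
    refine ⟨v, hv, η, hη, (c : A) • θ, Submodule.smul_mem _ _ hθ, ⟨c, ?_⟩, ?_⟩
    · rw [smul_comm, hθ']
    · linear_combination (norm := module) huv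

/-- There is no stage above `n` to supply a Kummer generator; `w` plays the role of `p θ` in
correcting `l` to a fixed element. -/
theorem exists_decomp_top {u l w l' : M} (h : normSum p σ n • u = (p : A) • l)
    (hw : normSum p σ n • w = (p : A) • l') (hl' : (σ - 1) • l' = ξ) :
    ∃ c : ℤ, ∃ v ∈ fixedBy M p σ (n - 1), ∃ η, u = (c : A) • w + v + (σ - 1) • η := by
  obtain ⟨c, hc⟩ := H.sub_one_smul_of_p_smul (by rw [← h]; exact normSum_fixed H.mem_top)
  have hn : n - 1 + 1 = n := Nat.sub_add_cancel H.pos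
  obtain ⟨v, hv, η, hη, huv⟩ := H.exists_decomp_of_fixed (k := n - 1) (by omega)
      (ω := u - (c : A) • w) (f := l - (c : A) • l') (by rw [hn]; exact H.mem_top)
      (by linear_combination (norm := module) hc - (c : A) • hl')
      (by rw [hn]; linear_combination (norm := module) h - (c : A) • hw)
  exact ⟨c, v, hv, η, by linear_combination (norm := module) huv⟩

theorem normSum_top : normSum p σ n = stepSum p σ (n - 1) * normSum p σ (n - 1) := by
  rw [← normSum_succ, Nat.sub_add_cancel H.pos]

/-- Source of the reference elements for `exists_decomp_top`. Writing the step norm as `p +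
(σ^(p^(n-1)) - 1) Φ`, it sends `x` to `p (x + Φ y)`, and `l = N_{n-1} (x + Φ y)` works. -/
theorem normSum_top_of_step {x y : M} (hx : (σ ^ p ^ (n - 1) - 1) • x = (p : A) • y)
    (hy : stepSum p σ (n - 1) • y = ξ) :
    ∃ l, normSum p σ n • x = (p : A) • l ∧ (σ - 1) • l = ξ := by
  obtain ⟨Φ, hΦ⟩ := exists_stepSum_eq p σ (n - 1)
  have e := sub_one_mul_normSum p σ (n - 1)
  refine ⟨normSum p σ (n - 1) • (x + Φ • y), ?_, ?_⟩
  · rw [H.normSum_top]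
    linear_combination (norm := module)
      (normSum p σ (n - 1) * hΦ) • x + (normSum p σ (n - 1) * Φ) • hx
  · linear_combination (norm := module) e • (x + Φ • y) + hx + hy - hΦ • y

/-- For `n > 1`, `N_{n-1} x` lies in stage `n - 1`, because `N_{n-1} ξ = p^(n-1) ξ = 0`. For `n = 1`
the step norm differs from `p` by the multiple `c p (p - 1) / 2` of `ξ`, which vanishes when `p` is
odd. -/
theorem normSum_top_kummer (hpn : p ≠ 2 ∨ n ≠ 1) {x : M} {c : ℤ}
    (hx : (σ ^ p ^ (n - 1) - 1) • x = (c : A) • ξ) :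
    normSum p σ n • x = (p : A) • normSum p σ (n - 1) • x := by
  have e := sub_one_mul_normSum p σ (n - 1)
  have hfix : ∀ l, ξ ∈ fixedBy M p σ l := fun l => sub_one_smul_eq_zero H.fixed
  rw [H.normSum_top, mul_smul]
  by_cases hn : n = 1
  · subst hn
    have hp2 := hpn.resolve_right (by simp)
    simp only [Nat.sub_self, normSum_zero, one_smul, pow_zero, pow_one] at hx ⊢
    have hj : ∀ j : ℕ, σ ^ j • x = x + ((j * c : ℤ) : A) • ξ := by
      intro j
      induction j with
      | zero => simp
      | succ j ih =>
        have h1 := H.fixed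
        rw [pow_succ', mul_smul, ih]
        push_cast
        linear_combination (norm := module) hx + ((j * c : A)) • h1
    have : stepSum p σ 0 • x = (p : A) • x + ((∑ j ∈ range p, j : ℕ) : A) • (c : A) • ξ := by
      simp only [stepSum, pow_zero, pow_one, sum_smul, hj, sum_add_distrib, sum_const, card_range]
      push_cast
      rw [sum_smul, ← Nat.cast_smul_eq_nsmul A]
      simp only [mul_smul]
    rw [this, sum_range_id]
    obtain ⟨q, hq⟩ : 2 ∣ p - 1 := by
      rcases H.prime.eq_two_or_odd with h | h
      · exact absurd h hp2
      · omega
    rw [hq, mul_left_comm, Nat.mul_div_cancel_left _ (by norm_num), Nat.cast_mul, mul_comm, mul_smul,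
      smul_comm (p : A), H.p_smul]
    simp
  · refine stepSum_smul ?_
    obtain ⟨r, hr⟩ : ∃ r, n - 1 = r + 1 := ⟨n - 2, by have := H.pos; omega⟩
    rw [mem_fixedBy, smul_comm, hx, smul_comm, normSum_smul_fixed H.fixed, hr, pow_succ, mul_smul,
      H.p_smul, smul_zero, smul_zero]

end IsKummer

end Setup

end KummerModule

/-! ### Representations of norm pairs and lexicographic minimality -/

namespace KummerModule

open Finset

section Setup

variable {A M : Type*} [CommRing A] [AddCommGroup M] [Module A M] (p n m : ℕ) (σ : A)

/-- `∑_{i=0}^m p^i δ_i`. -/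
def weightSum (δ : ℕ → M) : M := ∑ i ∈ range (m + 1), ((p : A) ^ i) • δ i

/-- The contribution of the `δ_i` to the norm equation. -/
def normPart (δ : ℕ → M) : M :=
  normSum p σ (n - 1) • δ 0 + ∑ i ∈ range m, ((p : A) ^ i) • normSum p σ n • δ (i + 1)

/-- The pair `(α, δ)` represents `(a, 1 + p e)`. -/
structure Rep (ξ : M) (a : ℕ → WithBot ℕ) (e : ℤ) (α : M) (δ : ℕ → M) : Prop where
  a_le : ∀ i < m, a i ≤ (n : WithBot ℕ)
  a_zero_lt : a 0 < (n : WithBot ℕ)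
  δ_mem : ∀ i < m, δ i ∈ fixedBot M p σ (a i)
  eq_act : (σ - 1) • α - (p * e : A) • α = weightSum (A := A) p m δ
  eq_norm : ξ = (e : A) • normSum p σ n • α + normPart p n m σ δ

/-- No vector represented by a pair is lexicographically below `a`. -/
def LexMin (ξ : M) (a : ℕ → WithBot ℕ) : Prop :=
  ∀ a' e α δ, Rep p n m σ ξ a' e α δ → ∀ j < m, (∀ i < j, a' i = a i) → ¬ a' j < a j

variable {p n m σ}

theorem weightSum_add (δ Δ : ℕ → M) :
    weightSum (A := A) p m (δ + Δ) = weightSum (A := A) p m δ + weightSum (A := A) p m Δ := by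
  simp [weightSum, sum_add_distrib]

theorem weightSum_single {i : ℕ} (hi : i ≤ m) (x : M) :
    weightSum (A := A) p m (Pi.single i x) = ((p : A) ^ i) • x := by
  rw [weightSum, sum_eq_single_of_mem i (mem_range.2 (by omega))]
  · simp
  · intro k _ hk; simp [Pi.single_eq_of_ne hk]

theorem normPart_add (δ Δ : ℕ → M) :
    normPart p n m σ (δ + Δ) = normPart p n m σ δ + normPart p n m σ Δ := by
  simp only [normPart, Pi.add_apply, smul_add, sum_add_distrib]
  abel

theorem normPart_single_zero (x : M) :
    normPart p n m σ (Pi.single 0 x) = normSum p σ (n - 1) • x := by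
  simp [normPart]

theorem normPart_single_succ {i : ℕ} (hi : i < m) (x : M) :
    normPart p n m σ (Pi.single (i + 1) x) = ((p : A) ^ i) • normSum p σ n • x := by
  rw [normPart, sum_eq_single_of_mem i (mem_range.2 hi)]
  · simp
  · intro k _ hk; simp [Pi.single_eq_of_ne (show k + 1 ≠ i + 1 by omega)]

variable {ξ : M} {a : ℕ → WithBot ℕ} {e : ℤ} {α : M} {δ : ℕ → M}

/-- The common form of all minimality arguments: perturb `(e, α, δ)` compatibly with both equations,
leave the entries before `j` in their stages, and lower the stage at `j`. -/
theorem LexMin.false_of_change (hmin : LexMin p n m σ ξ a) (H : IsKummer p n σ ξ)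
    (h : Rep p n m σ ξ a e α δ) {j : ℕ} (hj : j < m) {b : WithBot ℕ} (hb : b < a j)
    (e' : ℤ) (α' : M) (Δ : ℕ → M)
    (h1 : (σ - 1) • α' - (p * e' : A) • α' = (σ - 1) • α - (p * e : A) • α +
      weightSum (A := A) p m Δ)
    (h2 : (e' : A) • normSum p σ n • α' + normPart p n m σ Δ = (e : A) • normSum p σ n • α)
    (h3 : ∀ i < j, Δ i ∈ fixedBot M p σ (a i)) (h4 : δ j + Δ j ∈ fixedBot M p σ b) : False := by
  -- Entries after `j` do not affect the comparison, so they are set to `n`, which puts no condition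
  -- on the later `δ_i`.
  let a' : ℕ → WithBot ℕ := fun i => if i < j then a i else if i = j then b else n
  have ha' : ∀ i < j, a' i = a i := fun i hi => by simp [a', hi]
  have haj : a' j = b := by simp [a']
  refine hmin a' e' α' (δ + Δ) ⟨?_, ?_, ?_, ?_, ?_⟩ j hj ha' (by rwa [haj])
  · intro i hi
    rcases lt_trichotomy i j with h' | rfl | h'
    · rw [ha' i h']; exact h.a_le i hi
    · rw [haj]; exact hb.le.trans (h.a_le _ hi)
    · simp [a', h'.not_gt, h'.ne']
  · rcases Nat.eq_zero_or_pos j with rfl | h'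
    · rw [haj]; exact hb.trans h.a_zero_lt
    · rw [ha' 0 h']; exact h.a_zero_lt
  · intro i hi
    rcases lt_trichotomy i j with h' | rfl | h'
    · rw [ha' i h']; exact add_mem (h.δ_mem i hi) (h3 i h')
    · rw [haj]; exact h4
    · simp only [a', h'.not_gt, h'.ne', if_false]; exact H.mem_top
  · rw [h1, weightSum_add, h.eq_act]
  · rw [normPart_add]
    linear_combination (norm := module) h.eq_norm - h2

variable (H : IsKummer p n σ ξ) (h : Rep p n m σ ξ a e α δ) (hmin : LexMin p n m σ ξ a)

theorem fixedBot_mono {b c : WithBot ℕ} (hbc : b ≤ c) : fixedBot M p σ b ≤ fixedBot M p σ c := by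
  induction b with
  | bot => exact bot_le
  | coe b =>
    induction c with
    | bot => simp at hbc
    | coe c => exact fixedBy_mono p σ (by exact_mod_cast hbc)

include H

theorem IsKummer.normSum_sub_one (x : M) : normSum p σ n • (σ - 1) • x = 0 := by
  rw [smul_comm, ← mul_smul, sub_one_mul_normSum, H.period]

include hmin h

/-- Since `p z` has norm `p ξ = 0`, Hilbert 90 writes it as `(σ - 1) α'`. Then `e = 0`, `δ_1 = z`
and all other `δ_i = 0` represent a pair with first entry `⊥`. -/
theorem LexMin.zero_eq_bot (hm : 0 < m) (hz : ∃ z : M, normSum p σ n • z = ξ) (hn : n = 1) :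
    a 0 = ⊥ := by
  obtain ⟨z, hz⟩ := hz
  subst hn
  have hPQ := H.normSum_top
  simp only [Nat.sub_self, normSum_zero, mul_one] at hPQ
  obtain ⟨α', -, hα⟩ := H.hilbert90 0 one_pos ((p : A) • z) (H.mem_of_le (by simp) _)
    (by rw [← hPQ, smul_comm, hz, H.p_smul])
  simp only [pow_zero, pow_one] at hα
  by_contra hbot
  refine hmin (fun i => if i = 0 then ⊥ else 1) 0 α' (Pi.single 1 z) ⟨?_, ?_, ?_, ?_, ?_⟩ 0 hm
    (by simp) (by simpa using bot_lt_iff_ne_bot.2 hbot)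
  · intro i _; split_ifs <;> simp
  · simp
  · intro i _
    split_ifs with hi
    · subst hi; simp
    · exact H.mem_top
  · rw [weightSum_single (by omega), ← hα]; simp
  · have := normPart_single_succ (p := p) (n := 1) (σ := σ) hm z
    rw [zero_add] at this
    rw [this, hz]; simp

/-- If `a j ≤ a i`, then `p^(j-i) δ_j` can be absorbed into `δ_i`, which frees position `j` for `⊥`.
-/
theorem LexMin.apply_lt {i j : ℕ} (hij : i < j) (hj : j < m) (hbot : a j ≠ ⊥) : a i < a j := by
  by_contra hle
  rw [not_lt] at hle
  obtain ⟨k, rfl⟩ : ∃ k, j = k + 1 := ⟨j - 1, by omega⟩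
  have hδ := fixedBot_mono hle (h.δ_mem _ hj)
  refine hmin.false_of_change H h hj (bot_lt_iff_ne_bot.2 hbot) e α
    (Pi.single i (((p : A) ^ (k + 1 - i)) • δ (k + 1)) + Pi.single (k + 1) (-δ (k + 1))) ?_ ?_ ?_ ?_
  · have : (p : A) ^ (k + 1) = (p : A) ^ i * (p : A) ^ (k + 1 - i) := by
      rw [← pow_add]; congr 1; omega
    rw [weightSum_add, weightSum_single (by omega), weightSum_single (by omega), this]
    module
  · rw [normPart_add, normPart_single_succ (by omega)]
    cases i with
    | zero =>
      -- The first entry enters the norm equation through `N_{n-1}` instead of `N_n`. The two agree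
      -- up to the factor `p` only on stage `n - 1`, which is where `a 0 < n` is needed.
      have hmem : δ (k + 1) ∈ fixedBy M p σ (n - 1) := by
        have h0 := h.a_zero_lt
        revert hδ h0
        induction a 0 with
        | bot => intro hδ _; rw [(Submodule.mem_bot A).1 hδ]; exact zero_mem _
        | coe b =>
          intro hδ h0
          have : b < n := WithBot.coe_lt_coe.1 h0
          exact fixedBy_mono p σ (by omega) hδ
      rw [normPart_single_zero, H.normSum_top]
      have := stepSum_smul hmem
      rw [Nat.sub_zero]
      linear_combination (norm := module) (-(p : A) ^ k * normSum p σ (n - 1)) • this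
    | succ i =>
      have : (p : A) ^ k = (p : A) ^ i * (p : A) ^ (k + 1 - (i + 1)) := by
        rw [← pow_add]; congr 1; omega
      rw [normPart_single_succ (by omega), this]
      module
  · intro l hl
    rw [Pi.add_apply, Pi.single_eq_of_ne (show l ≠ k + 1 by omega), add_zero]
    rcases eq_or_ne l i with rfl | hli
    · rw [Pi.single_eq_same]; exact Submodule.smul_mem _ _ hδ
    · rw [Pi.single_eq_of_ne hli]; exact zero_mem _
  · rw [Pi.add_apply, Pi.single_eq_same, Pi.single_eq_of_ne (show k + 1 ≠ i by omega)]
    simp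

/-- A decomposition of `δ_j` with respect to a lower stage contradicts minimality if `1 ≤ j`. -/
theorem LexMin.false_of_decomp_succ {j : ℕ} (hj : j + 1 < m) {b : WithBot ℕ} (hb : b < a (j + 1))
    (c : ℤ) {v η z y : M} (hv : v ∈ fixedBot M p σ b)
    (hy : (p : A) • y ∈ fixedBot M p σ (a 0))
    (hyN : normSum p σ n • y = (p : A) • normSum p σ (n - 1) • y)
    (hd : δ (j + 1) = v + (σ - 1) • η + (p : A) • z + (c : A) • α + y) : False := by
  -- The piece `c α` goes into the twist, `(σ - 1) η` into `α`, `p^(j+1) y` into `δ_0`, and `z` into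
  -- `δ_{j+2}` together with the twist correction for `η`. Only `v` stays at position `j + 1`.
  refine hmin.false_of_change H h hj hb (e + p ^ j * c) (α - ((p : A) ^ (j + 1)) • η)
    (Pi.single 0 (((p : A) ^ (j + 1)) • y) + Pi.single (j + 1) (v - δ (j + 1)) +
      Pi.single (j + 1 + 1) (z + ((e + p ^ j * c : ℤ) : A) • η)) ?_ ?_ ?_ ?_
  · rw [weightSum_add, weightSum_add, weightSum_single (by omega), weightSum_single (by omega),
      weightSum_single (by omega), hd]
    push_cast
    module
  · rw [normPart_add, normPart_add, normPart_single_succ (by omega),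
      normPart_single_succ (by omega), normPart_single_zero, hd]
    have h1 := H.normSum_sub_one η
    push_cast
    linear_combination (norm := module) ((-(p : A) ^ j)) • h1 - ((p : A) ^ j) • hyN
  · intro l hl
    rw [Pi.add_apply, Pi.add_apply, Pi.single_eq_of_ne (show l ≠ j + 1 by omega),
      Pi.single_eq_of_ne (show l ≠ j + 1 + 1 by omega), add_zero, add_zero]
    rcases eq_or_ne l 0 with rfl | hl0
    · rw [Pi.single_eq_same, pow_succ, mul_smul]; exact Submodule.smul_mem _ _ hy
    · rw [Pi.single_eq_of_ne hl0]; exact zero_mem _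
  · simpa using hv

/-- A decomposition of `δ_0` with respect to a lower stage contradicts minimality. -/
theorem LexMin.false_of_decomp_zero (hm : 0 < m) {b : WithBot ℕ} (hb : b < a 0)
    {v η z : M} (hv : v ∈ fixedBot M p σ b)
    (hN : normSum p σ n • z = normSum p σ (n - 1) • ((σ - 1) • η + (p : A) • z))
    (hd : δ 0 = v + (σ - 1) • η + (p : A) • z) : False := by
  refine hmin.false_of_change H h hm hb e (α - η)
    (Pi.single 0 (v - δ 0) + Pi.single (0 + 1) (z + (e : A) • η)) ?_ ?_ ?_ ?_
  · rw [weightSum_add, weightSum_single (by omega), weightSum_single (by omega), hd]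
    push_cast
    module
  · rw [normPart_add, normPart_single_succ (by omega), normPart_single_zero, hd]
    linear_combination (norm := module) hN
  · intro l hl; omega
  · simpa using hv

end Setup

end KummerModule

/-! ### What minimality says about norms modulo `p` -/

namespace KummerModule

open Finset

section Setup

variable {A M : Type*} [CommRing A] [AddCommGroup M] [Module A M] {p n m : ℕ} {σ : A}

variable (A) in
/-- `∑_{i=1}^m p^(i-1) δ_i`. -/
def tailSum (p m : ℕ) (δ : ℕ → M) : M := ∑ i ∈ range m, ((p : A) ^ i) • δ (i + 1)

theorem weightSum_eq (δ : ℕ → M) :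
    weightSum (A := A) p m δ = δ 0 + (p : A) • tailSum A p m δ := by
  rw [weightSum, sum_range_succ', tailSum, smul_sum, add_comm]
  simp only [pow_zero, one_smul, pow_succ', mul_smul]

theorem normPart_eq (δ : ℕ → M) :
    normPart p n m σ δ = normSum p σ (n - 1) • δ 0 + normSum p σ n • tailSum A p m δ := by
  simp only [normPart, tailSum, smul_sum, smul_comm (normSum p σ n)]

variable {ξ : M} {a : ℕ → WithBot ℕ} {e : ℤ} {α : M} {δ : ℕ → M}

variable (H : IsKummer p n σ ξ) (h : Rep p n m σ ξ a e α δ) (hmin : LexMin p n m σ ξ a)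
  (hm : 0 < m)

include h in
theorem Rep.sub_one_smul : (σ - 1) • α = δ 0 + (p : A) • ((e : A) • α + tailSum A p m δ) := by
  have := h.eq_act
  rw [weightSum_eq] at this
  linear_combination (norm := module) this

include H h hm

/-- Either `δ_0 = 0` or `δ_0` lies in stage `n - 2`, so `N_{n-1} δ_0` is divisible by `p`. Applying
`N_{n-1}` to the first equation and comparing with the norm equation gives the hypotheses of
`normSum_top_of_step` for `α`. -/
theorem Rep.exists_normSum_smul (h0 : a 0 < ((n - 1 : ℕ) : WithBot ℕ)) :
    ∃ l, normSum p σ n • α = (p : A) • l ∧ (σ - 1) • l = ξ := by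
  obtain ⟨y, hy, hyP⟩ : ∃ y, normSum p σ (n - 1) • δ 0 = (p : A) • y ∧
      stepSum p σ (n - 1) • y = (p : A) • y := by
    have hδ := h.δ_mem 0 hm
    revert hδ h0
    induction a 0 with
    | bot => intro _ hδ; rw [(Submodule.mem_bot A).1 hδ]; exact ⟨0, by simp, by simp⟩
    | coe b =>
      intro h0 hδ
      have hb : b < n - 1 := WithBot.coe_lt_coe.1 h0
      have hδ' : δ 0 ∈ fixedBy M p σ (n - 2) := fixedBy_mono p σ (by omega) hδ
      refine ⟨normSum p σ (n - 2) • δ 0, ?_, ?_⟩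
      · rw [show n - 1 = n - 2 + 1 by omega, normSum_succ, mul_comm, mul_smul, stepSum_smul hδ',
          smul_comm]
      · exact stepSum_smul (Submodule.smul_mem _ _ (fixedBy_mono p σ (by omega) hδ'))
  have e1 := sub_one_mul_normSum p σ (n - 1)
  refine H.normSum_top_of_step
    (y := normSum p σ (n - 1) • ((e : A) • α + tailSum A p m δ) + y) ?_ ?_
  · linear_combination (norm := module) (-e1) • α + (normSum p σ (n - 1)) • h.sub_one_smul + hy
  · have := h.eq_norm
    rw [normPart_eq, H.normSum_top] at this
    linear_combination (norm := module) hyP - this - hy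

/-- With `δ_0 = 0`, such an expression for `α` forces `e α + ∑ p^(i-1) δ_i = (σ - 1) z + c ξ`. Its
norm is `ξ` by the norm equation and zero by the right-hand side. -/
theorem Rep.not_mem_of_eq_bot (h0 : a 0 = ⊥) (f z : M) (hf : (σ - 1) • f = 0)
    (hα : α = f + (p : A) • z) : False := by
  have hδ := h.δ_mem 0 hm
  rw [h0] at hδ
  have hδ0 : δ 0 = 0 := (Submodule.mem_bot A).1 hδ
  obtain ⟨c, hc⟩ := H.torsion ((e : A) • α + tailSum A p m δ - (σ - 1) • z) (by
    have := h.sub_one_smul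
    rw [hδ0] at this
    linear_combination (norm := module) hf - this + (σ - 1) • hα)
  have h1 := h.eq_norm
  have h2 := normSum_smul_fixed (p := p) (k := n) H.fixed
  have h3 := H.normSum_sub_one z
  rw [normPart_eq, hδ0] at h1
  obtain ⟨r, rfl⟩ : ∃ r, n = r + 1 := ⟨n - 1, by have := H.pos; omega⟩
  rw [pow_succ, mul_smul, H.p_smul, smul_zero] at h2
  refine H.ne_zero ?_
  linear_combination (norm := module) h1 + (normSum p σ (r + 1)) • hc + h3 + (c : A) • h2

include hmin

theorem LexMin.ne_of_ne_bot (hsmall : p = 2 → n = 1 → ∃ z : M, normSum p σ n • z = ξ)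
    (h0 : a 0 ≠ ⊥) : p ≠ 2 ∨ n ≠ 1 := by
  by_contra hc
  push Not at hc
  exact h0 (hmin.zero_eq_bot H h hm (hsmall hc.1 hc.2) hc.2)

/-- The main consequence of minimality. For `k < n` the difference of `δ_j` and the step norm of `ε`
is decomposed by `exists_decomp`; the step norm of `ε` lies in `(σ - 1) M + pM`. Thus `δ_j` is, up
to such terms, in the preceding stage, which is impossible. -/
theorem LexMin.normSum_smul_ne (hsmall : p = 2 → n = 1 → ∃ z : M, normSum p σ n • z = ξ)
    {j k : ℕ} (hj : j < m) (hk : a j = (k : WithBot ℕ)) {ε z : M}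
    (hε : ε ∈ fixedBy M p σ (k + 1))
    (heq : normSum p σ k • δ j = normSum p σ (k + 1) • ε + (p : A) • z) : False := by
  have hδ := h.δ_mem j hj
  rw [hk] at hδ
  change δ j ∈ fixedBy M p σ k at hδ
  have hkn : k ≤ n := by have := h.a_le j hj; rw [hk] at this; exact_mod_cast this
  have hpos := H.pos
  rcases hkn.lt_or_eq with hkn | rfl
  · have hS : stepSum p σ k • ε ∈ fixedBy M p σ k := by
      rw [mem_fixedBy, ← mul_smul, sub_one_mul_stepSum]; exact hε
    obtain ⟨v, hv, η, hη, z', hz', ⟨c, hc⟩, hu⟩ := H.exists_decomp hkn (sub_mem hδ hS)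
      (l := z) (by
        rw [normSum_succ] at heq
        linear_combination (norm := module) heq)
    obtain ⟨Φ, hΦ⟩ := exists_stepSum_eq p σ k
    have e1 := sub_one_mul_normSum p σ k
    have hprev : prev k < a j := by
      rw [hk]
      cases k with
      | zero => exact WithBot.bot_lt_coe _
      | succ k => exact WithBot.coe_lt_coe.2 k.lt_succ_self
    have hd : δ j = v + (σ - 1) • (η + normSum p σ k • Φ • ε) + (p : A) • (z' + ε) := by
      linear_combination (norm := module) hu + hΦ • ε - e1 • Φ • ε
    cases j with
    | succ j =>
      refine hmin.false_of_decomp_succ H h hj hprev 0 (η := η + normSum p σ k • Φ • ε)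
        (z := z' + ε) (y := 0) hv (by simp) (by simp) ?_
      rw [hd]; simp
    | zero =>
      refine hmin.false_of_decomp_zero H h hm hprev hv ?_ hd
      have e2 := sub_one_mul_normSum p σ (n - 1)
      have f1 : normSum p σ (n - 1) • (σ - 1) • η = 0 := by
        rw [smul_comm, ← mul_smul, e2]; exact fixedBy_mono p σ (by omega) hη
      have f2 : normSum p σ n • z' = (p : A) • normSum p σ (n - 1) • z' := by
        rcases eq_or_ne k (n - 1) with rfl | hne
        · exact H.normSum_top_kummer (hmin.ne_of_ne_bot H h hm hsmall (by rw [hk]; simp)) hc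
        · rw [H.normSum_top, mul_smul]
          exact stepSum_smul (Submodule.smul_mem _ _ (fixedBy_mono p σ (by omega) hz'))
      have f3 : normSum p σ n • ε = normSum p σ (n - 1) • stepSum p σ k • ε := by
        rcases eq_or_ne k (n - 1) with rfl | hne
        · rw [H.normSum_top, mul_comm, mul_smul]
        · have h1 := stepSum_smul (Submodule.smul_mem _ (normSum p σ (n - 1))
            (fixedBy_mono p σ (show k + 1 ≤ n - 1 by omega) hε))
          have h2 : (σ ^ p ^ (n - 1) - 1) • Φ • ε = 0 :=
            Submodule.smul_mem _ Φ (fixedBy_mono p σ (show k + 1 ≤ n - 1 by omega) hε)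
          rw [H.normSum_top]
          linear_combination (norm := module) h1 - (normSum p σ (n - 1)) • hΦ • ε +
            (normSum p σ (n - 1)) • e1 • Φ • ε - (normSum p σ k) • h2 - normSum p σ k • e2 • Φ • ε
      linear_combination (norm := module) f2 + f3 - f1 + normSum p σ (n - 1) • hΦ • ε -
        normSum p σ (n - 1) • e1 • Φ • ε
  -- At the top stage the step norm is multiplication by `p`, so the assumption says that the norm
  -- of `δ_j` is divisible by `p`. The reference element is `α` if `a 0` is below the last proper
  -- stage.
  · have hl : normSum p σ k • δ j = (p : A) • (normSum p σ k • ε + z) := by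
      have := stepSum_smul (H.mem_top (x := normSum p σ k • ε))
      rw [heq, normSum_succ]
      linear_combination (norm := module) this
    have h0 := h.a_zero_lt
    obtain ⟨j, rfl⟩ : ∃ i, j = i + 1 := ⟨j - 1, by
      have : j ≠ 0 := by rintro rfl; exact absurd h0 (by rw [hk]; exact lt_irrefl _)
      omega⟩
    have hlt : ((k - 1 : ℕ) : WithBot ℕ) < a (j + 1) := by
      rw [hk]
      have : k - 1 < k := by omega
      exact WithBot.coe_lt_coe.2 this
    by_cases hcase : a 0 < ((k - 1 : ℕ) : WithBot ℕ)
    · obtain ⟨l, hl1, hl2⟩ := h.exists_normSum_smul H hm hcase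
      obtain ⟨c, v, hv, η, hd⟩ := H.exists_decomp_top hl hl1 hl2
      refine hmin.false_of_decomp_succ H h hj hlt c (v := v) (η := η) (y := 0) (z := 0) hv
        (by simp) (by simp) ?_
      rw [hd]; module
    -- Otherwise the reference is a Kummer generator `θ` of the last step; its multiple can be moved
    -- to `δ_0`, since `p θ` lies in stage `a 0`.
    · have ha0 : a 0 = ((k - 1 : ℕ) : WithBot ℕ) := by
        refine le_antisymm ?_ (not_lt.1 hcase)
        revert h0
        induction a 0 with
        | bot => intro _; exact bot_le
        | coe b =>
          intro h0
          have : b < k := WithBot.coe_lt_coe.1 h0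
          have : b ≤ k - 1 := by omega
          exact WithBot.coe_le_coe.2 this
      obtain ⟨θ, -, hθ⟩ := H.exists_kummer (k := k - 1) (by omega)
      have hpn := hmin.ne_of_ne_bot H h hm hsmall (by rw [ha0]; simp)
      have hθN := H.normSum_top_kummer hpn (x := θ) (c := 1) (by rw [hθ]; simp)
      have e2 := sub_one_mul_normSum p σ (k - 1)
      obtain ⟨c, v, hv, η, hd⟩ := H.exists_decomp_top hl hθN (by
        rw [← mul_smul, e2, hθ])
      refine hmin.false_of_decomp_succ H h hj hlt 0 (v := v) (η := η) (y := (c : A) • θ) (z := 0) hv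
        ?_ ?_ ?_
      · rw [ha0]
        change _ ∈ fixedBy M p σ (k - 1)
        have := H.p_smul
        rw [mem_fixedBy]
        linear_combination (norm := module) (c * p : A) • hθ + (c : A) • this
      · linear_combination (norm := module) (c : A) • hθN
      · rw [hd]; push_cast; module

end Setup

end KummerModule

/-! ### Generation: submodules that contain enough norms are everything -/

namespace KummerModule

open Finset

section Setup

variable {A M : Type*} [CommRing A] [AddCommGroup M] [Module A M] {p n m : ℕ} {σ : A}

theorem sub_one_pow_smul_of_mem (hp : p.Prime) {k : ℕ} {x : M} (hx : x ∈ fixedBy M p σ k) :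
    ∃ w, (σ - 1) ^ p ^ k • x = (p : A) • w := by
  obtain ⟨g, hg⟩ := exists_sub_one_pow_eq p σ hp k
  exact ⟨g • x, by linear_combination (norm := module) hg • x + (mem_fixedBy p σ).1 hx⟩

variable {ξ : M} {a : ℕ → WithBot ℕ} {e : ℤ} {α : M} {δ : ℕ → M}

variable (H : IsKummer p n σ ξ)

include H

/-- A power `τ ^ r` with `r > p ^ (n - 1)` maps to the fixed classes through norms from the top. -/
theorem IsKummer.exists_norm_of_pow (hpn : p ≠ 2 ∨ n ≠ 1) (d : ℕ) :
    ∀ (r : ℕ) (η : M), r + d = p ^ n - 1 → p ^ (n - 1) + 1 ≤ r →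
      (∃ w, (σ - 1) ^ (r + 1) • η = (p : A) • w) →
      ∃ y w, (σ - 1) ^ r • η = normSum p σ n • y + (p : A) • w := by
  have hn : n - 1 + 1 = n := Nat.sub_add_cancel H.pos
  obtain ⟨g, hg⟩ := exists_normSum_eq_sub_one_pow p σ H.prime n
  induction d with
  | zero =>
    rintro r η hr - -
    refine ⟨η, -(g • η), ?_⟩
    rw [add_zero] at hr
    rw [hr]
    linear_combination (norm := module) (-hg) • η
  | succ d ih =>
    rintro r η hr hr1 ⟨w, hw⟩
    -- Since `r + 1 ≤ p^n - 1`, the norm of `η` is divisible by `p`, and `exists_decomp_top` applies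
    -- with `θ` as reference.
    have hη : normSum p σ n • η = (p : A) • ((σ - 1) ^ (p ^ n - 1 - (r + 1)) • w + g • η) := by
      have : (σ - 1) ^ (p ^ n - 1) = (σ - 1) ^ (p ^ n - 1 - (r + 1)) * (σ - 1) ^ (r + 1) := by
        rw [← pow_add]; congr 1; omega
      linear_combination (norm := module) hg • η + this • η +
        ((σ - 1) ^ (p ^ n - 1 - (r + 1))) • hw
    obtain ⟨θ, -, hθ⟩ := H.exists_kummer (k := n - 1) (by omega)
    have hθN := H.normSum_top_kummer hpn (x := θ) (c := 1) (by rw [hθ]; simp)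
    obtain ⟨c, v, hv, η₂, hd⟩ := H.exists_decomp_top hη hθN (by
      rw [← mul_smul, sub_one_mul_normSum, hθ])
    obtain ⟨s, hs⟩ : ∃ s, r = s + 1 + p ^ (n - 1) := ⟨r - 1 - p ^ (n - 1), by omega⟩
    obtain ⟨g', hg'⟩ := exists_sub_one_pow_eq p σ H.prime (n - 1)
    have hfix := H.fixed
    have hv' := (mem_fixedBy p σ).1 hv
    -- Modulo `p`, `(σ - 1)^(p^(n-1))` is `σ^(p^(n-1)) - 1`: it kills `v` and sends `θ` to `ξ`,
    -- which one more factor `σ - 1` kills. As `r > p^(n-1)`, only the `η₂` term survives, with a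
    -- larger exponent.
    have key : (σ - 1) ^ r • η = (σ - 1) ^ (r + 1) • η₂ +
        (p : A) • (σ - 1) ^ (s + 1) • g' • ((c : A) • θ + v) := by
      rw [hd, hs]
      linear_combination (norm := module) ((σ - 1) ^ (s + 1) * hg') • ((c : A) • θ + v) +
        (σ - 1) ^ (s + 1) • (c : A) • hθ + (σ - 1) ^ (s + 1) • hv' + (σ - 1) ^ s • (c : A) • hfix
    obtain ⟨y, w', hy⟩ := ih (r + 1) η₂ (by omega) (by omega)
      ⟨w - (σ - 1) • (σ - 1) ^ (s + 1) • g' • ((c : A) • θ + v), by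
        linear_combination (norm := module) hw - (σ - 1) • key⟩
    exact ⟨y, w' + (σ - 1) ^ (s + 1) • g' • ((c : A) • θ + v), by rw [key, hy]; module⟩

/-- If a submodule contains the multiples of `p` and meets `normSum k` of each stage `k ≤ n`
modulo `p`, it contains the lower stages. -/
theorem IsKummer.fixedBy_le (Z : Submodule A M) (hpZ : ∀ x, (p : A) • x ∈ Z)
    (hS : ∀ k ≤ n, ∀ ε ∈ fixedBy M p σ k, ∃ z ∈ Z, z ∈ fixedBy M p σ k ∧
      ∃ w, normSum p σ k • ε = normSum p σ k • z + (p : A) • w) {k : ℕ} (hk : k < n) :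
    fixedBy M p σ k ≤ Z := by
  induction k using Nat.strong_induction_on with
  | _ k ih =>
    have hprev : fixedPrev M p σ k ≤ Z := by
      cases k with
      | zero => exact bot_le
      | succ k => exact ih k k.lt_succ_self (by omega)
    -- Repeatedly replace `η` by `η'` with `η - (σ - 1) η' ∈ Z`; at `r = p^k` the remainder is a
    -- multiple of `p`.
    have key : ∀ r, ∀ ε ∈ fixedBy M p σ k, ∃ η ∈ fixedBy M p σ k, ε - (σ - 1) ^ r • η ∈ Z := by
      intro r
      induction r with
      | zero => exact fun ε hε => ⟨ε, hε, by simp⟩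
      | succ r ihr =>
        intro ε hε
        obtain ⟨η, hη, h1⟩ := ihr ε hε
        obtain ⟨z, hz, hzk, w, hw⟩ := hS k hk.le η hη
        obtain ⟨v, hv, η', hη', z', -, -, hd⟩ := H.exists_decomp hk (sub_mem hη hzk) (l := w) (by
          rw [smul_sub, hw]; module)
        refine ⟨η', hη', ?_⟩
        have : ε - (σ - 1) ^ (r + 1) • η' = (ε - (σ - 1) ^ r • η) +
            (σ - 1) ^ r • (z + v + (p : A) • z') := by
          linear_combination (norm := module) (σ - 1) ^ r • hd
        rw [this]
        exact add_mem h1 (Z.smul_mem _ (add_mem (add_mem hz (hprev hv)) (hpZ _)))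
    intro ε hε
    obtain ⟨η, hη, h1⟩ := key (p ^ k) ε hε
    obtain ⟨w, hw⟩ := sub_one_pow_smul_of_mem H.prime hη
    rw [hw] at h1
    simpa using add_mem h1 (hpZ w)

/-- Nakayama's argument: `σ - 1` is nilpotent modulo `p`. -/
theorem IsKummer.eq_top_of_sub_one (Z : Submodule A M) (hpZ : ∀ x, (p : A) • x ∈ Z)
    (hZ : ∀ x, ∃ y, x - (σ - 1) • y ∈ Z) : Z = ⊤ := by
  have key : ∀ r : ℕ, ∀ x, ∃ y, x - (σ - 1) ^ r • y ∈ Z := by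
    intro r
    induction r with
    | zero => exact fun x => ⟨x, by simp⟩
    | succ r ih =>
      intro x
      obtain ⟨y, hy⟩ := ih x
      obtain ⟨y', hy'⟩ := hZ y
      refine ⟨y', ?_⟩
      have : x - (σ - 1) ^ (r + 1) • y' = (x - (σ - 1) ^ r • y) +
          (σ - 1) ^ r • (y - (σ - 1) • y') := by module
      rw [this]
      exact add_mem hy (Z.smul_mem _ hy')
  rw [eq_top_iff]
  rintro x -
  obtain ⟨y, hy⟩ := key (p ^ n) x
  obtain ⟨w, hw⟩ := sub_one_pow_smul_of_mem H.prime (H.mem_top (x := y))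
  rw [hw] at hy
  simpa using add_mem hy (hpZ w)

omit H in
theorem exists_mul_add_of_not_dvd (hp : p.Prime) {c : ℤ} (hc : ¬ (p : ℤ) ∣ c) :
    ∃ u v : ℤ, u * c + v * p = 1 := by
  have : IsCoprime c (p : ℤ) :=
    ((Nat.prime_iff_prime_int.1 hp).coprime_iff_not_dvd.2 hc).symm
  exact this

variable (h : Rep p n m σ ξ a e α δ) (hmin : LexMin p n m σ ξ a)
  (hm : 0 < m)
include h hmin hm

/-- The lower stages lie in `Z` by `fixedBy_le`. By `exists_decomp_top` it remains to find a
reference element in `Z + (σ - 1) M`: either `α` itself, or a Kummer generator `θ`, which must then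
be recovered from `α`. -/
theorem LexMin.eq_top (hsmall : p = 2 → n = 1 → ∃ z : M, normSum p σ n • z = ξ)
    (Z : Submodule A M) (hpZ : ∀ x, (p : A) • x ∈ Z) (hαZ : α ∈ Z)
    (hS : ∀ k ≤ n, ∀ ε ∈ fixedBy M p σ k, ∃ z ∈ Z, z ∈ fixedBy M p σ k ∧
      ∃ w, normSum p σ k • ε = normSum p σ k • z + (p : A) • w) : Z = ⊤ := by
  have hpos := H.pos
  have hlow : fixedBy M p σ (n - 1) ≤ Z := H.fixedBy_le Z hpZ hS (by omega)
  have main : ∀ w l : M, normSum p σ n • w = (p : A) • l → (σ - 1) • l = ξ →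
      (∃ y, w - (σ - 1) • y ∈ Z) → Z = ⊤ := by
    rintro w l hw hl ⟨y, hy⟩
    refine H.eq_top_of_sub_one Z hpZ fun x => ?_
    obtain ⟨z, hz, -, w', hw'⟩ := hS n le_rfl x H.mem_top
    obtain ⟨c, v, hv, η, hd⟩ := H.exists_decomp_top (u := x - z) (l := w')
      (by rw [smul_sub, hw']; module) hw hl
    refine ⟨(c : A) • y + η, ?_⟩
    have : x - (σ - 1) • ((c : A) • y + η) = z + (c : A) • (w - (σ - 1) • y) + v := by
      linear_combination (norm := module) hd
    rw [this]
    exact add_mem (add_mem hz (Z.smul_mem _ hy)) (hlow hv)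
  by_cases hcase : a 0 < ((n - 1 : ℕ) : WithBot ℕ)
  · obtain ⟨l, hl1, hl2⟩ := h.exists_normSum_smul H hm hcase
    exact main α l hl1 hl2 ⟨0, by simpa using hαZ⟩
  · have ha0 : a 0 = ((n - 1 : ℕ) : WithBot ℕ) := by
      refine le_antisymm ?_ (not_lt.1 hcase)
      have h0 := h.a_zero_lt
      revert h0
      induction a 0 with
      | bot => intro _; exact bot_le
      | coe b =>
        intro h0
        have : b < n := WithBot.coe_lt_coe.1 h0
        have : b ≤ n - 1 := by omega
        exact WithBot.coe_le_coe.2 this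
    obtain ⟨θ, -, hθ⟩ := H.exists_kummer (k := n - 1) (by omega)
    have hpn := hmin.ne_of_ne_bot H h hm hsmall (by rw [ha0]; simp)
    have hθN := H.normSum_top_kummer hpn (x := θ) (c := 1) (by rw [hθ]; simp)
    have e2 := sub_one_mul_normSum p σ (n - 1)
    have hθl : (σ - 1) • normSum p σ (n - 1) • θ = ξ := by rw [← mul_smul, e2, hθ]
    have hδ := h.δ_mem 0 hm
    rw [ha0] at hδ
    change δ 0 ∈ fixedBy M p σ (n - 1) at hδ
    have hαeq := h.sub_one_smul
    -- This leaves enough powers of `σ - 1` for the norm of `α` to be divisible by `p`: one turns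
    -- `α` into `δ_0` modulo `p`, and `p^(n-1)` more kill `δ_0` modulo `p`. It fails precisely for
    -- `p = 2`, `n = 1`, which is excluded here.
    have hsize : p ^ (n - 1) + 2 ≤ p ^ n := by
      obtain ⟨r, rfl⟩ : ∃ r, n = r + 1 := ⟨n - 1, by omega⟩
      rw [Nat.add_sub_cancel, pow_succ]
      have h1 : 1 ≤ p ^ r := Nat.one_le_pow _ _ H.prime.pos
      have h2 := H.prime.two_le
      by_cases hr : r = 0
      · subst hr
        have : p ≠ 2 := hpn.resolve_right (by simp)
        simp; omega
      · have : 2 ≤ p ^ r := h2.trans (Nat.le_self_pow hr p)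
        nlinarith
    obtain ⟨l, hl⟩ : ∃ l, normSum p σ n • α = (p : A) • l := by
      obtain ⟨g, hg⟩ := exists_normSum_eq_sub_one_pow p σ H.prime n
      obtain ⟨w, hw⟩ := sub_one_pow_smul_of_mem H.prime hδ
      obtain ⟨s, hs⟩ : ∃ s, p ^ n - 1 = s + p ^ (n - 1) + 1 := ⟨p ^ n - 2 - p ^ (n - 1), by omega⟩
      rw [hs] at hg
      refine ⟨g • α + (σ - 1) ^ s • w +
        (σ - 1) ^ (s + p ^ (n - 1)) • ((e : A) • α + tailSum A p m δ), ?_⟩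
      linear_combination (norm := module) hg • α + (σ - 1) ^ s • hw +
        (σ - 1) ^ (s + p ^ (n - 1)) • hαeq
    obtain ⟨c, v, hv, η, hd⟩ := H.exists_decomp_top hl hθN hθl
    -- If `p ∣ c`, then `N_{n-1} δ_0` is `(σ - 1)^(p^(n-1)+1) η` modulo `p` and is fixed, so
    -- `exists_norm_of_pow` makes it a norm from the top, against `normSum_smul_ne`. Otherwise `c`
    -- is inverted modulo `p` to solve for `θ`.
    by_cases hc : (p : ℤ) ∣ c
    · exfalso
      obtain ⟨c, rfl⟩ := hc
      push_cast at hd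
      obtain ⟨g, hg⟩ := exists_sub_one_pow_eq p σ H.prime (n - 1)
      have hv' := (mem_fixedBy p σ).1 hv
      have hQ : normSum p σ (n - 1) • δ 0 = (σ - 1) ^ (p ^ (n - 1) + 1) • η +
          (p : A) • ((σ ^ p ^ (n - 1) - 1) • (c : A) • θ - ((σ - 1) * g) • η -
            normSum p σ (n - 1) • ((e : A) • α + tailSum A p m δ)) := by
        linear_combination (norm := module) (-normSum p σ (n - 1)) • hαeq + e2 • α +
          (σ ^ p ^ (n - 1) - 1) • hd + hv' - ((σ - 1) * hg) • η
      have hτ : (σ - 1) • normSum p σ (n - 1) • δ 0 = 0 := IsKummer.normSum_fixed hδ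
      obtain ⟨y, w, hy⟩ := H.exists_norm_of_pow hpn (p ^ n - 1 - (p ^ (n - 1) + 1))
        (p ^ (n - 1) + 1) η (by omega) le_rfl
        ⟨-((σ - 1) • ((σ ^ p ^ (n - 1) - 1) • (c : A) • θ - ((σ - 1) * g) • η -
            normSum p σ (n - 1) • ((e : A) • α + tailSum A p m δ))), by
          linear_combination (norm := module) hτ - (σ - 1) • hQ⟩
      have hn : n - 1 + 1 = n := by omega
      obtain ⟨q, hq⟩ : ∃ q, normSum p σ (n - 1) • δ 0 =
          normSum p σ (n - 1 + 1) • y + (p : A) • q :=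
        ⟨_, by rw [hn, hQ, hy, add_assoc, ← smul_add]⟩
      exact hmin.normSum_smul_ne H h hm hsmall hm ha0 (by rw [hn]; exact H.mem_top) hq
    · obtain ⟨u, u', hu⟩ := exists_mul_add_of_not_dvd H.prime hc
      have hu' : (u : A) * c + u' * p = 1 := by exact_mod_cast congrArg (Int.cast : ℤ → A) hu
      refine main θ _ hθN hθl ⟨-((u : A) • η), ?_⟩
      have : θ - (σ - 1) • -((u : A) • η) = (u : A) • (α - v) + (u' : A) • (p : A) • θ := by
        linear_combination (norm := module) (-(u : A)) • hd - hu' • θ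
      rw [this]
      exact add_mem (Z.smul_mem _ (sub_mem hαZ (hlow hv))) (Z.smul_mem _ (hpZ _))

end Setup

end KummerModule

/-! ### A basis adapted to the filtration by norms -/

namespace KummerModule

open Finset

section Basis

variable {A M : Type*} [CommRing A] [AddCommGroup M] [Module A M] {p n m : ℕ} {σ : A}
variable {𝔽 J : Type*} [Field 𝔽] [AddCommGroup J] [Module 𝔽 J]

/-- The image in `J` of the norm of `x.2` from level `x.1` (from level `0` if `x.1 = ⊥`). -/
def socle (p : ℕ) (σ : A) (π : M →+ J) (x : WithBot ℕ × M) : J :=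
  π (normSum p σ (x.1.unbotD 0) • x.2)

variable {π : M →+ J}

theorem map_intCast_smul (c : ℤ) (x : M) : π ((c : A) • x) = (c : 𝔽) • π x := by
  rw [Int.cast_smul_eq_zsmul, Int.cast_smul_eq_zsmul, map_zsmul]

/-- A norm from level `l ≥ k` factors through level `k`, so a combination of such norms is the norm
of a single element of stage `k`. -/
theorem exists_of_mem_span_socle (h𝔽 : ∀ c : 𝔽, ∃ k : ℤ, c = k) {B : Set (WithBot ℕ × M)} {k : ℕ}
    {Z : Submodule A M}
    (hB : ∀ b ∈ B, (∃ l : ℕ, b.1 = l ∧ k ≤ l ∧ b.2 ∈ fixedBy M p σ l) ∧ b.2 ∈ Z) {x : J}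
    (hx : x ∈ Submodule.span 𝔽 (socle p σ π '' B)) :
    ∃ z ∈ Z, z ∈ fixedBy M p σ k ∧ x = π (normSum p σ k • z) := by
  induction hx using Submodule.span_induction with
  | mem x hx =>
    obtain ⟨⟨b, y⟩, hb, rfl⟩ := hx
    obtain ⟨⟨l, rfl, hkl, hy⟩, hyZ⟩ := hB _ hb
    obtain ⟨R, h1, h2⟩ := exists_normSum_eq_mul p σ hkl
    refine ⟨R • y, Z.smul_mem _ hyZ, ?_, ?_⟩
    · rw [mem_fixedBy, ← mul_smul, h2]; exact hy
    · rw [← mul_smul, ← h1]; rfl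
  | zero => exact ⟨0, zero_mem _, zero_mem _, by simp⟩
  | add x y _ _ hx hy =>
    obtain ⟨z, h1, h2, rfl⟩ := hx
    obtain ⟨z', h1', h2', rfl⟩ := hy
    exact ⟨z + z', add_mem h1 h1', add_mem h2 h2', by rw [smul_add, map_add]⟩
  | smul c x _ hx =>
    obtain ⟨z, h1, h2, rfl⟩ := hx
    obtain ⟨k, rfl⟩ := h𝔽 c
    refine ⟨(k : A) • z, Z.smul_mem _ h1, Submodule.smul_mem _ _ h2, ?_⟩
    rw [smul_comm, map_intCast_smul (𝔽 := 𝔽)]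

variable {ξ : M} {a : ℕ → WithBot ℕ} {e : ℤ} {α : M} {δ : ℕ → M}

variable (H : IsKummer p n σ ξ) (h : Rep p n m σ ξ a e α δ) (hmin : LexMin p n m σ ξ a)
  (hm : 0 < m) (hsmall : p = 2 → n = 1 → ∃ z : M, normSum p σ n • z = ξ)
  (hπ : ∀ x, π x = 0 ↔ ∃ w, x = (p : A) • w) (h𝔽 : ∀ c : 𝔽, ∃ k : ℤ, c = k)

include hπ in
theorem map_eq_iff {x y : M} : π x = π y ↔ ∃ w, x = y + (p : A) • w := by
  rw [← sub_eq_zero, ← map_sub, hπ]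
  simp only [sub_eq_iff_eq_add']

include H h hmin hm hsmall hπ h𝔽

/-- Descending induction on the stage `c = n + 1 - d`: norms from stage `c` include those from stage
`c + 1`, so the basis already built is extended, the prescribed `δ_j` with `a j = c` being inserted
first. -/
theorem LexMin.exists_basis_aux (d : ℕ) : ∀ c, c + d = n + 1 → ∃ B : Set (WithBot ℕ × M),
    (∀ b ∈ B, ∃ l : ℕ, b.1 = l ∧ c ≤ l ∧ l ≤ n ∧ b.2 ∈ fixedBy M p σ l) ∧
    (∀ j < m, (c : WithBot ℕ) ≤ a j → (a j, δ j) ∈ B) ∧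
    LinearIndepOn 𝔽 (socle p σ π) B ∧
    ∀ k, c ≤ k → k ≤ n → ∀ ε ∈ fixedBy M p σ k,
      π (normSum p σ k • ε) ∈ Submodule.span 𝔽 (socle p σ π '' {b ∈ B | (k : WithBot ℕ) ≤ b.1}) := by
  induction d with
  | zero =>
    intro c hc
    refine ⟨∅, by simp, ?_, linearIndepOn_empty _ _, fun k _ _ => by omega⟩
    intro j hj hcj
    have h1 := hcj.trans (h.a_le j hj)
    have h2 : c ≤ n := WithBot.coe_le_coe.1 h1
    omega
  | succ d ih =>
    intro c hc
    obtain ⟨B, hB1, hB2, hB3, hB4⟩ := ih (c + 1) (by omega)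
    obtain ⟨B', hBB', hB1', hB2', hB3'⟩ : ∃ B', B ⊆ B' ∧
        (∀ b ∈ B', ∃ l : ℕ, b.1 = l ∧ c ≤ l ∧ l ≤ n ∧ b.2 ∈ fixedBy M p σ l) ∧
        (∀ j < m, (c : WithBot ℕ) ≤ a j → (a j, δ j) ∈ B') ∧
        LinearIndepOn 𝔽 (socle p σ π) B' := by
      have hlow : ∀ b ∈ B, ∃ l : ℕ, b.1 = l ∧ c ≤ l ∧ l ≤ n ∧ b.2 ∈ fixedBy M p σ l := by
        intro b hb
        obtain ⟨l, h1, h2, h3⟩ := hB1 b hb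
        exact ⟨l, h1, by omega, h3⟩
      have hup : ∀ j < m, (c : WithBot ℕ) ≤ a j → a j ≠ c → (a j, δ j) ∈ B := by
        intro j hj h1 h2
        refine hB2 j hj ?_
        have h3 := lt_of_le_of_ne h1 h2.symm
        revert h3
        induction a j with
        | bot => intro h3; exact absurd h3 not_lt_bot
        | coe b =>
          intro h3
          have : c < b := WithBot.coe_lt_coe.1 h3
          exact WithBot.coe_le_coe.2 this
      -- By `apply_lt` at most one index has `a j = c`; its socle is independent of the earlier ones
      -- by `normSum_smul_ne`.
      by_cases hex : ∃ j < m, a j = c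
      · obtain ⟨j, hj, hjc⟩ := hex
        refine ⟨insert (a j, δ j) B, Set.subset_insert _ _, ?_, ?_, hB3.insert ?_⟩
        · rintro b (rfl | hb)
          · have hδ := h.δ_mem j hj
            have hle := h.a_le j hj
            rw [hjc] at hδ hle
            exact ⟨c, hjc, le_rfl, by exact_mod_cast hle, hδ⟩
          · exact hlow b hb
        · intro i hi hci
          by_cases hic : a i = c
          · have hij : i = j := by
              rcases lt_trichotomy i j with hlt | heq | hlt
              · have := hmin.apply_lt H h hlt hj (by rw [hjc]; simp)
                rw [hic, hjc] at this; exact absurd this (lt_irrefl _)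
              · exact heq
              · have := hmin.apply_lt H h hlt hi (by rw [hic]; simp)
                rw [hic, hjc] at this; exact absurd this (lt_irrefl _)
            subst hij
            exact Set.mem_insert _ _
          · exact Set.mem_insert_of_mem _ (hup i hi hci hic)
        · intro hmem
          obtain ⟨z, -, hz, hzπ⟩ := exists_of_mem_span_socle (A := A) (k := c + 1) (Z := ⊤) h𝔽
            (fun b hb => ⟨let ⟨l, h1, h2, _, h4⟩ := hB1 b hb; ⟨l, h1, h2, h4⟩, trivial⟩) hmem
          rw [socle, map_eq_iff hπ] at hzπ
          obtain ⟨w, hw⟩ := hzπ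
          rw [hjc] at hw
          exact hmin.normSum_smul_ne H h hm hsmall hj hjc hz hw
      · refine ⟨B, subset_rfl, hlow, fun j hj hcj => hup j hj hcj fun hjc => hex ⟨j, hj, hjc⟩, hB3⟩
    obtain ⟨C, hC1, hC2, hC3, hC4⟩ := exists_linearIndepOn_extension hB3'
      (t := B' ∪ {b | ∃ x ∈ fixedBy M p σ c, b = ((c : WithBot ℕ), x)}) Set.subset_union_left
    have hC1' : ∀ b ∈ C, ∃ l : ℕ, b.1 = l ∧ c ≤ l ∧ l ≤ n ∧ b.2 ∈ fixedBy M p σ l := by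
      intro b hb
      rcases hC1 hb with hb | ⟨x, hx, rfl⟩
      · exact hB1' b hb
      · exact ⟨c, rfl, le_rfl, by omega, hx⟩
    refine ⟨C, hC1', fun j hj hcj => hC2 (hB2' j hj hcj), hC4, ?_⟩
    intro k hck hkn ε hε
    rcases hck.eq_or_lt with rfl | hck
    · have : {b ∈ C | (c : WithBot ℕ) ≤ b.1} = C := by
        ext b
        refine ⟨fun hb => hb.1, fun hb => ⟨hb, ?_⟩⟩
        obtain ⟨l, h1, h2, -⟩ := hC1' b hb
        rw [h1]; exact_mod_cast h2
      rw [this]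
      exact hC3 ⟨((c : WithBot ℕ), ε), Or.inr ⟨ε, hε, rfl⟩, rfl⟩
    · refine Submodule.span_mono (Set.image_mono ?_) (hB4 k hck hkn ε hε)
      exact fun b hb => ⟨hC2 (hBB' hb.1), hb.2⟩

/-- The element of `M` whose class generates the socle of the module generated by `α`. -/
def topElt (a : ℕ → WithBot ℕ) (α : M) (δ : ℕ → M) : M := if a 0 = ⊥ then α else δ 0

omit [Module 𝔽 J] [Field 𝔽] in
omit H h hmin hm hsmall hπ h𝔽 in
theorem socle_topElt_of_eq_bot (h0 : a 0 = ⊥) : socle p σ π (a 0, topElt a α δ) = π α := by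
  simp [socle, topElt, h0]

/-- If `a 0 = ⊥`, the class of `α` has to be added below stage `0`; `Rep.not_mem_of_eq_bot` says it
is outside the span of all norms. Otherwise the socle of `⟨α⟩` comes from `δ_0`, already in the
basis. -/
theorem LexMin.exists_basis : ∃ B : Set (WithBot ℕ × M),
    (∀ b ∈ B, b = (a 0, topElt a α δ) ∨ ∃ l : ℕ, b.1 = l ∧ l ≤ n ∧ b.2 ∈ fixedBy M p σ l) ∧
    ((a 0, topElt a α δ) ∈ B) ∧
    (∀ j < m, a j ≠ ⊥ → (a j, δ j) ∈ B) ∧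
    LinearIndepOn 𝔽 (socle p σ π) B ∧
    ∀ k ≤ n, ∀ ε ∈ fixedBy M p σ k,
      π (normSum p σ k • ε) ∈ Submodule.span 𝔽 (socle p σ π '' {b ∈ B | (k : WithBot ℕ) ≤ b.1}) := by
  obtain ⟨B, h1, h2, h3, h4⟩ := hmin.exists_basis_aux H h hm hsmall hπ h𝔽 (n + 1) 0 (by omega)
  have h2' : ∀ j < m, a j ≠ ⊥ → (a j, δ j) ∈ B := by
    intro j hj hne
    refine h2 j hj ?_
    revert hne
    induction a j with
    | bot => intro hne; exact absurd rfl hne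
    | coe b => intro _; exact WithBot.coe_le_coe.2 b.zero_le
  by_cases h0 : a 0 = ⊥
  · refine ⟨insert (a 0, topElt a α δ) B, ?_, Set.mem_insert _ _,
      fun j hj hne => Set.mem_insert_of_mem _ (h2' j hj hne), h3.insert ?_, ?_⟩
    · rintro b (rfl | hb)
      · exact Or.inl rfl
      · obtain ⟨l, h1, -, h3⟩ := h1 b hb; exact Or.inr ⟨l, h1, h3⟩
    · intro hmem
      obtain ⟨z, -, hz, hzπ⟩ := exists_of_mem_span_socle (A := A) (k := 0) (Z := ⊤) h𝔽
        (fun b hb => ⟨let ⟨l, h1, h2, _, h4⟩ := h1 b hb; ⟨l, h1, h2, h4⟩, trivial⟩) hmem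
      rw [socle_topElt_of_eq_bot h0, map_eq_iff hπ] at hzπ
      obtain ⟨w, hw⟩ := hzπ
      rw [normSum_zero, one_smul] at hw
      exact h.not_mem_of_eq_bot H hm h0 z w (mem_fixedBy_zero.1 hz) hw
    · intro k hk ε hε
      refine Submodule.span_mono (Set.image_mono ?_) (h4 k k.zero_le hk ε hε)
      exact fun b hb => ⟨Set.mem_insert_of_mem _ hb.1, hb.2⟩
  · refine ⟨B, ?_, by simpa [topElt, h0] using h2' 0 hm h0, h2', h3,
      fun k hk => h4 k k.zero_le hk⟩
    intro b hb
    obtain ⟨l, h1, -, h3⟩ := h1 b hb; exact Or.inr ⟨l, h1, h3⟩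

end Basis

end KummerModule

/-! ### Uniserial quotients, independence from socles, lifting to `p^m` -/

namespace KummerModule

open Finset

section Ideals

variable {A : Type*} [CommRing A] {p : ℕ} {τ : A}

/-- Every element of `A` is congruent to an integer modulo `τ`. -/
def IntModulo (τ : A) : Prop := ∀ f : A, ∃ (c : ℤ) (q : A), f = c + τ * q

theorem dvd_of_mul_mem (hp : p.Prime) {I : Ideal A} (hpI : (p : A) ∈ I) {y : A} (hy : y ∉ I) {c : ℤ}
    (hc : (c : A) * y ∈ I) : (p : ℤ) ∣ c := by
  by_contra hd
  obtain ⟨u, v, huv⟩ := exists_mul_add_of_not_dvd hp hd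
  have huv' : (u : A) * c + v * p = 1 := by exact_mod_cast congrArg (Int.cast : ℤ → A) huv
  refine hy ?_
  have : y = u * (c * y) + (v * y) * p := by linear_combination (-y) * huv'
  rw [this]
  exact add_mem (I.mul_mem_left _ hc) (I.mul_mem_left _ hpI)

/-- Modulo `p` and powers of `τ` the ring is a chain ring with residue field `𝔽_p`, so these
conditions pin `I` down as `(p, τ^(r+1))`. The induction passes to the ideal of `q` with `τ q ∈ I`.
-/
theorem exists_eq_of_mem_ideal (hp : p.Prime) (hτ : IntModulo τ) (r : ℕ) :
    ∀ (I : Ideal A), (p : A) ∈ I → τ ^ (r + 1) ∈ I → τ ^ r ∉ I → ∀ f ∈ I,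
      ∃ f' q, f = p * f' + τ ^ (r + 1) * q := by
  induction r with
  | zero =>
    intro I hpI _ h2 f hf
    obtain ⟨c, q, rfl⟩ := hτ f
    obtain ⟨c, rfl⟩ := dvd_of_mul_mem hp hpI h2 (c := c) (by
      have : (c : A) * τ ^ 0 = (c + τ * q) - q * τ ^ (0 + 1) := by ring
      rw [this]
      exact sub_mem hf (I.mul_mem_left _ ‹_›))
    exact ⟨c, q, by push_cast; ring⟩
  | succ r ih =>
    intro I hpI h1 h2 f hf
    obtain ⟨c, q, rfl⟩ := hτ f
    obtain ⟨c, rfl⟩ := dvd_of_mul_mem hp hpI h2 (c := c) (by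
      have : (c : A) * τ ^ (r + 1) = τ ^ (r + 1) * (c + τ * q) - q * τ ^ (r + 1 + 1) := by ring
      rw [this]
      exact sub_mem (I.mul_mem_left _ hf) (I.mul_mem_left _ h1))
    have hq : τ * q ∈ I := by
      have : τ * q = (((p : ℤ) * c : ℤ) + τ * q) - (c : A) * p := by push_cast; ring
      rw [this]
      exact sub_mem hf (I.mul_mem_left _ hpI)
    obtain ⟨f', q', hq'⟩ := ih (Submodule.comap (LinearMap.mulLeft A τ) I)
      (show τ * p ∈ I from I.mul_mem_left _ hpI)
      (show τ * τ ^ (r + 1) ∈ I by rw [← pow_succ']; exact h1)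
      (fun h => h2 (by rw [pow_succ']; exact h)) q hq
    exact ⟨c + τ * f', q', by rw [hq']; push_cast; ring⟩

/-- This says that the socle of `A / I` is spanned by `τ^r`. -/
theorem exists_sub_mem_ideal (hp : p.Prime) (hτ : IntModulo τ) (r : ℕ) :
    ∀ (I : Ideal A), (p : A) ∈ I → τ ^ (r + 1) ∈ I → τ ^ r ∉ I → ∀ g, τ * g ∈ I →
      ∃ c : ℤ, g - c * τ ^ r ∈ I := by
  induction r with
  | zero =>
    intro I _ h1 _ g _
    obtain ⟨c, q, rfl⟩ := hτ g
    refine ⟨c, ?_⟩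
    have : (c : A) + τ * q - c * τ ^ 0 = q * τ ^ (0 + 1) := by ring
    rw [this]
    exact I.mul_mem_left _ h1
  | succ r ih =>
    intro I hpI h1 h2 g hg
    obtain ⟨c, q, rfl⟩ := hτ g
    obtain ⟨c, rfl⟩ := dvd_of_mul_mem hp hpI h2 (c := c) (by
      have : (c : A) * τ ^ (r + 1) = τ ^ r * (τ * (c + τ * q)) - q * τ ^ (r + 1 + 1) := by ring
      rw [this]
      exact sub_mem (I.mul_mem_left _ hg) (I.mul_mem_left _ h1))
    obtain ⟨c', hc'⟩ := ih (Submodule.comap (LinearMap.mulLeft A τ) I)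
      (show τ * p ∈ I from I.mul_mem_left _ hpI)
      (show τ * τ ^ (r + 1) ∈ I by rw [← pow_succ']; exact h1)
      (fun h => h2 (by rw [pow_succ']; exact h)) q (by
        have : τ * (τ * q) = τ * (((p : ℤ) * c : ℤ) + τ * q) - τ * c * p := by push_cast; ring
        change τ * (τ * q) ∈ I
        rw [this]
        exact sub_mem hg (I.mul_mem_left _ hpI))
    refine ⟨c', ?_⟩
    have : (((p : ℤ) * c : ℤ) : A) + τ * q - c' * τ ^ (r + 1) =
        τ * (q - c' * τ ^ r) + c * p := by push_cast; ring
    rw [this]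
    exact add_mem hc' (I.mul_mem_left _ hpI)

variable {M : Type*} [AddCommGroup M] [Module A M]

/-- The ideal of elements that map `x` into the submodule `N`. -/
def transporter (N : Submodule A M) (x : M) : Ideal A := N.comap (LinearMap.toSpanSingleton A M x)

theorem mem_transporter {N : Submodule A M} {x : M} {f : A} : f ∈ transporter N x ↔ f • x ∈ N :=
  Iff.rfl

/-- Cyclic modules whose socles are independent modulo `N` are independent modulo `N`. -/
theorem smul_mem_of_sum_mem (hp : p.Prime) (hτ : IntModulo τ) {N : Submodule A M}
    (hpN : ∀ x : M, (p : A) • x ∈ N) {R : ℕ} (hR : ∀ x : M, τ ^ R • x ∈ N) {ι : Type*} (x : ι → M)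
    (r : ι → ℕ) (h1 : ∀ i, τ ^ (r i + 1) • x i ∈ N) (h2 : ∀ i, τ ^ r i • x i ∉ N) (s : Finset ι)
    (hs : ∀ c : ι → ℤ, ∑ i ∈ s, (c i : A) • τ ^ r i • x i ∈ N →
      ∀ i ∈ s, (c i : A) • τ ^ r i • x i ∈ N)
    (f : ι → A) (hf : ∑ i ∈ s, f i • x i ∈ N) : ∀ i ∈ s, f i • x i ∈ N := by
  suffices key : ∀ R : ℕ, (∀ i ∈ s, τ ^ R • f i • x i ∈ N) → ∀ i ∈ s, f i • x i ∈ N from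
    key R fun i _ => hR _
  intro R
  induction R with
  | zero => exact fun h i hi => by simpa using h i hi
  | succ R ih =>
    intro h
    refine ih ?_
    -- Each `τ^R f_i x_i` is killed by `τ` modulo `N`, hence is a multiple of the socle generator
    -- `τ^(r i) x_i`; independence of the socles removes it, and `R` drops by one.
    have hc : ∀ i, ∃ c : ℤ, i ∈ s → (τ ^ R * f i - c * τ ^ r i) • x i ∈ N := by
      intro i
      by_cases hi : i ∈ s
      · obtain ⟨c, hc⟩ := exists_sub_mem_ideal hp hτ (r i) (transporter N (x i)) (hpN _) (h1 i)
          (h2 i) (τ ^ R * f i) (by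
            rw [mem_transporter, ← mul_assoc, ← pow_succ', mul_smul]; exact h i hi)
        exact ⟨c, fun _ => hc⟩
      · exact ⟨0, fun h => absurd h hi⟩
    choose c hc using hc
    have hsum : ∑ i ∈ s, (c i : A) • τ ^ r i • x i ∈ N := by
      have : ∑ i ∈ s, (c i : A) • τ ^ r i • x i = τ ^ R • ∑ i ∈ s, f i • x i -
          ∑ i ∈ s, (τ ^ R * f i - c i * τ ^ r i) • x i := by
        rw [smul_sum, ← sum_sub_distrib]
        exact sum_congr rfl fun i _ => by module
      rw [this]
      exact sub_mem (N.smul_mem _ hf) (sum_mem fun i hi => hc i hi)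
    intro i hi
    have : τ ^ R • f i • x i = (τ ^ R * f i - c i * τ ^ r i) • x i + (c i : A) • τ ^ r i • x i := by
      module
    rw [this]
    exact add_mem (hc i hi) (hs c hsum i hi)

/-- Dividing a relation by `p` leaves an error in the `p`-torsion `⟨ξ⟩`. Because `ξ ∈ X + p^(m-1)
M`, the error can be moved into the `X`-component without disturbing divisibility by `p^j` for `j <
m`. -/
theorem exists_eq_of_add_eq_pow_smul {ξ : M} (htors : ∀ x : M, (p : A) • x = 0 → ∃ c : ℤ, x = (c : A) • ξ)
    (hpξ : (p : A) • ξ = 0) {m : ℕ} {X S : Submodule A M}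
    (hX : ∀ y ∈ X, ∀ s ∈ S, (∃ w, y + s = (p : A) • w) →
      (∃ y' ∈ X, ∃ w, y = (p : A) • y' + ((p : A) ^ m) • w) ∧ ∃ s' ∈ S, s = (p : A) • s')
    (hξ : ∃ x ∈ X, ∃ w, ξ = x + ((p : A) ^ (m - 1)) • w) (j : ℕ) (hj : j ≤ m) :
    ∀ y ∈ X, ∀ s ∈ S, (∃ w, y + s = ((p : A) ^ j) • w) → ∃ w, y = ((p : A) ^ j) • w := by
  induction j with
  | zero => exact fun y _ _ _ _ => ⟨y, by simp⟩
  | succ j ih =>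
    rintro y hy s hs ⟨w, hw⟩
    obtain ⟨⟨y', hy', z, hyz⟩, s', hs', rfl⟩ := hX y hy s hs
      ⟨((p : A) ^ j) • w, by rw [hw]; module⟩
    obtain ⟨r, rfl⟩ : ∃ r, m = j + 1 + r := ⟨m - (j + 1), by omega⟩
    obtain ⟨x, hx, w', hξx⟩ := hξ
    rw [show j + 1 + r - 1 = j + r by omega] at hξx
    obtain ⟨c, hc⟩ := htors (y' + s' + ((p : A) ^ (j + r)) • z - ((p : A) ^ j) • w) (by
      linear_combination (norm := module) hw - hyz)
    obtain ⟨v, hv⟩ := ih (by omega) (y' - (c : A) • x) (sub_mem hy' (X.smul_mem _ hx)) s' hs'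
      ⟨w - ((p : A) ^ r) • z + (c : A) • ((p : A) ^ r) • w', by
        linear_combination (norm := module) hc + (c : A) • hξx⟩
    exact ⟨v + ((p : A) ^ r) • z - (c : A) • ((p : A) ^ r) • w', by
      linear_combination (norm := module) hyz + (p : A) • hv - ((p : A) * c) • hξx + (c : A) • hpξ⟩

end Ideals

end KummerModule

/-! ### Complements of the exceptional module, modulo `p` and modulo `p^m` -/

namespace KummerModule

open Finset

section Decomposition

variable {A M : Type*} [CommRing A] [AddCommGroup M] [Module A M] {p n m : ℕ} {σ : A}
variable {𝔽 J : Type*} [Field 𝔽] [AddCommGroup J] [Module 𝔽 J]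

/-- The nonzero elements among `α, δ_1, …, δ_{m-1}`. -/
def excSet (m : ℕ) (α : M) (δ : ℕ → M) : Set M :=
  insert α {x | ∃ j, 1 ≤ j ∧ j < m ∧ x = δ j} \ {0}

variable (A M) in
/-- The multiples of `p`. -/
def multiples (p : ℕ) : Submodule A M := LinearMap.range (LinearMap.lsmul A M (p : A))

theorem mem_multiples {x : M} : x ∈ multiples A M p ↔ ∃ w, x = (p : A) • w := by
  simp only [multiples, LinearMap.mem_range, LinearMap.lsmul_apply, eq_comm]

theorem smul_mem_multiples (x : M) : (p : A) • x ∈ multiples A M p := mem_multiples.2 ⟨x, rfl⟩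

/-- `p X + p ^ m M`. -/
def thicken (p m : ℕ) (X : Submodule A M) : Submodule A M :=
  X.map (LinearMap.lsmul A M (p : A)) ⊔ LinearMap.range (LinearMap.lsmul A M ((p : A) ^ m))

theorem mem_thicken {X : Submodule A M} {x : M} :
    x ∈ thicken p m X ↔ ∃ y ∈ X, ∃ w, x = (p : A) • y + ((p : A) ^ m) • w := by
  simp only [thicken, Submodule.mem_sup, Submodule.mem_map, LinearMap.mem_range,
    LinearMap.lsmul_apply]
  constructor
  · rintro ⟨_, ⟨y, hy, rfl⟩, _, ⟨w, rfl⟩, rfl⟩; exact ⟨y, hy, w, rfl⟩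
  · rintro ⟨y, hy, w, rfl⟩; exact ⟨_, ⟨y, hy, rfl⟩, _, ⟨w, rfl⟩, rfl⟩

theorem smul_mem_thicken {X : Submodule A M} {x : M} (hx : x ∈ X) : (p : A) • x ∈ thicken p m X :=
  mem_thicken.2 ⟨x, hx, 0, by simp⟩

theorem thicken_le (hm : 0 < m) (X : Submodule A M) : thicken p m X ≤ multiples A M p := by
  intro x hx
  obtain ⟨y, -, w, rfl⟩ := mem_thicken.1 hx
  obtain ⟨r, rfl⟩ : ∃ r, m = r + 1 := ⟨m - 1, by omega⟩
  exact mem_multiples.2 ⟨y + ((p : A) ^ r) • w, by module⟩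

variable {π : M →+ J} {ξ : M} {a : ℕ → WithBot ℕ} {e : ℤ} {α : M} {δ : ℕ → M}

variable (H : IsKummer p n σ ξ) (h : Rep p n m σ ξ a e α δ) (hmin : LexMin p n m σ ξ a)
  (hm : 0 < m) (hsmall : p = 2 → n = 1 → ∃ z : M, normSum p σ n • z = ξ)
  (hπ : ∀ x, π x = 0 ↔ ∃ w, x = (p : A) • w) (h𝔽 : ∀ c : 𝔽, ∃ k : ℤ, c = k)

include hπ in
theorem map_eq_zero_iff_mem {x : M} : π x = 0 ↔ x ∈ multiples A M p := by
  rw [hπ, mem_multiples]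

omit [Module 𝔽 J] [Field 𝔽] in
include hπ in
theorem map_pow_smul_eq_socle (hp : p.Prime) (k : ℕ) (x : M) :
    π ((σ - 1) ^ (p ^ k - 1) • x) = socle p σ π (k, x) := by
  obtain ⟨g, hg⟩ := exists_normSum_eq_sub_one_pow p σ hp k
  change _ = π (normSum p σ k • x)
  exact (map_eq_iff hπ).2 ⟨-(g • x), by linear_combination (norm := module) (-hg) • x⟩

theorem pow_smul_eq_of_mem_fixedBy (hp : p.Prime) {k : ℕ} {x : M} (hx : x ∈ fixedBy M p σ k) :
    ∃ g : A, (σ - 1) ^ (p ^ k - 1 + 1) • x = (p : A) • g • x := by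
  rw [Nat.sub_add_cancel (Nat.one_le_pow _ _ hp.pos)]
  obtain ⟨g, hg⟩ := exists_sub_one_pow_eq p σ hp k
  exact ⟨g, by linear_combination (norm := module) hg • x + (mem_fixedBy p σ).1 hx⟩

include h in
theorem Rep.sub_one_smul_sub_mem {X : Submodule A M} (hα : α ∈ X)
    (hδ : ∀ j, 1 ≤ j → j < m → δ j ∈ X) : (σ - 1) • α - δ 0 ∈ thicken p m X := by
  have htail : ∀ k, ∑ i ∈ range k, (p : A) • ((p : A) ^ i) • δ (i + 1) ∈ thicken p m X ∨ m < k := by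
    intro k
    by_cases hk : m < k
    · exact Or.inr hk
    · refine Or.inl (sum_mem fun i hi => ?_)
      have hik := mem_range.1 hi
      by_cases him : i + 1 < m
      · exact smul_mem_thicken (X.smul_mem _ (hδ (i + 1) (by omega) him))
      -- The last term involves `δ_m`, which is not a generator of `X`; its coefficient `p^m` puts
      -- it in the second summand.
      · have : m = i + 1 := by omega
        exact mem_thicken.2 ⟨0, zero_mem _, δ (i + 1), by rw [this]; module⟩
  have h1 : (σ - 1) • α - δ 0 = (p : A) • (e : A) • α +
      ∑ i ∈ range m, (p : A) • ((p : A) ^ i) • δ (i + 1) := by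
    rw [h.sub_one_smul, ← smul_sum, tailSum]; module
  rw [h1]
  exact add_mem (smul_mem_thicken (X.smul_mem _ hα)) ((htail m).resolve_right (lt_irrefl _))

include h hm hπ in
omit [Module 𝔽 J] [Field 𝔽] in
-- Modulo `p X + p^m M`, `σ - 1` sends `α` to `δ_0`. So `⟨α⟩` is one step longer than `⟨δ_0⟩`: `r =
-- p^k` if `a 0 = k`, and `r = 0` if `δ_0 = 0`.
theorem Rep.exists_length (hp : p.Prime) {X : Submodule A M} (hα : α ∈ X)
    (hδ : ∀ j, 1 ≤ j → j < m → δ j ∈ X) :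
    ∃ r, π ((σ - 1) ^ r • α) = socle p σ π (a 0, topElt a α δ) ∧
      (σ - 1) ^ (r + 1) • α ∈ thicken p m X := by
  have hW := h.sub_one_smul_sub_mem hα hδ
  have hδ0 := h.δ_mem 0 hm
  by_cases h0 : a 0 = ⊥
  · rw [h0] at hδ0
    have hδ0 : δ 0 = 0 := (Submodule.mem_bot A).1 hδ0
    rw [hδ0, sub_zero] at hW
    exact ⟨0, by rw [socle_topElt_of_eq_bot h0]; simp, by simpa using hW⟩
  · obtain ⟨k, hk⟩ := WithBot.ne_bot_iff_exists.1 h0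
    rw [← hk] at hδ0
    change δ 0 ∈ fixedBy M p σ k at hδ0
    have htop : topElt a α δ = δ 0 := by simp [topElt, h0]
    have hp1 : p ^ k - 1 + 1 = p ^ k := Nat.sub_add_cancel (Nat.one_le_pow _ _ hp.pos)
    refine ⟨p ^ k, ?_, ?_⟩
    · rw [htop, ← hk]
      refine Eq.trans ?_ (map_pow_smul_eq_socle hπ hp k (δ 0))
      obtain ⟨w, hw⟩ := mem_multiples.1 (thicken_le hm X hW)
      refine (map_eq_iff hπ).2 ⟨(σ - 1) ^ (p ^ k - 1) • w, ?_⟩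
      rw [← hp1, Nat.add_sub_cancel]
      linear_combination (norm := module) (σ - 1) ^ (p ^ k - 1) • hw
    · obtain ⟨g, hg⟩ := pow_smul_eq_of_mem_fixedBy hp hδ0
      rw [hp1] at hg
      have : (σ - 1) ^ (p ^ k + 1) • α = (σ - 1) ^ p ^ k • ((σ - 1) • α - δ 0) +
          ((p : A) • g • (σ - 1) • α - ((p : A) * g) • ((σ - 1) • α - δ 0)) := by
        linear_combination (norm := module) hg
      rw [this]
      exact add_mem (Submodule.smul_mem _ _ hW) (sub_mem
        (smul_mem_thicken (X.smul_mem _ (X.smul_mem _ hα))) (Submodule.smul_mem _ _ hW))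

include H h hm hπ

omit [Module 𝔽 J] [Field 𝔽] in
/-- The elements of `excSet` generate cyclic modules of known length and socle. -/
theorem Rep.exists_length_of_mem {x : M} (hx : x ∈ excSet m α δ) :
    ∃ r b, π ((σ - 1) ^ r • x) = socle p σ π b ∧
      (σ - 1) ^ (r + 1) • x ∈ thicken p m (Submodule.span A (excSet m α δ)) ∧
      ((x = α ∧ b = (a 0, topElt a α δ)) ∨
        ∃ j, 1 ≤ j ∧ j < m ∧ a j ≠ ⊥ ∧ x = δ j ∧ b = (a j, δ j)) := by
  have hspan : ∀ y ∈ insert α {x | ∃ j, 1 ≤ j ∧ j < m ∧ x = δ j},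
      y ∈ Submodule.span A (excSet m α δ) := by
    intro y hy
    by_cases hy0 : y = 0
    · rw [hy0]; exact zero_mem _
    · exact Submodule.subset_span ⟨hy, hy0⟩
  have hα := hspan α (Set.mem_insert _ _)
  have hδ : ∀ j, 1 ≤ j → j < m → δ j ∈ Submodule.span A (excSet m α δ) :=
    fun j h1 h2 => hspan _ (Set.mem_insert_of_mem _ ⟨j, h1, h2, rfl⟩)
  rcases hx with ⟨rfl | ⟨j, h1, h2, rfl⟩, hx0⟩
  · obtain ⟨r, hr1, hr2⟩ := h.exists_length hm hπ H.prime hα hδ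
    exact ⟨r, _, hr1, hr2, Or.inl ⟨rfl, rfl⟩⟩
  · have hmem := h.δ_mem j h2
    have hne : a j ≠ ⊥ := by
      intro hbot
      rw [hbot] at hmem
      exact hx0 ((Submodule.mem_bot A).1 hmem)
    obtain ⟨k, hk⟩ := WithBot.ne_bot_iff_exists.1 hne
    rw [← hk] at hmem
    refine ⟨p ^ k - 1, (a j, δ j), by rw [← hk]; exact map_pow_smul_eq_socle hπ H.prime k _, ?_,
      Or.inr ⟨j, h1, h2, hne, rfl, rfl⟩⟩
    obtain ⟨g, hg⟩ := pow_smul_eq_of_mem_fixedBy H.prime hmem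
    rw [hg]
    exact smul_mem_thicken (Submodule.smul_mem _ _ (hδ j h1 h2))

include hmin hsmall h𝔽

/-- `T` consists of the vectors of the adapted basis not accounted for by `α` and the `δ_j`.
Generation follows from `LexMin.eq_top`, and independence from that of the socles. -/
theorem LexMin.exists_complement (hτ : IntModulo (σ - 1)) : ∃ T : Set M,
    (∀ t ∈ T, ∃ k ≤ n, t ∈ fixedBy M p σ k ∧ π (normSum p σ k • t) ≠ 0) ∧
    (∀ Z : Submodule A M, (∀ x, (p : A) • x ∈ Z) → excSet m α δ ⊆ Z → T ⊆ Z → Z = ⊤) ∧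
    ∀ (s : Finset (excSet m α δ ⊕ T)) (f : excSet m α δ ⊕ T → A),
      π (∑ i ∈ s, f i • (Sum.elim Subtype.val Subtype.val i : M)) = 0 →
      ∀ i ∈ s, π (f i • (Sum.elim Subtype.val Subtype.val i : M)) = 0 := by
  obtain ⟨B, hB1, hB2, hB3, hB4, hB5⟩ := hmin.exists_basis H h hm hsmall hπ h𝔽
  let T : Set M := {t | ∃ k : ℕ, ((k : WithBot ℕ), t) ∈ B ∧
    ((k : WithBot ℕ), t) ≠ (a 0, topElt a α δ) ∧ ∀ j < m, ((k : WithBot ℕ), t) ≠ (a j, δ j)}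
  have hT : ∀ t ∈ T, ∃ k : ℕ, k ≤ n ∧ t ∈ fixedBy M p σ k ∧ ((k : WithBot ℕ), t) ∈ B ∧
      ((k : WithBot ℕ), t) ≠ (a 0, topElt a α δ) ∧
      ∀ j < m, ((k : WithBot ℕ), t) ≠ (a j, δ j) := by
    rintro t ⟨k, hk1, hk2, hk3⟩
    obtain ⟨l, h1, h2, h3⟩ := (hB1 _ hk1).resolve_left hk2
    obtain rfl : k = l := WithBot.coe_injective h1
    exact ⟨k, h2, h3, hk1, hk2, hk3⟩
  have hsoc : ∀ b ∈ B, socle p σ π b ≠ 0 := fun b hb => hB4.ne_zero hb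
  refine ⟨T, ?_, ?_, ?_⟩
  · intro t ht
    obtain ⟨k, h1, h2, h3, -⟩ := hT t ht
    exact ⟨k, h1, h2, hsoc _ h3⟩
  · intro Z hpZ hX hTZ
    have hZ : ∀ y ∈ insert α {x | ∃ j, 1 ≤ j ∧ j < m ∧ x = δ j}, y ∈ Z := by
      intro y hy
      by_cases hy0 : y = 0
      · rw [hy0]; exact zero_mem _
      · exact hX ⟨hy, hy0⟩
    have hα : α ∈ Z := hZ α (Set.mem_insert _ _)
    have hδ0 : δ 0 ∈ Z := by
      have : δ 0 = (σ - 1) • α - (p : A) • ((e : A) • α + tailSum A p m δ) := by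
        rw [h.sub_one_smul]; module
      rw [this]
      exact sub_mem (Z.smul_mem _ hα) (hpZ _)
    have hδ : ∀ j < m, δ j ∈ Z := by
      intro j hj
      rcases Nat.eq_zero_or_pos j with rfl | hj0
      · exact hδ0
      · exact hZ _ (Set.mem_insert_of_mem _ ⟨j, hj0, hj, rfl⟩)
    refine hmin.eq_top H h hm hsmall Z hpZ hα fun k hk ε hε => ?_
    have hside : ∀ b ∈ {b ∈ B | (k : WithBot ℕ) ≤ b.1},
        (∃ l : ℕ, b.1 = l ∧ k ≤ l ∧ b.2 ∈ fixedBy M p σ l) ∧ b.2 ∈ Z := by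
      rintro b ⟨hb, hkb⟩
      by_cases hb0 : b = (a 0, topElt a α δ)
      · subst hb0
        have hne : a 0 ≠ ⊥ := by rintro h0; rw [h0] at hkb; exact absurd hkb (by simp)
        obtain ⟨l, hl⟩ := WithBot.ne_bot_iff_exists.1 hne
        have hmem := h.δ_mem 0 hm
        have htop : topElt a α δ = δ 0 := by simp [topElt, hne]
        rw [← hl] at hmem
        simp only [htop]
        refine ⟨⟨l, hl.symm, ?_, hmem⟩, hδ0⟩
        rw [← hl] at hkb
        exact WithBot.coe_le_coe.1 hkb
      · obtain ⟨l, h1, h2, h3⟩ := (hB1 _ hb).resolve_left hb0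
        refine ⟨⟨l, h1, ?_, h3⟩, ?_⟩
        · rw [h1] at hkb; exact WithBot.coe_le_coe.1 hkb
        · by_cases hex : ∃ j < m, b = (a j, δ j)
          · obtain ⟨j, hj, rfl⟩ := hex; exact hδ j hj
          · push Not at hex
            obtain ⟨b1, b2⟩ := b
            dsimp only at h1
            subst h1
            exact hTZ ⟨l, hb, hb0, hex⟩
    obtain ⟨z, hz1, hz2, hz3⟩ := exists_of_mem_span_socle h𝔽 hside (hB5 k hk ε hε)
    exact ⟨z, hz1, hz2, (map_eq_iff hπ).1 hz3⟩
  · have hdata : ∀ i : excSet m α δ ⊕ T, ∃ r b,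
        π ((σ - 1) ^ r • (Sum.elim Subtype.val Subtype.val i : M)) = socle p σ π b ∧
        π ((σ - 1) ^ (r + 1) • (Sum.elim Subtype.val Subtype.val i : M)) = 0 ∧ b ∈ B ∧
        match i with
        | .inl x => (x.1 = α ∧ b = (a 0, topElt a α δ)) ∨
            ∃ j, 1 ≤ j ∧ j < m ∧ a j ≠ ⊥ ∧ x.1 = δ j ∧ b = (a j, δ j)
        | .inr t => b.2 = t.1 ∧ b ≠ (a 0, topElt a α δ) ∧ ∀ j < m, b ≠ (a j, δ j) := by
      rintro (⟨x, hx⟩ | ⟨t, ht⟩)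
      · obtain ⟨r, b, h1, h2, h3⟩ := h.exists_length_of_mem H hm hπ hx
        refine ⟨r, b, h1, (map_eq_zero_iff_mem hπ).2 (thicken_le hm _ h2), ?_, h3⟩
        rcases h3 with ⟨-, rfl⟩ | ⟨j, -, hj, hne, -, rfl⟩
        · exact hB2
        · exact hB3 j hj hne
      · obtain ⟨k, h1, h2, h3, h4, h5⟩ := hT t ht
        obtain ⟨g, hg⟩ := pow_smul_eq_of_mem_fixedBy H.prime h2
        exact ⟨p ^ k - 1, _, map_pow_smul_eq_socle hπ H.prime k t, (hπ _).2 ⟨g • t, hg⟩, h3, rfl,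
          h4, h5⟩
    choose r b hr1 hr2 hbB hb using hdata
    -- Distinct generators use distinct basis vectors: `α` sits at level `a 0`, which is strictly
    -- below every `a j ≠ ⊥` with `j ≥ 1`, and `T` avoids all of these by construction.
    have hbinj : Function.Injective b := by
      intro i i' hii
      have hi := hb i
      have hi' := hb i'
      rw [← hii] at hi'
      match i, i', hi, hi' with
      | .inl x, .inl x', hi, hi' =>
        congr 1
        refine Subtype.ext ?_
        rcases hi with ⟨h1, h2⟩ | ⟨j, h1, h2, h3, h4, h5⟩ <;>
        rcases hi' with ⟨h1', h2'⟩ | ⟨j', h1', h2', h3', h4', h5'⟩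
        · rw [h1, h1']
        · rw [h2] at h5'
          exact absurd (congrArg Prod.fst h5') (hmin.apply_lt H h h1' h2' h3').ne
        · rw [h2'] at h5
          exact absurd (congrArg Prod.fst h5) (hmin.apply_lt H h h1 h2 h3).ne
        · rw [h5] at h5'
          rw [h4, h4']; exact (Prod.mk.inj h5').2
      | .inl x, .inr t, hi, hi' =>
        rcases hi with ⟨-, h2⟩ | ⟨j, -, h2, -, -, h5⟩
        · exact absurd h2 hi'.2.1
        · exact absurd h5 (hi'.2.2 j h2)
      | .inr t, .inl x, hi, hi' =>
        rcases hi' with ⟨-, h2⟩ | ⟨j, -, h2, -, -, h5⟩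
        · exact absurd h2 hi.2.1
        · exact absurd h5 (hi.2.2 j h2)
      | .inr t, .inr t', hi, hi' =>
        congr 1
        exact Subtype.ext (hi.1.symm.trans hi'.1)
    have hLI : LinearIndependent 𝔽 fun i => socle p σ π (b i) :=
      hB4.comp (fun i => (⟨b i, hbB i⟩ : B)) fun i i' hii => hbinj (congrArg Subtype.val hii)
    intro s f hf
    have hN : ∀ {x : M}, π x = 0 ↔ x ∈ multiples A M p := map_eq_zero_iff_mem hπ
    simp only [hN] at hf ⊢
    refine smul_mem_of_sum_mem H.prime hτ smul_mem_multiples (R := p ^ n) ?_ _ r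
      (fun i => hN.1 (hr2 i)) (fun i hi => ?_) s ?_ f hf
    · intro x
      obtain ⟨w, hw⟩ := sub_one_pow_smul_of_mem H.prime (H.mem_top (x := x))
      exact mem_multiples.2 ⟨w, hw⟩
    · rw [← hN, hr1] at hi
      exact hsoc _ (hbB i) hi
    · intro c hc i hi
      rw [← hN, map_sum] at hc
      simp only [map_intCast_smul (𝔽 := 𝔽), hr1] at hc
      have := linearIndependent_iff'.1 hLI s (fun i => (c i : 𝔽)) hc i hi
      rw [← hN, map_intCast_smul (𝔽 := 𝔽), this, zero_smul]

/-- The annihilator of `x` modulo `p` is `(p, (σ - 1)^(r+1))`, and both generators send `x` into `p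
X + p^m M`. -/
theorem LexMin.exists_eq_of_smul_mem (hτ : IntModulo (σ - 1)) {x : M} (hx : x ∈ excSet m α δ)
    {f : A} (hf : f • x ∈ multiples A M p) :
    f • x ∈ thicken p m (Submodule.span A (excSet m α δ)) := by
  obtain ⟨B, -, hB2, hB3, hB4, -⟩ := hmin.exists_basis H h hm hsmall hπ h𝔽
  obtain ⟨r, b, h1, h2, h3⟩ := h.exists_length_of_mem H hm hπ hx
  have hbB : b ∈ B := by
    rcases h3 with ⟨-, rfl⟩ | ⟨j, -, hj, hne, -, rfl⟩
    · exact hB2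
    · exact hB3 j hj hne
  obtain ⟨f', q, rfl⟩ := exists_eq_of_mem_ideal H.prime hτ r (transporter (multiples A M p) x)
    (smul_mem_multiples x) (thicken_le hm _ h2)
    (fun hmem => hB4.ne_zero hbB (by rw [← h1, map_eq_zero_iff_mem hπ]; exact hmem)) f hf
  have : ((p : A) * f' + (σ - 1) ^ (r + 1) * q) • x =
      (p : A) • f' • x + q • (σ - 1) ^ (r + 1) • x := by module
  rw [this]
  exact add_mem (smul_mem_thicken (Submodule.smul_mem _ _ (Submodule.subset_span hx)))
    (Submodule.smul_mem _ _ h2)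

omit [Module 𝔽 J] [Field 𝔽] h𝔽 hπ hmin hsmall H in
-- Eliminate `δ_0` from the norm equation by means of the first equation. All that is left outside
-- `X` is the contribution of `δ_m`, with factor `p^(m-1)`.
theorem Rep.exists_xi_eq : ∃ x ∈ Submodule.span A (excSet m α δ), ∃ w,
    ξ = x + ((p : A) ^ (m - 1)) • w := by
  set X := Submodule.span A (excSet m α δ)
  have hspan : ∀ y ∈ insert α {x | ∃ j, 1 ≤ j ∧ j < m ∧ x = δ j}, y ∈ X := by
    intro y hy
    by_cases hy0 : y = 0
    · rw [hy0]; exact zero_mem _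
    · exact Submodule.subset_span ⟨hy, hy0⟩
  have hα := hspan α (Set.mem_insert _ _)
  have hδ : ∀ j, 1 ≤ j → j < m → δ j ∈ X :=
    fun j h1 h2 => hspan _ (Set.mem_insert_of_mem _ ⟨j, h1, h2, rfl⟩)
  obtain ⟨r, rfl⟩ : ∃ r, m = r + 1 := ⟨m - 1, by omega⟩
  rw [Nat.add_sub_cancel]
  have htail : ∃ y ∈ X, tailSum A p (r + 1) δ = y + ((p : A) ^ r) • δ (r + 1) := by
    refine ⟨_, ?_, sum_range_succ _ r⟩
    exact sum_mem fun i hi => X.smul_mem _ (hδ _ (by omega) (by have := mem_range.1 hi; omega))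
  obtain ⟨y, hy, hyt⟩ := htail
  have h1 := h.eq_norm
  rw [normPart_eq, hyt] at h1
  have h2 := h.sub_one_smul
  rw [hyt] at h2
  refine ⟨(e : A) • normSum p σ n • α + normSum p σ (n - 1) • ((σ - 1) • α - (p : A) • ((e : A) • α + y))
    + normSum p σ n • y, ?_, (normSum p σ n - (p : A) * normSum p σ (n - 1)) • δ (r + 1), ?_⟩
  · refine add_mem (add_mem ?_ ?_) ?_
    · exact X.smul_mem _ (X.smul_mem _ hα)
    · exact X.smul_mem _ (sub_mem (X.smul_mem _ hα)
        (X.smul_mem _ (add_mem (X.smul_mem _ hα) hy)))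
    · exact X.smul_mem _ hy
  · linear_combination (norm := module) h1 - normSum p σ (n - 1) • h2

/-- A family complementary to `excSet` modulo `p` is complementary modulo `p ^ m`. -/
theorem LexMin.disjoint_of_complement (hτ : IntModulo (σ - 1)) {T : Set M}
    (hT : ∀ t ∈ T, ∀ g : A, g • t ∈ multiples A M p → ∃ g' : A, g • t = (p : A) • g' • t)
    (hind : ∀ (s : Finset (excSet m α δ ⊕ T)) (f : excSet m α δ ⊕ T → A),
      π (∑ i ∈ s, f i • (Sum.elim Subtype.val Subtype.val i : M)) = 0 →
      ∀ i ∈ s, π (f i • (Sum.elim Subtype.val Subtype.val i : M)) = 0)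
    {y z : M} (hy : y ∈ Submodule.span A (excSet m α δ)) (hz : z ∈ Submodule.span A T)
    (hyz : ∃ w, y + z = ((p : A) ^ m) • w) : ∃ w, y = ((p : A) ^ m) • w := by
  refine exists_eq_of_add_eq_pow_smul H.torsion H.p_smul (m := m) (S := Submodule.span A T) ?_
    (h.exists_xi_eq hm) m le_rfl y hy z hz hyz
  clear! y z
  intro y hy z hz hyz
  classical
  obtain ⟨f, hf⟩ := (Finsupp.mem_span_iff_linearCombination A _ y).1 hy
  obtain ⟨g, hg⟩ := (Finsupp.mem_span_iff_linearCombination A _ z).1 hz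
  rw [Finsupp.linearCombination_apply, Finsupp.sum] at hf hg
  have key := hind (f.support.disjSum g.support) (Sum.elim f g) (by
    rw [sum_disjSum]
    simp only [Sum.elim_inl, Sum.elim_inr]
    rw [hf, hg, hπ]; exact hyz)
  constructor
  · refine mem_thicken.1 ?_
    rw [← hf]
    refine sum_mem fun i hi => hmin.exists_eq_of_smul_mem H h hm hsmall hπ h𝔽 hτ i.2 ?_
    have := key (Sum.inl i) (by simpa using hi)
    rwa [map_eq_zero_iff_mem hπ] at this
  · have hg' : ∀ i ∈ g.support, ∃ g' : A, g i • (i : M) = (p : A) • g' • (i : M) := by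
      intro i hi
      refine hT i i.2 _ ?_
      have := key (Sum.inr i) (by simpa using hi)
      rwa [map_eq_zero_iff_mem hπ] at this
    choose! g' hg' using hg'
    refine ⟨∑ i ∈ g.support, g' i • (i : M),
      sum_mem fun i _ => Submodule.smul_mem _ _ (Submodule.subset_span i.2), ?_⟩
    rw [← hg, smul_sum]
    exact sum_congr rfl fun i hi => hg' i hi

omit H h hmin hm hsmall hπ h𝔽 [Module 𝔽 J] [Field 𝔽] in
theorem exists_add_of_span_top {X S : Submodule A M} (hXS : ∀ x, ∃ y ∈ X, ∃ z ∈ S, ∃ w,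
    x = y + z + (p : A) • w) (j : ℕ) (x : M) : ∃ y ∈ X, ∃ z ∈ S, ∃ w,
    x = y + z + ((p : A) ^ j) • w := by
  induction j with
  | zero => exact ⟨0, zero_mem _, 0, zero_mem _, x, by simp⟩
  | succ j ih =>
    obtain ⟨y, hy, z, hz, w, hw⟩ := ih
    obtain ⟨y', hy', z', hz', w', hw'⟩ := hXS w
    exact ⟨y + ((p : A) ^ j) • y', add_mem hy (X.smul_mem _ hy'), z + ((p : A) ^ j) • z',
      add_mem hz (S.smul_mem _ hz'), w', by rw [hw, hw']; module⟩

end Decomposition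

end KummerModule

/-! ### The unit group as a `ℤ[X]`-module and its map to power classes -/

namespace KummerModule

open Finset Polynomial

section UnitModule

variable {F K : Type*} [Field F] [Field K] [Algebra F K]

/-- `Kˣ`, written additively, as a `ℤ[X]`-module on which `X` acts as `σ`. -/
def UnitModule (_σ : K ≃ₐ[F] K) : Type _ := Additive Kˣ

noncomputable section

instance (σ : K ≃ₐ[F] K) : AddCommGroup (UnitModule σ) := inferInstanceAs (AddCommGroup (Additive Kˣ))

/-- `σ` as an endomorphism of `Kˣ`. -/
def unitEnd (σ : K ≃ₐ[F] K) : Module.End ℤ (Additive Kˣ) :=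
  (MonoidHom.toAdditive (act σ)).toIntLinearMap

instance (σ : K ≃ₐ[F] K) : Module ℤ[X] (UnitModule σ) :=
  Module.compHom (Additive Kˣ) (aeval (unitEnd σ)).toRingHom

variable (σ : K ≃ₐ[F] K)

/-- The element of `UnitModule σ` given by a unit. -/
def ofUnit (u : Kˣ) : UnitModule σ := Additive.ofMul u

theorem ofUnit_injective : Function.Injective (ofUnit σ) := fun _ _ h => h

theorem ofUnit_surjective : Function.Surjective (ofUnit σ) := fun u => ⟨u, rfl⟩

@[simp] theorem ofUnit_one : ofUnit σ 1 = 0 := rfl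

theorem ofUnit_mul (u v : Kˣ) : ofUnit σ (u * v) = ofUnit σ u + ofUnit σ v := rfl

theorem ofUnit_div (u v : Kˣ) : ofUnit σ (u / v) = ofUnit σ u - ofUnit σ v := rfl

theorem ofUnit_zpow (u : Kˣ) (c : ℤ) : ofUnit σ (u ^ c) = (c : ℤ[X]) • ofUnit σ u := by
  rw [Int.cast_smul_eq_zsmul]; rfl

theorem ofUnit_pow (u : Kˣ) (c : ℕ) : ofUnit σ (u ^ c) = (c : ℤ[X]) • ofUnit σ u := by
  rw [Nat.cast_smul_eq_nsmul]; rfl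

theorem ofUnit_prod {ι : Type*} (s : Finset ι) (u : ι → Kˣ) :
    ofUnit σ (∏ i ∈ s, u i) = ∑ i ∈ s, ofUnit σ (u i) := by
  classical
  induction s using Finset.induction_on with
  | empty => rfl
  | insert i s hi ih => rw [prod_insert hi, sum_insert hi, ofUnit_mul, ih]

theorem X_smul_ofUnit (u : Kˣ) : (X : ℤ[X]) • ofUnit σ u = ofUnit σ (act σ u) := by
  change (aeval (unitEnd σ)) X (Additive.ofMul u) = _
  rw [aeval_X]
  rfl

theorem X_pow_smul_ofUnit (k : ℕ) (u : Kˣ) :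
    (X ^ k : ℤ[X]) • ofUnit σ u = ofUnit σ (act (σ ^ k) u) := by
  induction k with
  | zero => rw [pow_zero, pow_zero, one_smul]; rfl
  | succ k ih => rw [pow_succ', mul_smul, ih, X_smul_ofUnit, pow_succ']; rfl

theorem normSum_smul_ofUnit (p k : ℕ) (u : Kˣ) :
    normSum p (X : ℤ[X]) k • ofUnit σ u = ofUnit σ (∏ j ∈ range (p ^ k), act (σ ^ j) u) := by
  simp only [normSum, sum_smul, X_pow_smul_ofUnit, ofUnit_prod]

theorem mem_fixedBy_ofUnit {p k : ℕ} {u : Kˣ} :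
    ofUnit σ u ∈ fixedBy (UnitModule σ) p (X : ℤ[X]) k ↔ act (σ ^ p ^ k) u = u := by
  rw [mem_fixedBy, sub_smul, one_smul, X_pow_smul_ofUnit, sub_eq_zero, (ofUnit_injective σ).eq_iff]

theorem mem_stage {p k : ℕ} {u : Kˣ} : (u : K) ∈ stage p σ k ↔ act (σ ^ p ^ k) u = u := by
  rw [stage, IntermediateField.mem_fixedField_iff, Units.ext_iff]
  constructor
  · intro h; exact h _ (Subgroup.mem_zpowers _)
  · intro h f hf
    have : Subgroup.zpowers (σ ^ p ^ k) ≤ MulAction.stabilizer (K ≃ₐ[F] K) (u : K) := by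
      rw [Subgroup.zpowers_le]; exact h
    exact this hf

theorem mem_stageUnits {p : ℕ} {b : WithBot ℕ} {u : Kˣ} :
    u ∈ stageUnits p σ b ↔ ofUnit σ u ∈ fixedBot (UnitModule σ) p (X : ℤ[X]) b := by
  induction b with
  | bot => exact Iff.rfl
  | coe k =>
    change (u : K) ∈ stage p σ k ↔ ofUnit σ u ∈ fixedBy (UnitModule σ) p (X : ℤ[X]) k
    rw [mem_stage, mem_fixedBy_ofUnit]

variable (p m : ℕ)

/-- The projection of `Kˣ` onto `J_m`. -/
def toJ : UnitModule σ →+ J K p m := ModN.mkQ (p ^ m)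

theorem toJ_ofUnit (u : Kˣ) : toJ σ p m (ofUnit σ u) = cls p m u := rfl

theorem toJ_surjective : Function.Surjective (toJ σ p m) := cls_surjective p m

theorem toJ_eq_zero {x : UnitModule σ} :
    toJ σ p m x = 0 ↔ ∃ w, x = ((p : ℤ[X]) ^ m) • w := by
  refine (Submodule.Quotient.mk_eq_zero _).trans ?_
  rw [LinearMap.mem_range]
  refine exists_congr fun w => ?_
  rw [← Nat.cast_pow, Nat.cast_smul_eq_nsmul, eq_comm, LinearMap.lsmul_apply, natCast_zsmul]

/-- The surjection of `ℤ[X]` onto `R_m G` that maps `X` to `σ`. -/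
def toGroupRing : ℤ[X] →+* MonoidAlgebra (ZMod (p ^ m)) (K ≃ₐ[F] K) :=
  (aeval (MonoidAlgebra.of (ZMod (p ^ m)) (K ≃ₐ[F] K) σ)).toRingHom

theorem toGroupRing_X : toGroupRing σ p m X = MonoidAlgebra.of _ _ σ := aeval_X _

theorem toJ_smul (f : ℤ[X]) (x : UnitModule σ) :
    toJ σ p m (f • x) = toGroupRing σ p m f • toJ σ p m x := by
  induction f using Polynomial.induction_on' with
  | add f g hf hg => rw [add_smul, map_add, hf, hg, map_add, add_smul]
  | monomial k c =>
    obtain ⟨u, rfl⟩ := ofUnit_surjective σ x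
    rw [← C_mul_X_pow_eq_monomial, eq_intCast, mul_smul, Int.cast_smul_eq_zsmul, map_zsmul,
      X_pow_smul_ofUnit, map_mul, map_intCast, map_pow, toGroupRing_X, ← map_pow, mul_smul,
      toJ_ofUnit, toJ_ofUnit, of_smul_cls, Int.cast_smul_eq_zsmul]

variable {p m}

theorem toGroupRing_surjective [FiniteDimensional F K] (hσ : ∀ g, g ∈ Subgroup.zpowers σ) :
    Function.Surjective (toGroupRing σ p m) := by
  intro y
  change y ∈ (toGroupRing σ p m).range
  induction y using MonoidAlgebra.induction_on with
  | of g =>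
    obtain ⟨k, rfl⟩ := (Submonoid.mem_powers_iff _ _).1
      (mem_powers_iff_mem_zpowers.2 (hσ g))
    exact ⟨X ^ k, by rw [map_pow, toGroupRing_X, map_pow]⟩
  | add f g hf hg => exact add_mem hf hg
  | smul r f hf =>
    obtain ⟨c, rfl⟩ := ZMod.intCast_surjective r
    rw [Int.cast_smul_eq_zsmul]
    exact zsmul_mem hf c

theorem toJ_mem_span {S : Set (UnitModule σ)} {x : UnitModule σ} (hx : x ∈ Submodule.span ℤ[X] S) :
    toJ σ p m x ∈ Submodule.span (MonoidAlgebra (ZMod (p ^ m)) (K ≃ₐ[F] K)) (toJ σ p m '' S) := by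
  induction hx using Submodule.span_induction with
  | mem x hx => exact Submodule.subset_span ⟨x, hx, rfl⟩
  | zero => rw [map_zero]; exact zero_mem _
  | add x y _ _ hx hy => rw [map_add]; exact add_mem hx hy
  | smul f x _ hx => rw [toJ_smul]; exact Submodule.smul_mem _ _ hx

theorem exists_of_mem_span_toJ [FiniteDimensional F K] (hσ : ∀ g, g ∈ Subgroup.zpowers σ)
    {S : Set (UnitModule σ)} {y : J K p m}
    (hy : y ∈ Submodule.span (MonoidAlgebra (ZMod (p ^ m)) (K ≃ₐ[F] K)) (toJ σ p m '' S)) :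
    ∃ x ∈ Submodule.span ℤ[X] S, y = toJ σ p m x := by
  induction hy using Submodule.span_induction with
  | mem y hy => obtain ⟨x, hx, rfl⟩ := hy; exact ⟨x, Submodule.subset_span hx, rfl⟩
  | zero => exact ⟨0, zero_mem _, (map_zero _).symm⟩
  | add y y' _ _ hy hy' =>
    obtain ⟨x, hx, rfl⟩ := hy
    obtain ⟨x', hx', rfl⟩ := hy'
    exact ⟨x + x', add_mem hx hx', (map_add _ _ _).symm⟩
  | smul r y _ hy =>
    obtain ⟨x, hx, rfl⟩ := hy
    obtain ⟨f, rfl⟩ := toGroupRing_surjective σ hσ r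
    exact ⟨f • x, Submodule.smul_mem _ _ hx, (toJ_smul σ p m f x).symm⟩

theorem mem_cyc_iff [FiniteDimensional F K] (hσ : ∀ g, g ∈ Subgroup.zpowers σ) {u : Kˣ}
    {y : J K p m} : y ∈ cyc F p m u ↔ ∃ f : ℤ[X], y = toJ σ p m (f • ofUnit σ u) := by
  rw [cyc, Submodule.mem_span_singleton]
  constructor
  · rintro ⟨r, rfl⟩
    obtain ⟨f, rfl⟩ := toGroupRing_surjective σ hσ r
    exact ⟨f, (toJ_smul σ p m f _).symm⟩
  · rintro ⟨f, rfl⟩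
    exact ⟨_, (toJ_smul σ p m f _).symm⟩

theorem intModulo_X_sub_one : IntModulo (X - 1 : ℤ[X]) := by
  intro f
  refine ⟨f.eval 1, f /ₘ (X - C 1), ?_⟩
  have := modByMonic_add_div f (X - C (1 : ℤ))
  rw [modByMonic_X_sub_C_eq_C_eval] at this
  conv_lhs => rw [← this]
  simp

end

end UnitModule

end KummerModule

/-! ### Norms, Hilbert 90 and norm pairs for the intermediate fields -/

namespace KummerModule

open Finset Polynomial

section Fields

variable {F K : Type*} [Field F] [Field K] [Algebra F K]

theorem algebraMap_norm_eq_prod_range {L : Type*} [Field L] [Algebra F L] [FiniteDimensional F L]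
    [IsGalois F L] {s : L ≃ₐ[F] L} (hs : ∀ g, g ∈ Subgroup.zpowers s) (x : L) :
    algebraMap F L (Algebra.norm F x) = ∏ j ∈ range (Module.finrank F L), (s ^ j) x := by
  classical
  have hord : orderOf s = Module.finrank F L := by
    rw [orderOf_eq_card_of_forall_mem_zpowers hs, IsGalois.card_aut_eq_finrank]
  rw [Algebra.norm_eq_prod_automorphisms, ← hord]
  have himg : (univ : Finset (L ≃ₐ[F] L)) = (range (orderOf s)).image (s ^ ·) := by
    symm
    rw [eq_univ_iff_forall]
    intro g
    obtain ⟨k, rfl⟩ := (Submonoid.mem_powers_iff _ _).1 (mem_powers_iff_mem_zpowers.2 (hs g))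
    exact mem_image.2 ⟨k % orderOf s, mem_range.2 (Nat.mod_lt _ (orderOf_pos s)),
      pow_mod_orderOf s k⟩
  rw [himg, prod_image]
  intro i hi j hj hij
  exact pow_injOn_Iio_orderOf (by simpa using hi) (by simpa using hj) hij

variable [FiniteDimensional F K] [IsGalois F K] {p n : ℕ} {σ : K ≃ₐ[F] K}
  (hdeg : Module.finrank F K = p ^ n) (hσ : ∀ g, g ∈ Subgroup.zpowers σ)

include hdeg hσ

theorem orderOf_generator : orderOf σ = p ^ n := by
  rw [orderOf_eq_card_of_forall_mem_zpowers hσ, IsGalois.card_aut_eq_finrank, hdeg]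

theorem algebraMap_norm_eq (x : K) :
    algebraMap F K (Algebra.norm F x) = ∏ j ∈ range (p ^ n), (σ ^ j) x := by
  rw [algebraMap_norm_eq_prod_range hσ, hdeg]

/-- The stage is Galois over `F` because the group is abelian, and the restriction of `σ` generates
its group. -/
theorem algebraMap_norm_stage_eq (hp : p.Prime) {k : ℕ} (hk : k ≤ n) (x : stage p σ k) :
    algebraMap F K (Algebra.norm F x) = ∏ j ∈ range (p ^ k), (σ ^ j) (x : K) := by
  have hcomm : ∀ g g' : K ≃ₐ[F] K, g * g' = g' * g := by
    intro g g'
    obtain ⟨i, rfl⟩ := Subgroup.mem_zpowers_iff.1 (hσ g)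
    obtain ⟨j, rfl⟩ := Subgroup.mem_zpowers_iff.1 (hσ g')
    exact (Commute.refl σ).zpow_zpow i j
  have hnormal : (Subgroup.zpowers (σ ^ p ^ k)).Normal :=
    ⟨fun g hg g' => by rwa [hcomm g' g, mul_inv_cancel_right]⟩
  have hgal : IsGalois F (stage p σ k) := IsGalois.of_fixedField_normal_subgroup _
  have hpow : ∀ (j : ℕ) (y : stage p σ k),
      (((AlgEquiv.restrictNormalHom (stage p σ k) σ) ^ j) y : K) = (σ ^ j) (y : K) := by
    intro j y
    rw [← map_pow]
    exact AlgEquiv.restrictNormal_commutes (σ ^ j) (stage p σ k) y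
  have hgen : ∀ g : (stage p σ k) ≃ₐ[F] (stage p σ k),
      g ∈ Subgroup.zpowers (AlgEquiv.restrictNormalHom (stage p σ k) σ) := by
    intro g
    obtain ⟨g, rfl⟩ := AlgEquiv.restrictNormalHom_surjective (F := F) (K₁ := stage p σ k) K g
    obtain ⟨j, rfl⟩ := Subgroup.mem_zpowers_iff.1 (hσ g)
    rw [map_zpow]
    exact Subgroup.zpow_mem_zpowers _ _
  have hfin : Module.finrank F (stage p σ k) = p ^ k := by
    have h1 : Module.finrank (stage p σ k) K = p ^ (n - k) := by
      rw [stage, IntermediateField.finrank_fixedField_eq_card, Nat.card_zpowers,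
        orderOf_pow_of_dvd (pow_ne_zero _ hp.ne_zero), orderOf_generator hdeg hσ,
        Nat.pow_div hk hp.pos]
      rw [orderOf_generator hdeg hσ]
      exact pow_dvd_pow p hk
    have h2 := Module.finrank_mul_finrank F (stage p σ k) K
    rw [h1, hdeg] at h2
    have h3 : p ^ n = p ^ k * p ^ (n - k) := by rw [← pow_add]; congr 1; omega
    rw [h3] at h2
    exact Nat.eq_of_mul_eq_mul_right (pow_pos hp.pos _) h2
  rw [IsScalarTower.algebraMap_apply F (stage p σ k) K, algebraMap_norm_eq_prod_range hgen, hfin]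
  exact (map_prod (stage p σ k).val _ _).trans (prod_congr rfl fun j _ => hpow j x)

/-- The classical resolvent argument for the cyclic group of order `p` generated by the restriction
of `g = σ^(p^k)` to stage `k + 1`, carried out inside `K`. The powers `g^j`, `j < p`, restrict to
distinct characters there. -/
theorem hilbert90_stage (hp : p.Prime) {k : ℕ} (hk : k < n) {u : Kˣ}
    (hu : act (σ ^ p ^ (k + 1)) u = u) (hN : ∏ j ∈ range p, act ((σ ^ p ^ k) ^ j) u = 1) :
    ∃ v : Kˣ, act (σ ^ p ^ (k + 1)) v = v ∧ u = act (σ ^ p ^ k) v / v := by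
  set g := σ ^ p ^ k with hg
  have hgp : σ ^ p ^ (k + 1) = g ^ p := by rw [hg, ← pow_mul, pow_succ]
  rw [hgp] at hu ⊢
  have act_mul : ∀ (a b : K ≃ₐ[F] K) (x : Kˣ), act (a * b) x = act a (act b x) := fun _ _ _ => rfl
  let χ : ℕ → stage p σ (k + 1) →* K := fun j =>
    ((g ^ j : K ≃ₐ[F] K) : K →* K).comp (stage p σ (k + 1)).val
  have hχ : ∀ i < p, ∀ j < p, i < j → χ i ≠ χ j := by
    intro i _ j hj hij heq
    have hfix : g ^ (j - i) ∈ (stage p σ (k + 1)).fixingSubgroup := by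
      rw [IntermediateField.mem_fixingSubgroup_iff]
      intro x hx
      have h1 : (g ^ i) x = (g ^ j) x := DFunLike.congr_fun heq ⟨x, hx⟩
      have h2 : (g ^ j) x = (g ^ i) ((g ^ (j - i)) x) := by
        rw [← AlgEquiv.mul_apply, ← pow_add]; congr 2; omega
      rw [h2] at h1
      exact ((g ^ i).injective h1).symm
    rw [stage, IntermediateField.fixingSubgroup_fixedField] at hfix
    obtain ⟨z, hz⟩ := Subgroup.mem_zpowers_iff.1 hfix
    have hz' : σ ^ ((p : ℤ) ^ (k + 1) * z - p ^ k * (j - i : ℕ)) = 1 := by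
      rw [zpow_sub, mul_inv_eq_one, zpow_mul, zpow_mul]
      rw [hg] at hz
      exact_mod_cast hz
    rw [← orderOf_dvd_iff_zpow_eq_one, orderOf_generator hdeg hσ] at hz'
    have h1 : (p : ℤ) ^ (k + 1) ∣ p ^ k * (j - i : ℕ) := by
      have h2 : (p : ℤ) ^ (k + 1) ∣ (p : ℤ) ^ (k + 1) * z - p ^ k * (j - i : ℕ) :=
        (pow_dvd_pow (p : ℤ) (show k + 1 ≤ n by omega)).trans (by exact_mod_cast hz')
      exact (dvd_sub_right (dvd_mul_right _ _)).1 h2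
    rw [pow_succ] at h1
    have h2 : (p : ℤ) ∣ (j - i : ℕ) :=
      (mul_dvd_mul_iff_left (pow_ne_zero k (by exact_mod_cast hp.ne_zero))).1 h1
    have h3 : p ∣ j - i := by exact_mod_cast h2
    have := Nat.le_of_dvd (by omega) h3
    omega
  have hinj : Set.InjOn χ (range p) := by
    intro i hi j hj hij
    have hi := mem_range.1 (mem_coe.1 hi)
    have hj := mem_range.1 (mem_coe.1 hj)
    by_contra hne
    rcases lt_or_gt_of_ne hne with h | h
    · exact hχ i hi j hj h hij
    · exact hχ j hj i hi h hij.symm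
  -- The cocycle attached to `u`; the norm condition is `c p = 1`. By independence of characters
  -- some resolvent `b = ∑ c_j g^j(x)` is nonzero, and it satisfies `u g(b) = b`.
  let c : ℕ → Kˣ := fun j => ∏ l ∈ range j, act (g ^ l) u
  have hc : ∀ j, u * act g (c j) = c (j + 1) := by
    intro j
    simp only [c]
    rw [prod_range_succ', map_prod, mul_comm]
    congr 1
    exact prod_congr rfl fun l _ => by rw [← act_mul, pow_succ']
  obtain ⟨x, hx⟩ : ∃ x : stage p σ (k + 1), ∑ j ∈ range p, (c j : K) * χ j x ≠ 0 := by
    by_contra hall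
    push Not at hall
    have hli := (linearIndependent_monoidHom (stage p σ (k + 1)) K).comp
      (fun j : range p => χ j) (fun i j hij => Subtype.ext (hinj i.2 j.2 hij))
    have := linearIndependent_iff'.1 hli univ (fun j => (c j : K)) (by
      funext x
      rw [Finset.sum_apply]
      exact (sum_coe_sort (range p) fun j => (c j : K) * χ j x).trans (hall x)) ⟨0, mem_range.2 hp.pos⟩ (mem_univ _)
    exact (c 0).ne_zero this
  set b := ∑ j ∈ range p, (c j : K) * χ j x with hb
  have hgx : (g ^ p) (x : K) = x := by
    rw [← hgp]
    exact (IntermediateField.mem_fixedField_iff _ _).1 x.2 _ (Subgroup.mem_zpowers _)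
  have hcp : ∀ j, act (g ^ p) (c j) = c j := by
    intro j
    simp only [c]
    rw [map_prod]
    refine prod_congr rfl fun l _ => ?_
    rw [← act_mul, (Commute.refl g).pow_pow p l |>.eq, act_mul, hu]
  have hbp : (g ^ p) b = b := by
    rw [hb, map_sum]
    refine sum_congr rfl fun j _ => ?_
    rw [map_mul]
    congr 1
    · exact congrArg Units.val (hcp j)
    · change (g ^ p) ((g ^ j) (x : K)) = (g ^ j) (x : K)
      rw [← AlgEquiv.mul_apply, (Commute.refl g).pow_pow p j |>.eq, AlgEquiv.mul_apply, hgx]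
  have hub : (u : K) * g b = b := by
    have h1 : (u : K) * g b = ∑ j ∈ range p, (c (j + 1) : K) * χ (j + 1) x := by
      rw [hb, map_sum, mul_sum]
      refine sum_congr rfl fun j _ => ?_
      rw [map_mul, ← mul_assoc, ← hc j, pow_succ' g j |> fun h => show χ (j + 1) x = g (χ j x) by
        change (g ^ (j + 1)) (x : K) = g ((g ^ j) (x : K))
        rw [h]; rfl]
      rfl
    have h2 : ∑ j ∈ range p, (c (j + 1) : K) * χ (j + 1) x + (c 0 : K) * χ 0 x =
        b + (c p : K) * χ p x := by
      rw [← sum_range_succ' (fun j => (c j : K) * χ j x), sum_range_succ]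
    have h3 : (c 0 : K) * χ 0 x = (c p : K) * χ p x := by
      have h4 : c p = 1 := hN
      have h5 : c 0 = 1 := prod_range_zero _
      have h6 : χ p x = x := hgx
      rw [h4, h5, h6]; rfl
    rw [h1]
    rw [h3] at h2
    exact add_right_cancel h2
  have hu' : u * act g (Units.mk0 b hx) = Units.mk0 b hx := Units.ext hub
  refine ⟨(Units.mk0 b hx)⁻¹, ?_, ?_⟩
  · rw [map_inv]
    congr 1
    exact Units.ext hbp
  · rw [map_inv, eq_div_iff_mul_eq', eq_inv_iff_mul_eq_one, mul_comm, ← mul_assoc]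
    rw [mul_comm _ u, hu', mul_inv_cancel]

variable {ξ : F} (hξ : IsPrimitiveRoot ξ p)

omit [FiniteDimensional F K] [IsGalois F K] hdeg hσ in
variable (K) in
include hξ in
theorem ne_zero_of_primitiveRoot (hp : p.Prime) : algebraMap F K ξ ≠ 0 :=
  (_root_.map_ne_zero _).2 (hξ.ne_zero hp.ne_zero)

/-- The root of unity `ξ` as an element of `UnitModule σ`. -/
noncomputable def rootOf (σ : K ≃ₐ[F] K) (x : F) (hx : algebraMap F K x ≠ 0) : UnitModule σ :=
  ofUnit σ (Units.mk0 _ hx)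

theorem isKummer (hp : p.Prime) (hn : 1 ≤ n) (hx : algebraMap F K ξ ≠ 0)
    (hξ : IsPrimitiveRoot ξ p) :
    IsKummer p n (X : ℤ[X]) (rootOf σ ξ hx) := by
  have hξK : IsPrimitiveRoot (algebraMap F K ξ) p := hξ.map_of_injective (algebraMap F K).injective
  refine ⟨hp, hn, ?_, ?_, ?_, ?_, ?_, ?_⟩
  · intro x
    obtain ⟨u, rfl⟩ := ofUnit_surjective σ x
    rw [← mem_fixedBy, mem_fixedBy_ofUnit, ← orderOf_generator hdeg hσ, pow_orderOf_eq_one]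
    rfl
  · intro k hk x hx hN
    obtain ⟨u, rfl⟩ := ofUnit_surjective σ x
    rw [mem_fixedBy_ofUnit] at hx
    have hN' : ∏ j ∈ range p, act ((σ ^ p ^ k) ^ j) u = 1 := by
      refine ofUnit_injective σ ?_
      rw [ofUnit_one, ← hN, stepSum, sum_smul, ofUnit_prod]
      refine sum_congr rfl fun j _ => ?_
      rw [← pow_mul, ← pow_mul, X_pow_smul_ofUnit]
    obtain ⟨v, hv1, hv2⟩ := hilbert90_stage hdeg hσ hp hk hx hN'
    refine ⟨ofUnit σ v, (mem_fixedBy_ofUnit σ).2 hv1, ?_⟩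
    rw [hv2, ofUnit_div, sub_smul, one_smul, X_pow_smul_ofUnit]
  · intro x hx
    obtain ⟨u, rfl⟩ := ofUnit_surjective σ x
    rw [← ofUnit_pow, ← ofUnit_one, (ofUnit_injective σ).eq_iff] at hx
    have : NeZero p := ⟨hp.ne_zero⟩
    obtain ⟨i, -, hi⟩ := hξK.eq_pow_of_pow_eq_one (show (u : K) ^ p = 1 by
      rw [← Units.val_pow_eq_pow_val, hx, Units.val_one])
    refine ⟨i, ?_⟩
    rw [Int.cast_natCast, rootOf, ← ofUnit_pow]
    congr 1
    exact Units.ext (by simpa using hi.symm)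
  · rw [sub_smul, one_smul, rootOf, X_smul_ofUnit, sub_eq_zero]
    congr 1
    exact Units.ext (by simp [act])
  · rw [rootOf, ← ofUnit_pow, ← ofUnit_one σ]
    congr 1
    exact Units.ext (by simpa using hξK.pow_eq_one)
  · intro h0
    rw [rootOf, ← ofUnit_one σ, (ofUnit_injective σ).eq_iff] at h0
    have : algebraMap F K ξ = 1 := congrArg Units.val h0
    rw [this] at hξK
    exact hp.one_lt.ne' (hξK.unique IsPrimitiveRoot.one)

theorem rep_iff (hp : p.Prime) (hn : 1 ≤ n) {m : ℕ} [NeZero m] (hx : algebraMap F K ξ ≠ 0)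
    (a : ℕ → WithBot ℕ) (e : ℤ) (α : Kˣ) (δ : ℕ → Kˣ) :
    Rep p n m (X : ℤ[X]) (rootOf σ ξ hx) a e (ofUnit σ α) (fun i => ofUnit σ (δ i)) ↔
      Represents p n m σ ξ (fun i => a i) (1 + p * e) α (fun i => δ i) := by
  have hpZ : (p : ℤ) ≠ 0 := by exact_mod_cast hp.ne_zero
  have hediv : (1 + (p : ℤ) * e - 1) / p = e := by
    rw [add_sub_cancel_left, Int.mul_ediv_cancel_left _ hpZ]
  have hact : (X - 1 : ℤ[X]) • ofUnit σ α - (p * e : ℤ[X]) • ofUnit σ α =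
      weightSum (A := ℤ[X]) p m (fun i => ofUnit σ (δ i)) ↔
      act σ α / α ^ (1 + p * e) = ∏ i : Fin (m + 1), δ i ^ p ^ (i : ℕ) := by
    rw [← (ofUnit_injective σ).eq_iff, ofUnit_prod, ofUnit_div, ofUnit_zpow, ← X_smul_ofUnit]
    simp only [ofUnit_pow, Nat.cast_pow]
    rw [Fin.sum_univ_eq_sum_range (fun i => (p : ℤ[X]) ^ i • ofUnit σ (δ i)) (m + 1), weightSum]
    have : (X - 1 : ℤ[X]) • ofUnit σ α - (p * e : ℤ[X]) • ofUnit σ α =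
        (X : ℤ[X]) • ofUnit σ α - ((1 + p * e : ℤ) : ℤ[X]) • ofUnit σ α := by
      push_cast; module
    rw [this]
  have hnorm : ∀ η : stage p σ (n - 1), (η : K) = δ 0 →
      (rootOf σ ξ hx = (e : ℤ[X]) • normSum p (X : ℤ[X]) n • ofUnit σ α +
        normPart p n m (X : ℤ[X]) (fun i => ofUnit σ (δ i)) ↔
      ξ = Algebra.norm F (α : K) ^ ((1 + (p : ℤ) * e - 1) / (p : ℤ)) * Algebra.norm F η *
        ∏ i : Fin m, Algebra.norm F (δ i.succ : K) ^ p ^ (i : ℕ)) := by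
    intro η hη
    have hun : ∀ u : Kˣ, algebraMap F K (Algebra.norm F (u : K)) =
        ((∏ j ∈ range (p ^ n), act (σ ^ j) u : Kˣ) : K) := by
      intro u
      rw [algebraMap_norm_eq hdeg hσ, Units.coe_prod]
      rfl
    have hη' : algebraMap F K (Algebra.norm F η) =
        ((∏ j ∈ range (p ^ (n - 1)), act (σ ^ j) (δ 0) : Kˣ) : K) := by
      rw [algebraMap_norm_stage_eq hdeg hσ hp (by omega), Units.coe_prod, hη]
      rfl
    rw [hediv, ← (algebraMap F K).injective.eq_iff, map_mul, map_mul, map_prod, map_zpow₀, hun, hη']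
    simp only [map_pow, hun, Fin.val_succ]
    rw [show algebraMap F K ξ = ((Units.mk0 _ hx : Kˣ) : K) from rfl, normPart]
    simp only [normSum_smul_ofUnit, ← Nat.cast_pow, ← ofUnit_pow, ← ofUnit_zpow]
    rw [← ofUnit_prod, ← ofUnit_mul, ← ofUnit_mul, rootOf, (ofUnit_injective σ).eq_iff,
      Units.ext_iff, ← mul_assoc,
      Fin.prod_univ_eq_prod_range
        (fun i => ((∏ j ∈ range (p ^ n), act (σ ^ j) (δ (i + 1)) : Kˣ) : K) ^ p ^ i) m]
    simp only [Units.val_mul, Units.coe_prod, Units.val_pow_eq_pow_val, Units.val_zpow_eq_zpow_val]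
  have hm : 0 < m := Nat.pos_of_ne_zero (NeZero.ne m)
  constructor
  · intro h
    have hδ0 : ((δ 0 : Kˣ) : K) ∈ stage p σ (n - 1) := by
      have h0 := h.a_zero_lt
      have hδ := h.δ_mem 0 hm
      revert h0 hδ
      induction a 0 with
      | bot =>
        intro _ hδ
        have : δ 0 = 1 := ofUnit_injective σ ((Submodule.mem_bot ℤ[X]).1 hδ)
        rw [this]; exact one_mem _
      | coe b =>
        intro h0 hδ
        have : b < n := WithBot.coe_lt_coe.1 h0
        exact (mem_stage σ).2 ((mem_fixedBy_ofUnit σ).1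
          (fixedBy_mono p (X : ℤ[X]) (show b ≤ n - 1 by omega) hδ))
    refine ⟨fun i => h.a_le i i.2, h.a_zero_lt, ?_, fun i => ?_, hact.1 h.eq_act, ⟨⟨δ 0, hδ0⟩, rfl,
      (hnorm ⟨δ 0, hδ0⟩ rfl).1 h.eq_norm⟩⟩
    · exact ⟨e, by ring⟩
    · exact (mem_stageUnits σ).2 (h.δ_mem i i.2)
  · intro h
    obtain ⟨η, hη, hη'⟩ := h.eq_norm
    exact ⟨fun i hi => h.a_le ⟨i, hi⟩, h.a_zero_lt, fun i hi => (mem_stageUnits σ).1 (h.δ_mem ⟨i, hi⟩),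
      hact.2 h.eq_act, (hnorm η hη).2 hη'⟩

end Fields

end KummerModule

/-! ### Freeness over `𝔽_p G_k` detected by the norm -/

namespace KummerModule

open Finset Polynomial

section Free

variable {F K : Type*} [Field F] [Field K] [Algebra F K] [FiniteDimensional F K] [IsGalois F K]
  {p n : ℕ} {σ : K ≃ₐ[F] K}
  (hdeg : Module.finrank F K = p ^ n) (hσ : ∀ g, g ∈ Subgroup.zpowers σ)

noncomputable section

/-- The permutation module `𝔽_p[G / ⟨σ ^ (p ^ k)⟩]`. -/
abbrev CosetModule (p : ℕ) (σ : K ≃ₐ[F] K) (k : ℕ) : Type _ :=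
  (Representation.ofMulAction (ZMod (p ^ 1)) (K ≃ₐ[F] K)
    ((K ≃ₐ[F] K) ⧸ Subgroup.zpowers (σ ^ p ^ k))).asModule

/-- The coset of `g` as an element of the permutation module. -/
def cosetElt (p : ℕ) (σ : K ≃ₐ[F] K) (k : ℕ) (g : K ≃ₐ[F] K) : CosetModule p σ k :=
  (Representation.asModuleEquiv _).symm (MonoidAlgebra.single (QuotientGroup.mk g) 1)

omit [FiniteDimensional F K] [IsGalois F K] in
theorem of_smul_cosetElt (k : ℕ) (g g' : K ≃ₐ[F] K) :
    MonoidAlgebra.of (ZMod (p ^ 1)) (K ≃ₐ[F] K) g • cosetElt p σ k g' =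
      cosetElt p σ k (g * g') := by
  rw [cosetElt, ← Representation.asModuleEquiv_symm_map_rho, Representation.ofMulAction_single]
  rfl

omit [FiniteDimensional F K] [IsGalois F K] in
theorem X_pow_smul_cosetElt (k j : ℕ) :
    toGroupRing σ p 1 (X ^ j) • cosetElt p σ k 1 = cosetElt p σ k (σ ^ j) := by
  rw [map_pow, toGroupRing_X, ← map_pow, of_smul_cosetElt, mul_one]

omit [FiniteDimensional F K] [IsGalois F K] in
theorem toGroupRing_natCast_prime : toGroupRing σ p 1 (p : ℤ[X]) = 0 := by
  have h : ((p : ℕ) : ZMod (p ^ 1)) = 0 := by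
    rw [ZMod.natCast_eq_zero_iff, pow_one]
  rw [map_natCast, ← map_natCast (algebraMap (ZMod (p ^ 1)) _), h, map_zero]

omit [FiniteDimensional F K] [IsGalois F K] in
theorem span_cosetElt (k : ℕ) (x : CosetModule p σ k) :
    ∃ r : MonoidAlgebra (ZMod (p ^ 1)) (K ≃ₐ[F] K), x = r • cosetElt p σ k 1 := by
  obtain ⟨y, rfl⟩ := (Representation.asModuleEquiv _).symm.surjective x
  induction y using MonoidAlgebra.induction_linear with
  | zero => exact ⟨0, by rw [map_zero, zero_smul]⟩
  | add y z hy hz =>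
    obtain ⟨r, hr⟩ := hy
    obtain ⟨s, hs⟩ := hz
    exact ⟨r + s, by rw [map_add, hr, hs, add_smul]⟩
  | single h c =>
    obtain ⟨g, rfl⟩ := QuotientGroup.mk_surjective h
    refine ⟨algebraMap _ _ c * MonoidAlgebra.of _ _ g, ?_⟩
    rw [mul_smul, of_smul_cosetElt, mul_one, cosetElt, ← Representation.asModuleEquiv_symm_map_smul,
      MonoidAlgebra.smul_single, smul_eq_mul, mul_one]

include hdeg hσ

/-- The coefficient at the trivial coset is `1`: no `σ^j` with `0 < j < p^k` lies in `⟨σ^(p^k)⟩`. -/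
theorem normSum_smul_cosetElt_ne_zero (hp : p.Prime) {k : ℕ} (hk : k ≤ n) :
    toGroupRing σ p 1 (normSum p X k) • cosetElt p σ k 1 ≠ 0 := by
  intro h
  have hfact : Fact (1 < p ^ 1) := ⟨by rw [pow_one]; exact hp.one_lt⟩
  rw [normSum, map_sum, sum_smul] at h
  simp only [X_pow_smul_cosetElt] at h
  simp only [cosetElt] at h
  rw [← map_sum, LinearEquiv.map_eq_zero_iff] at h
  have h1 := congrArg (fun y => MonoidAlgebra.coeff y
    (QuotientGroup.mk (1 : K ≃ₐ[F] K) : (K ≃ₐ[F] K) ⧸ Subgroup.zpowers (σ ^ p ^ k))) h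
  rw [MonoidAlgebra.coeff_sum, Finsupp.finsetSum_apply,
    sum_eq_single_of_mem 0 (mem_range.2 (pow_pos hp.pos k))] at h1
  · simp at h1
  · intro j hj hj0
    rw [MonoidAlgebra.coeff_single, Finsupp.single_apply, if_neg]
    intro heq
    rw [eq_comm, QuotientGroup.eq, inv_one, one_mul] at heq
    obtain ⟨z, hz⟩ := Subgroup.mem_zpowers_iff.1 heq
    have hz' : σ ^ ((p : ℤ) ^ k * z - j) = 1 := by
      rw [zpow_sub, mul_inv_eq_one, zpow_mul]
      exact_mod_cast hz
    rw [← orderOf_dvd_iff_zpow_eq_one, orderOf_generator hdeg hσ] at hz'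
    have h2 : (p : ℤ) ^ k ∣ (p : ℤ) ^ k * z - j :=
      (pow_dvd_pow (p : ℤ) hk).trans (by exact_mod_cast hz')
    have h3 : (p : ℤ) ^ k ∣ j := (dvd_sub_right (dvd_mul_right _ _)).1 h2
    have h4 : p ^ k ∣ j := by exact_mod_cast h3
    have := Nat.le_of_dvd (Nat.pos_of_ne_zero hj0) h4
    have := mem_range.1 hj
    omega

omit hdeg [FiniteDimensional F K] [IsGalois F K] hσ in
/-- The annihilator in `ℤ[X]` of an element of an `𝔽_p G`-module. -/
def annPoly {V : Type*} [AddCommGroup V] [Module (MonoidAlgebra (ZMod (p ^ 1)) (K ≃ₐ[F] K)) V]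
    (σ : K ≃ₐ[F] K) (v : V) : Ideal ℤ[X] where
  carrier := {f | toGroupRing σ p 1 f • v = 0}
  add_mem' {f g} hf hg := by
    simp only [Set.mem_ofPred_eq] at hf hg ⊢
    rw [map_add, add_smul, hf, hg, add_zero]
  zero_mem' := by simp
  smul_mem' g f hf := by
    simp only [Set.mem_ofPred_eq, smul_eq_mul] at hf ⊢
    rw [map_mul, mul_smul, hf, smul_zero]

omit hdeg [FiniteDimensional F K] [IsGalois F K] hσ in
-- The answer does not depend on `v`. This identifies the annihilator of a class `[t]_1` with that
-- of the generator of the permutation module.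
theorem mem_annPoly_iff (hp : p.Prime) {V : Type*} [AddCommGroup V]
    [Module (MonoidAlgebra (ZMod (p ^ 1)) (K ≃ₐ[F] K)) V] {v : V} {k : ℕ}
    (h1 : toGroupRing σ p 1 (X ^ p ^ k - 1) • v = 0)
    (h2 : toGroupRing σ p 1 (normSum p X k) • v ≠ 0) (f : ℤ[X]) :
    toGroupRing σ p 1 f • v = 0 ↔ ∃ f' q : ℤ[X], f = (p : ℤ[X]) * f' + (X - 1) ^ (p ^ k - 1 + 1) * q := by
  have hpow : p ^ k - 1 + 1 = p ^ k := Nat.sub_add_cancel (Nat.one_le_pow _ _ hp.pos)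
  have hpI : (p : ℤ[X]) ∈ annPoly (p := p) σ v := by
    change toGroupRing σ p 1 (p : ℤ[X]) • v = 0
    rw [toGroupRing_natCast_prime, zero_smul]
  have h1I : (X - 1 : ℤ[X]) ^ (p ^ k - 1 + 1) ∈ annPoly (p := p) σ v := by
    obtain ⟨g, hg⟩ := exists_sub_one_pow_eq p (X : ℤ[X]) hp k
    rw [hpow, hg]
    exact add_mem h1 (Ideal.mul_mem_right _ _ hpI)
  have h2I : (X - 1 : ℤ[X]) ^ (p ^ k - 1) ∉ annPoly (p := p) σ v := by
    intro hmem
    obtain ⟨g, hg⟩ := exists_normSum_eq_sub_one_pow p (X : ℤ[X]) hp k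
    refine h2 ?_
    rw [hg]
    exact add_mem hmem (Ideal.mul_mem_right g _ hpI)
  constructor
  · exact exists_eq_of_mem_ideal hp intModulo_X_sub_one _ (annPoly (p := p) σ v) hpI h1I h2I f
  · rintro ⟨f', q, rfl⟩
    exact add_mem (Ideal.mul_mem_right f' _ hpI) (Ideal.mul_mem_right q _ h1I)

omit hdeg [FiniteDimensional F K] [IsGalois F K] hσ in
theorem X_pow_sub_one_smul_cosetElt (k : ℕ) :
    toGroupRing σ p 1 (X ^ p ^ k - 1) • cosetElt p σ k 1 = 0 := by
  rw [map_sub, sub_smul, X_pow_smul_cosetElt, map_one, one_smul, sub_eq_zero, cosetElt, cosetElt]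
  congr 2
  rw [eq_comm, QuotientGroup.eq, inv_one, one_mul]
  exact Subgroup.mem_zpowers _

theorem isFreeOverG_of_normSum (hp : p.Prime) {k : ℕ} (hk : k ≤ n) {t : Kˣ}
    (ht : ofUnit σ t ∈ fixedBy (UnitModule σ) p (X : ℤ[X]) k)
    (hne : toJ σ p 1 (normSum p (X : ℤ[X]) k • ofUnit σ t) ≠ 0) : IsFreeOverG p σ k t := by
  rw [toJ_smul] at hne
  have h1 : toGroupRing σ p 1 (X ^ p ^ k - 1) • toJ σ p 1 (ofUnit σ t) = 0 := by
    rw [← toJ_smul, (mem_fixedBy p (X : ℤ[X])).1 ht, map_zero]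
  have hker : LinearMap.ker (LinearMap.toSpanSingleton
        (MonoidAlgebra (ZMod (p ^ 1)) (K ≃ₐ[F] K)) _ (cls p 1 t)) =
      LinearMap.ker (LinearMap.toSpanSingleton
        (MonoidAlgebra (ZMod (p ^ 1)) (K ≃ₐ[F] K)) _ (cosetElt p σ k 1)) := by
    ext r
    obtain ⟨f, rfl⟩ := toGroupRing_surjective σ hσ r
    rw [LinearMap.mem_ker, LinearMap.mem_ker, LinearMap.toSpanSingleton_apply,
      LinearMap.toSpanSingleton_apply, mem_annPoly_iff hp (X_pow_sub_one_smul_cosetElt k)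
        (normSum_smul_cosetElt_ne_zero hdeg hσ hp hk)]
    exact mem_annPoly_iff hp h1 hne f
  have hrange : LinearMap.range (LinearMap.toSpanSingleton
      (MonoidAlgebra (ZMod (p ^ 1)) (K ≃ₐ[F] K)) _ (cls p 1 t)) = cyc F p 1 t :=
    LinearMap.range_toSpanSingleton _
  have hsurj : Function.Surjective (LinearMap.toSpanSingleton
      (MonoidAlgebra (ZMod (p ^ 1)) (K ≃ₐ[F] K)) _ (cosetElt p σ k 1)) := by
    intro x
    obtain ⟨r, hr⟩ := span_cosetElt k x
    exact ⟨r, hr.symm⟩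
  exact ⟨(LinearEquiv.ofEq _ _ hrange.symm).trans
    ((LinearMap.quotKerEquivRange _).symm.trans ((Submodule.quotEquivOfEq _ _ hker).trans
      (LinearMap.quotKerEquivOfSurjective _ hsurj)))⟩

/-- If `N_k` killed the generator, it would kill the whole cyclic module, and hence the generator of
the permutation module. -/
theorem normSum_ne_zero_of_isFreeOverG (hp : p.Prime) {k : ℕ} (hk : k ≤ n) {t : Kˣ}
    (hfree : IsFreeOverG p σ k t) : toJ σ p 1 (normSum p (X : ℤ[X]) k • ofUnit σ t) ≠ 0 := by
  intro h0
  obtain ⟨e⟩ := hfree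
  obtain ⟨⟨y, hy⟩, hye⟩ := e.surjective (cosetElt p σ k 1)
  refine normSum_smul_cosetElt_ne_zero hdeg hσ hp hk ?_
  obtain ⟨f, rfl⟩ := (mem_cyc_iff σ hσ).1 hy
  rw [← hye, ← map_smul]
  refine (congrArg e ?_).trans (map_zero e)
  refine Subtype.ext ?_
  change toGroupRing σ p 1 (normSum p X k) • toJ σ p 1 (f • ofUnit σ t) = 0
  rw [← toJ_smul, smul_comm, toJ_smul, h0, smul_zero]

end

end Free

end KummerModule

/-! ### Independence and spanning of cyclic submodules of power classes -/

namespace KummerModule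

open Finset Polynomial

section Independence

variable {A M J : Type*} [CommRing A] [AddCommGroup M] [Module A M] [AddCommGroup J]

/-- The cyclic submodules generated by the `x i` have independent images under `π`. -/
def CyclicIndep (A : Type*) {M J ι : Type*} [CommRing A] [AddCommGroup M] [Module A M]
    [AddCommGroup J] (π : M →+ J) (x : ι → M) : Prop :=
  ∀ (s : Finset ι) (f : ι → A), π (∑ i ∈ s, f i • x i) = 0 → ∀ i ∈ s, π (f i • x i) = 0

theorem CyclicIndep.comp_equiv {π : M →+ J} {ι κ : Type*} {x : ι → M} (hx : CyclicIndep A π x)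
    (e : κ ≃ ι) : CyclicIndep A π (x ∘ e) := by
  intro s f hf i hi
  have := hx (s.map e.toEmbedding) (f ∘ e.symm) (by simpa using hf) (e i) (by simpa using hi)
  simpa using this

end Independence

section Classes

variable {F K : Type*} [Field F] [Field K] [Algebra F K] [FiniteDimensional F K]
  {p m n : ℕ} {σ : K ≃ₐ[F] K} (hσ : ∀ g, g ∈ Subgroup.zpowers σ)

include hσ

theorem iSupIndep_cyc_iff {ι : Type*} {u : ι → Kˣ} :
    iSupIndep (fun i => cyc F p m (u i)) ↔
      CyclicIndep ℤ[X] (toJ σ p m) (fun i => ofUnit σ (u i)) := by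
  rw [iSupIndep_iff_finsetSum_eq_zero_imp_eq_zero]
  constructor
  · intro h s f hf
    exact h s (fun i => toJ σ p m (f i • ofUnit σ (u i)))
      (fun i _ => (mem_cyc_iff σ hσ).2 ⟨f i, rfl⟩) (by rw [← hf, map_sum])
  · intro h s v hv hv0
    have hv' : ∀ i, ∃ f : ℤ[X], i ∈ s → v i = toJ σ p m (f • ofUnit σ (u i)) := by
      intro i
      by_cases hi : i ∈ s
      · obtain ⟨f, hf⟩ := (mem_cyc_iff σ hσ).1 (hv i hi)
        exact ⟨f, fun _ => hf⟩
      · exact ⟨0, fun h => absurd h hi⟩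
    choose f hf using hv'
    intro i hi
    rw [hf i hi]
    refine h s f ?_ i hi
    rw [map_sum, ← hv0]
    exact sum_congr rfl fun i hi => (hf i hi).symm

omit [FiniteDimensional F K] hσ in
theorem iSup_cyc_eq_span {ι : Type*} (u : ι → Kˣ) : ⨆ i, cyc F p m (u i) =
    Submodule.span (MonoidAlgebra (ZMod (p ^ m)) (K ≃ₐ[F] K))
      (toJ σ p m '' Set.range fun i => ofUnit σ (u i)) := by
  rw [← Set.range_comp, Submodule.span_range_eq_iSup]
  rfl

theorem iSup_cyc_eq_top_iff {ι : Type*} {u : ι → Kˣ} :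
    ⨆ i, cyc F p m (u i) = ⊤ ↔ ∀ Z : Submodule ℤ[X] (UnitModule σ),
      (∀ x, ((p : ℤ[X]) ^ m) • x ∈ Z) → (∀ i, ofUnit σ (u i) ∈ Z) → Z = ⊤ := by
  constructor
  · intro h Z hp hu
    rw [eq_top_iff]
    intro x _
    have hx : toJ σ p m x ∈ ⨆ i, cyc F p m (u i) := by rw [h]; trivial
    rw [iSup_cyc_eq_span (σ := σ)] at hx
    obtain ⟨y, hy, hxy⟩ := exists_of_mem_span_toJ σ hσ hx
    obtain ⟨w, hw⟩ := (toJ_eq_zero σ p m).1 (by rw [map_sub, hxy, sub_self] :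
      toJ σ p m (x - y) = 0)
    have hyZ : y ∈ Z := (Submodule.span_le.2 (by rintro _ ⟨i, rfl⟩; exact hu i)) hy
    have := add_mem hyZ (hp w)
    rwa [← hw, add_sub_cancel] at this
  · intro h
    let Z : Submodule ℤ[X] (UnitModule σ) :=
      { carrier := {x | toJ σ p m x ∈ ⨆ i, cyc F p m (u i)}
        add_mem' := fun {x y} hx hy => by
          rw [Set.mem_ofPred_eq, map_add]; exact add_mem hx hy
        zero_mem' := by rw [Set.mem_ofPred_eq, map_zero]; exact zero_mem _
        smul_mem' := fun f x hx => by
          rw [Set.mem_ofPred_eq, toJ_smul]; exact Submodule.smul_mem _ _ hx }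
    have hZ : Z = ⊤ := by
      refine h Z (fun x => ?_) fun i => ?_
      · change toJ σ p m (((p : ℤ[X]) ^ m) • x) ∈ ⨆ i, cyc F p m (u i)
        rw [(toJ_eq_zero σ p m).2 ⟨x, rfl⟩]
        exact zero_mem _
      · exact le_iSup (fun i => cyc F p m (u i)) i (Submodule.subset_span rfl)
    rw [eq_top_iff]
    intro y _
    obtain ⟨x, rfl⟩ := toJ_surjective σ p m y
    have : x ∈ Z := by rw [hZ]; trivial
    exact this

omit [FiniteDimensional F K] hσ in
theorem mem_basisPart_iff [NeZero m] (α : Kˣ) (δ : ℕ → Kˣ) (u : Kˣ) :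
    u ∈ basisPart m α (fun i => δ i) ↔
      ofUnit σ u ∈ excSet m (ofUnit σ α) (fun i => ofUnit σ (δ i)) := by
  refine and_congr (or_congr Iff.rfl ⟨?_, ?_⟩) Iff.rfl
  · rintro ⟨i, h1, h2, rfl⟩
    exact ⟨i, h1, h2, rfl⟩
  · rintro ⟨j, h1, h2, h3⟩
    exact ⟨⟨j, by omega⟩, h1, h2, h3⟩

omit [FiniteDimensional F K] hσ in
theorem excModule_eq_span [NeZero m] (α : Kˣ) (δ : ℕ → Kˣ) :
    excModule F p m α (fun i => δ i) =
      Submodule.span (MonoidAlgebra (ZMod (p ^ m)) (K ≃ₐ[F] K))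
        (toJ σ p m '' excSet m (ofUnit σ α) (fun i => ofUnit σ (δ i))) := by
  refine le_antisymm (Submodule.span_le.2 ?_) (Submodule.span_mono ?_)
  · rintro _ ⟨u, hu, rfl⟩
    by_cases h1 : u = 1
    · rw [h1, ← toJ_ofUnit σ, ofUnit_one, map_zero]
      exact zero_mem _
    · exact Submodule.subset_span ⟨ofUnit σ u, (mem_basisPart_iff α δ u).1 ⟨hu, h1⟩, rfl⟩
  · rintro _ ⟨x, hx, rfl⟩
    obtain ⟨u, rfl⟩ := ofUnit_surjective σ x
    exact ⟨u, ((mem_basisPart_iff α δ u).2 hx).1, rfl⟩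

omit [FiniteDimensional F K] hσ in
/-- The index types of the two decompositions agree. -/
noncomputable def indexEquiv {S T : Set Kˣ} {S' T' : Set (UnitModule σ)} (hS : ∀ u, u ∈ S ↔ ofUnit σ u ∈ S')
    (hT : ∀ u, u ∈ T ↔ ofUnit σ u ∈ T') : S ⊕ T ≃ S' ⊕ T' :=
  Equiv.sumCongr
    ((Equiv.ofBijective (ofUnit σ) ⟨ofUnit_injective σ, ofUnit_surjective σ⟩).subtypeEquiv hS)
    ((Equiv.ofBijective (ofUnit σ) ⟨ofUnit_injective σ, ofUnit_surjective σ⟩).subtypeEquiv hT)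

omit [FiniteDimensional F K] hσ in
theorem ofUnit_comp_indexEquiv {S T : Set Kˣ} {S' T' : Set (UnitModule σ)}
    (hS : ∀ u, u ∈ S ↔ ofUnit σ u ∈ S') (hT : ∀ u, u ∈ T ↔ ofUnit σ u ∈ T') :
    (fun i : S ⊕ T => ofUnit σ (Sum.elim Subtype.val Subtype.val i)) =
      (Sum.elim Subtype.val Subtype.val : S' ⊕ T' → UnitModule σ) ∘ indexEquiv hS hT := by
  funext i
  cases i <;> rfl

end Classes

end KummerModule

/-! ### Assembly of the direct sum decomposition -/

namespace KummerModule

open Finset Polynomial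

section Main

variable {F K : Type*} [Field F] [Field K] [Algebra F K] [FiniteDimensional F K] [IsGalois F K]
  {p n m : ℕ} {σ : K ≃ₐ[F] K} (hdeg : Module.finrank F K = p ^ n)
  (hσ : ∀ g, g ∈ Subgroup.zpowers σ)

omit [FiniteDimensional F K] [IsGalois F K] in
theorem toJ_one_eq_zero {x : UnitModule σ} : toJ σ p 1 x = 0 ↔ ∃ w, x = (p : ℤ[X]) • w := by
  rw [toJ_eq_zero, pow_one]

include hdeg hσ

theorem exists_normSum_eq_rootOf {ξ : F} (hξ : IsPrimitiveRoot ξ p)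
    (hx : algebraMap F K ξ ≠ 0) (hnorm : p = 2 → n = 1 → ∃ γ : K, Algebra.norm F γ = -1)
    (hp2 : p = 2) (hn1 : n = 1) :
    ∃ z : UnitModule σ, normSum p (X : ℤ[X]) n • z = rootOf σ ξ hx := by
  obtain ⟨γ, hγ⟩ := hnorm hp2 hn1
  have hγ0 : γ ≠ 0 := by
    rintro rfl
    rw [Algebra.norm_zero] at hγ
    exact neg_ne_zero.2 one_ne_zero hγ.symm
  have hξ' : ξ = -1 := by
    rw [hp2] at hξ
    exact hξ.eq_neg_one_of_two_right
  refine ⟨ofUnit σ (Units.mk0 γ hγ0), ?_⟩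
  rw [normSum_smul_ofUnit, rootOf]
  congr 1
  refine Units.ext ?_
  rw [Units.val_mk0, hξ', ← hγ, algebraMap_norm_eq hdeg hσ, Units.coe_prod]
  rfl

omit hdeg hσ [FiniteDimensional F K] [IsGalois F K] in
theorem exists_vector_lift (m : ℕ) {α : Type*} [Inhabited α] (f : Fin m → α) :
    ∃ g : ℕ → α, f = fun i : Fin m => g i :=
  ⟨fun i => if h : i < m then f ⟨i, h⟩ else default, by funext i; simp⟩

theorem lexMin_of_isMinimalNormPair [NeZero m] (hp : p.Prime) (hn : 1 ≤ n) {ξ : F}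
    (hx : algebraMap F K ξ ≠ 0) {a : ℕ → WithBot ℕ} {d : ℤ}
    (hmin : IsMinimalNormPair p n m σ ξ (fun i : Fin m => a i) d) :
    LexMin p n m (X : ℤ[X]) (rootOf σ ξ hx) a := by
  intro a' e α δ hrep j hj hpre hlt
  obtain ⟨α, rfl⟩ := ofUnit_surjective σ α
  obtain ⟨δ, rfl⟩ : ∃ δ' : ℕ → Kˣ, δ = fun i => ofUnit σ (δ' i) := ⟨δ, rfl⟩
  have hlex : toLex (fun i : Fin m => a' i) < toLex (fun i : Fin m => a i) :=
    ⟨⟨j, hj⟩, fun i hi => hpre i hi, hlt⟩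
  rcases hmin.2 _ _ ⟨α, _, (rep_iff hdeg hσ hp hn hx a' e α δ).1 hrep⟩ with h | ⟨h, -⟩
  · exact lt_asymm h hlex
  · rw [← h] at hlex
    exact lt_irrefl _ hlex

omit hdeg hσ [FiniteDimensional F K] [IsGalois F K] in
-- An element from a stage below `k` has `N_k t` divisible by `p`. So a nonzero norm class forces
-- `k` to be the exact stage of `t`.
theorem eq_of_normSum_ne_zero {i k : ℕ} {t : Kˣ}
    (ht : ofUnit σ t ∈ fixedBy (UnitModule σ) p (X : ℤ[X]) k)
    (hne : toJ σ p 1 (normSum p (X : ℤ[X]) k • ofUnit σ t) ≠ 0)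
    (h1 : t ∈ stageUnits p σ (i : WithBot ℕ)) (h2 : t ∉ stageUnits p σ (prev i)) : i = k := by
  rw [mem_stageUnits] at h1 h2
  change _ ∈ fixedBy (UnitModule σ) p (X : ℤ[X]) i at h1
  rcases lt_trichotomy i k with h | h | h
  · exfalso
    obtain ⟨l, rfl⟩ : ∃ l, k = l + 1 := ⟨k - 1, by omega⟩
    refine hne (toJ_one_eq_zero.2 ⟨normSum p (X : ℤ[X]) l • ofUnit σ t, ?_⟩)
    have := stepSum_smul (fixedBy_mono p (X : ℤ[X]) (show i ≤ l by omega) h1)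
    rw [normSum_succ, mul_comm, mul_smul, this, smul_comm]
  · exact h
  · exfalso
    obtain ⟨l, rfl⟩ : ∃ l, i = l + 1 := ⟨i - 1, by omega⟩
    exact h2 (fixedBy_mono p (X : ℤ[X]) (show k ≤ l by omega) ht)

omit [FiniteDimensional F K] [IsGalois F K] hdeg hσ in
-- The annihilator of `t` modulo `p` is `(p, (X - 1)^(p^k))`, and both generators send `t` into `p
-- ℤ[X] t`. This is what lets relations among the complementary generators be divided by `p`.
theorem exists_smul_eq_of_normSum (hp : p.Prime) {k : ℕ} {t : UnitModule σ}
    (ht : t ∈ fixedBy (UnitModule σ) p (X : ℤ[X]) k)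
    (hne : toJ σ p 1 (normSum p (X : ℤ[X]) k • t) ≠ 0) {g : ℤ[X]}
    (hg : g • t ∈ multiples ℤ[X] (UnitModule σ) p) :
    ∃ g' : ℤ[X], g • t = (p : ℤ[X]) • g' • t := by
  obtain ⟨q, hq⟩ := pow_smul_eq_of_mem_fixedBy hp ht
  obtain ⟨c, hc⟩ := exists_normSum_eq_sub_one_pow p (X : ℤ[X]) hp k
  obtain ⟨f', q', rfl⟩ := exists_eq_of_mem_ideal hp intModulo_X_sub_one (p ^ k - 1)
    (transporter (multiples ℤ[X] (UnitModule σ) p) t) (smul_mem_multiples t)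
    (by rw [mem_transporter, hq]; exact smul_mem_multiples _)
    (fun hmem => by
      obtain ⟨w, hw⟩ := mem_multiples.1 (mem_transporter.1 hmem)
      exact hne (toJ_one_eq_zero.2 ⟨w + c • t,
        by linear_combination (norm := module) hc • t + hw⟩)) g hg
  exact ⟨f' + q' * q, by linear_combination (norm := module) q' • hq⟩

theorem exists_mem_stageUnits {t : Kˣ} (ht : t ≠ 1) :
    ∃ i ≤ n, t ∈ stageUnits p σ (i : WithBot ℕ) ∧ t ∉ stageUnits p σ (prev i) := by
  classical
  have htop : t ∈ stageUnits p σ (n : WithBot ℕ) := by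
    change (t : K) ∈ stage p σ n
    rw [mem_stage, ← orderOf_generator hdeg hσ, pow_orderOf_eq_one]
    rfl
  have hex : ∃ i : ℕ, t ∈ stageUnits p σ (i : WithBot ℕ) := ⟨n, htop⟩
  refine ⟨Nat.find hex, Nat.find_min' hex htop, Nat.find_spec hex, ?_⟩
  have hlt : ∀ i < Nat.find hex, t ∉ stageUnits p σ (i : WithBot ℕ) := fun i => Nat.find_min hex
  cases h : Nat.find hex with
  | zero => exact ht
  | succ l => exact hlt l (by omega)

theorem exists_complementaryBasis_and_isCompl [NeZero m] (hp : p.Prime) (hn : 1 ≤ n) {ξ : F}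
    (hξ : IsPrimitiveRoot ξ p)
    (hnorm : p = 2 → n = 1 → ∃ γ : K, Algebra.norm F γ = -1)
    {a : ℕ → WithBot ℕ} {e : ℤ} {α : Kˣ} {δ : ℕ → Kˣ}
    (hmin : IsMinimalNormPair p n m σ ξ (fun i : Fin m => a i) (1 + p * e))
    (hrep : Represents p n m σ ξ (fun i : Fin m => a i) (1 + p * e) α (fun i => δ i)) :
    (∃ T : Set Kˣ, IsComplementaryBasis p n m σ α (fun i => δ i) T) ∧
      ∀ T : Set Kˣ, IsComplementaryBasis p n m σ α (fun i => δ i) T →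
        IsCompl (excModule F p m α (fun i => δ i)) (⨆ t ∈ T, cyc F p m t) := by
  classical
  have hx := ne_zero_of_primitiveRoot K hξ hp
  have H := isKummer hdeg hσ hp hn hx hξ
  have h := (rep_iff hdeg hσ hp hn hx a e α δ).2 hrep
  have hlex := lexMin_of_isMinimalNormPair hdeg hσ hp hn hx hmin
  have hm : 0 < m := Nat.pos_of_ne_zero (NeZero.ne m)
  have hsmall := exists_normSum_eq_rootOf hdeg hσ hξ hx hnorm
  have hfact : Fact (p ^ 1).Prime := ⟨by rwa [pow_one]⟩
  have hπ : ∀ x : UnitModule σ, toJ σ p 1 x = 0 ↔ ∃ w, x = (p : ℤ[X]) • w :=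
    fun x => toJ_one_eq_zero
  have h𝔽 : ∀ c : ZMod (p ^ 1), ∃ k : ℤ, c = k := fun c => by
    obtain ⟨k, hk⟩ := ZMod.intCast_surjective c
    exact ⟨k, hk.symm⟩
  have hbasis := mem_basisPart_iff (m := m) (σ := σ) α δ
  constructor
  · obtain ⟨T', hT1, hT2, hT3⟩ :=
      hlex.exists_complement H h hm hsmall hπ h𝔽 intModulo_X_sub_one
    refine ⟨{t | ofUnit σ t ∈ T'}, ?_, ?_⟩
    · rw [DirectSum.isInternal_submodule_iff_iSupIndep_and_iSup_eq_top]
      constructor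
      · rw [iSupIndep_cyc_iff hσ, ofUnit_comp_indexEquiv hbasis (fun _ => Iff.rfl)]
        exact CyclicIndep.comp_equiv hT3 _
      · rw [iSup_cyc_eq_top_iff hσ]
        intro Z hpZ hZ
        rw [pow_one] at hpZ
        refine hT2 Z hpZ ?_ ?_
        · intro x hx
          obtain ⟨u, rfl⟩ := ofUnit_surjective σ x
          exact hZ (Sum.inl ⟨u, (hbasis u).2 hx⟩)
        · intro x hx
          obtain ⟨u, rfl⟩ := ofUnit_surjective σ x
          exact hZ (Sum.inr ⟨u, hx⟩)
    · intro i hi t ht h1 h2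
      obtain ⟨k, hk, hkt, hne⟩ := hT1 _ ht
      obtain rfl := eq_of_normSum_ne_zero hkt hne h1 h2
      exact isFreeOverG_of_normSum hdeg hσ hp hi hkt hne
  · intro T hT
    obtain ⟨hind, htop⟩ := (DirectSum.isInternal_submodule_iff_iSupIndep_and_iSup_eq_top _).1
      hT.isInternal
    rw [iSupIndep_cyc_iff hσ] at hind
    rw [iSup_cyc_eq_top_iff hσ] at htop
    have hTimg : ∀ u, u ∈ T ↔ ofUnit σ u ∈ ofUnit σ '' T := fun u =>
      (ofUnit_injective σ).mem_set_image.symm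
    rw [ofUnit_comp_indexEquiv hbasis hTimg] at hind
    have hind' := hind.comp_equiv (indexEquiv hbasis hTimg).symm
    rw [Function.comp_assoc, Equiv.self_comp_symm, Function.comp_id] at hind'
    have hTY : ⨆ t ∈ T, cyc F p m t =
        Submodule.span (MonoidAlgebra (ZMod (p ^ m)) (K ≃ₐ[F] K))
          (toJ σ p m '' (ofUnit σ '' T)) := by
      rw [iSup_subtype', iSup_cyc_eq_span (σ := σ), Set.image_eq_range (ofUnit σ) T]
    have hmul : ∀ t ∈ ofUnit σ '' T, ∀ g : ℤ[X], g • t ∈ multiples ℤ[X] (UnitModule σ) p →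
        ∃ g' : ℤ[X], g • t = (p : ℤ[X]) • g' • t := by
      rintro _ ⟨t, ht, rfl⟩ g hg
      -- The unit `1` lies in stage `-∞`, so the freeness condition says nothing about it; it
      -- generates the zero module.
      by_cases h1 : t = 1
      · exact ⟨0, by rw [h1, ofUnit_one, smul_zero, smul_zero, smul_zero]⟩
      · obtain ⟨i, hi, h2, h3⟩ := exists_mem_stageUnits hdeg hσ h1
        exact exists_smul_eq_of_normSum hp ((mem_stageUnits σ).1 h2)
          (normSum_ne_zero_of_isFreeOverG hdeg hσ hp hi (hT.free i hi t ht h2 h3)) hg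
    rw [excModule_eq_span (σ := σ), hTY]
    set E := excSet m (ofUnit σ α) (fun i => ofUnit σ (δ i))
    constructor
    · rw [Submodule.disjoint_def]
      intro v hv1 hv2
      obtain ⟨y, hy, rfl⟩ := exists_of_mem_span_toJ σ hσ hv1
      obtain ⟨z, hz, hyz⟩ := exists_of_mem_span_toJ σ hσ hv2
      refine (toJ_eq_zero σ p m).2 (hlex.disjoint_of_complement H h hm hsmall hπ h𝔽
        intModulo_X_sub_one hmul hind' hy (neg_mem hz) ((toJ_eq_zero σ p m).1 ?_))
      rw [map_add, map_neg, hyz, add_neg_cancel]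
    · have hXS : ∀ x, ∃ y ∈ Submodule.span ℤ[X] E, ∃ z ∈ Submodule.span ℤ[X] (ofUnit σ '' T),
          ∃ w, x = y + z + (p : ℤ[X]) • w := by
        have hZ := htop (Submodule.span ℤ[X] E ⊔ Submodule.span ℤ[X] (ofUnit σ '' T) ⊔
          multiples ℤ[X] (UnitModule σ) p) (fun x => ?_) ?_
        · intro x
          have hx : x ∈ (⊤ : Submodule ℤ[X] (UnitModule σ)) := trivial
          rw [← hZ] at hx
          obtain ⟨_, hyz, _, hw, rfl⟩ := Submodule.mem_sup.1 hx
          obtain ⟨y, hy, z, hz, rfl⟩ := Submodule.mem_sup.1 hyz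
          obtain ⟨w, rfl⟩ := mem_multiples.1 hw
          exact ⟨y, hy, z, hz, w, rfl⟩
        · rw [pow_one]
          exact Submodule.mem_sup_right (smul_mem_multiples x)
        · rintro (⟨u, hu⟩ | ⟨u, hu⟩)
          · exact Submodule.mem_sup_left (Submodule.mem_sup_left
              (Submodule.subset_span ((hbasis u).1 hu)))
          · exact Submodule.mem_sup_left (Submodule.mem_sup_right
              (Submodule.subset_span ⟨u, hu, rfl⟩))
      rw [codisjoint_iff, eq_top_iff]
      intro v _
      obtain ⟨x, rfl⟩ := toJ_surjective σ p m v
      obtain ⟨y, hy, z, hz, w, rfl⟩ := exists_add_of_span_top hXS m x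
      rw [map_add, (toJ_eq_zero σ p m).2 ⟨w, rfl⟩, add_zero, map_add]
      exact Submodule.add_mem_sup (toJ_mem_span σ hy) (toJ_mem_span σ hz)

end Main

end KummerModule

theorem proposition7p1 {F K : Type*} [Field F] [Field K] [Algebra F K] [FiniteDimensional F K]
    [IsGalois F K] (p n m : ℕ) (hp : p.Prime) (hn : 1 ≤ n) [NeZero m]
    (hdeg : Module.finrank F K = p ^ n)
    (σ : K ≃ₐ[F] K) (hσ : ∀ g : K ≃ₐ[F] K, g ∈ Subgroup.zpowers σ)
    (ξ : F) (hξ : IsPrimitiveRoot ξ p)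
    (hnorm : p = 2 → n = 1 → ∃ γ : K, Algebra.norm F γ = -1) :
    (∀ X : Submodule (MonoidAlgebra (ZMod (p ^ m)) (K ≃ₐ[F] K)) (J K p m),
      IsExceptionalModule p n m σ ξ X → ∃ Y, IsCompl X Y) ∧
    (∀ (a : Fin m → WithBot ℕ) (d : ℤ) (α : Kˣ) (δ : Fin (m + 1) → Kˣ),
      IsMinimalNormPair p n m σ ξ a d → Represents p n m σ ξ a d α δ →
        (∃ T : Set Kˣ, IsComplementaryBasis p n m σ α δ T) ∧
        ∀ T : Set Kˣ, IsComplementaryBasis p n m σ α δ T →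
          IsCompl (excModule F p m α δ) (⨆ t ∈ T, cyc F p m t)) := by
  have main : ∀ (a : Fin m → WithBot ℕ) (d : ℤ) (α : Kˣ) (δ : Fin (m + 1) → Kˣ),
      IsMinimalNormPair p n m σ ξ a d → Represents p n m σ ξ a d α δ →
        (∃ T : Set Kˣ, IsComplementaryBasis p n m σ α δ T) ∧
        ∀ T : Set Kˣ, IsComplementaryBasis p n m σ α δ T →
          IsCompl (excModule F p m α δ) (⨆ t ∈ T, cyc F p m t) := by
    intro a d α δ hmin hrep
    obtain ⟨a, rfl⟩ := KummerModule.exists_vector_lift m a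
    obtain ⟨δ, rfl⟩ := KummerModule.exists_vector_lift (m + 1) δ
    obtain ⟨e, he⟩ : (p : ℤ) ^ 1 ∣ d - 1 := hrep.d_mem
    obtain rfl : d = 1 + p * e := by linarith [pow_one (p : ℤ)]
    exact KummerModule.exists_complementaryBasis_and_isCompl hdeg hσ hp hn hξ hnorm hmin hrep
  refine ⟨?_, main⟩
  rintro X ⟨a, d, α, δ, hmin, hrep, rfl⟩
  obtain ⟨⟨T, hT⟩, h⟩ := main a d α δ hmin hrep
  exact ⟨_, h T hT⟩
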